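/- Let $B=\prod_{k=1}^{\ell}\sigma_{i_k}^{\epsilon_k}$ be a braid word with $s$ strands and $\ell$ crossings whose closure in $S^3$ is a non-trivial knot. Consider the following algorithm with input $B$. (1) Fix heights $0=\theta_0<\theta_1<\dots<\theta_\ell=2\pi$ and real numbers $x_1<\dots<x_s$ representing the positions of the strands. Number the strands of $B$ by $j=0,\dots,s-1$ so that strand $j+1$ (mod $s$) starts where strand $j$ ends. By trigonometric interpolation with $s\ell$ data points, find a real trigonometric polynomial $F$ of degree at most $\lfloor s\ell/2\rfloor$ such that, for $0\le j<s$, $0\le k<\ell$, $F\big(\tfrac{\theta_k+2\pi j}{s}\big)=x_p$, where $p$ is the position of strand $j$ after the first $k$ letters of $B$. (2) By adding to $F$ an arbitrarily small trigonometric polynomial of degree at most $1$ and by an arbitrarily small shift of the variable $t$ moving no crossing through $t=0$, obtain $\tilde F$ such that the curves $\tilde F\big(\tfrac{t+2\pi j}{s}\big)$ intersect only transversely, in pairs, at different heights and not at $t=\pi$. The modification is such that the order of the curves at every $\theta_k$ (before the shift) is still the one given by $B$. (3) Put $g(u,e^{it})=\prod_{j=0}^{s-1}\big(u-\tilde F(\tfrac{2t+2\pi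 j}{s})\big)$. (4) Put $p_k(u,re^{it})=r^{2ks}g(u/r^{2k},e^{it})$, where $2ks$ is greater than the degree of $g$ with respect to $e^{\pm it}$. (5) Let $t_1<\dots<t_{\ell'}$ in $[0,2\pi]$ be the heights of the crossings of the curves $\tilde F\big(\tfrac{t+2\pi j}{s}\big)$, let $j_n$ be the position of the crossing at $t_n$ (it exchanges the $j_n$-th and $(j_n+1)$-th curves from the left), and choose signs $\varepsilon_n\in\{\pm1\}$ such that $\prod_n\sigma_{j_n}^{\varepsilon_n}$ is braid isotopic to $B$. Find a trigonometric polynomial $\tilde A:S^1\to\mathbb C$ of degree at most $\ell'$ such that, for all $n$, $\tilde A(e^{it_n})$ is real, non-zero and has the sign of the value of $\prod_j\big(u-\tilde F(\tfrac{t+2\pi j}{s})\big)$ at its critical point in $u$ between the two roots that collide at $t=t_n$, for $t$ near $t_n$, and such that $\partial_t\arg\tilde A(e^{it})=\varepsilon_n$ at $t=t_n$. Put $A(e^{it})=\tilde A(e^{2it})\cos t$. (6) Put $f(u,re^{it})=p_k(u,re^{it})+r^mA(e^{it})$, where $m$ is odd, larger than $2ks$ and larger than the degree of $A$ with respect to $e^{\pm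 it}$. Then the algorithm can be carried out (for every choice of the $\theta_k$, of the $x_p$, of the strand with label $0$, and of a bound on the size of the modifications in (2)). However its other steps are carried out, if $k$ and then $m$ are chosen as small as allowed, the function $f$ is a polynomial in $u$, $v$ and $\bar v$ (where $v=re^{it}$), and its degree satisfies $$\deg(f)\le 2s\ell(s+1)+1.$$ -/

import Mathlib

/-! ### Braid words, the braid group and closures -/

/-- A braid word on `s` strands. The letter `(i, ε)` is the Artin generator `σ_{i+1}^ε`, which
exchanges the strands in the positions `i` and `i + 1` (positions are numbered from `0` by
increasing real part). Letters are read in the direction of increasing height. -/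
abbrev BraidWord (s : ℕ) : Type := List (Fin (s - 1) × ℤˣ)

/-- The defining relators of the braid group on `s` strands. -/
def braidRelators (s : ℕ) : Set (FreeGroup (Fin (s - 1))) :=
  {x | ∃ i j : Fin (s - 1), (i : ℕ) + 1 < j ∧
      x = .of i * .of j * (FreeGroup.of j * .of i)⁻¹} ∪
  {x | ∃ i j : Fin (s - 1), (i : ℕ) + 1 = j ∧
      x = .of i * .of j * .of i * (FreeGroup.of j * .of i * .of j)⁻¹}

/-- The braid group on `s` strands: braids up to braid isotopy. -/
abbrev BraidGroup (s : ℕ) : Type := PresentedGroup (braidRelators s)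

/-- The braid represented by a braid word. -/
def BraidWord.toBraid {s : ℕ} (w : BraidWord s) : BraidGroup s :=
  (w.map fun a => (PresentedGroup.of a.1 : BraidGroup s) ^ (a.2 : ℤ)).prod

/-- The 3-sphere in `ℂ²`. -/
abbrev ThreeSphere : Type := {p : ℂ × ℂ // ‖p.1‖ ^ 2 + ‖p.2‖ ^ 2 = 1}

/-- The untwisted embedding of the open solid torus `ℂ × S¹` in the 3-sphere, with the unknot
`{u = 0}` as core: `(z, e^{iθ}) ↦ (z, e^{iθ}) / √(1 + |z|²)`. -/
noncomputable def torusEmbedding (z : ℂ) (θ : ℝ) : ThreeSphere :=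
  ⟨(z / (√(1 + ‖z‖ ^ 2) : ℝ), Complex.exp (θ * Complex.I) / (√(1 + ‖z‖ ^ 2) : ℝ)), by
    have h : (0 : ℝ) < 1 + ‖z‖ ^ 2 := by positivity
    simp only [norm_div, Complex.norm_exp_ofReal_mul_I, Complex.norm_real, Real.norm_eq_abs,
      div_pow, sq_abs, Real.sq_sqrt h.le]
    field_simp
    ring⟩

/-- The motion of the strand in position `p` while the letter `a` is performed, `x ∈ [0,1]`:
the strands in the positions `i`, `i + 1` make half a turn about their midpoint, anticlockwise
for `σ_{i+1}` and clockwise for its inverse, and all other strands stay where they are. In the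
anticlockwise half turn the strand coming from the left has the smaller imaginary part, hence it
is the overcrossing strand and the crossing is positive. With `none` nothing moves. -/
noncomputable def letterMotion {s : ℕ} (a : Option (Fin (s - 1) × ℤˣ)) (p : Fin s) (x : ℝ) : ℂ :=
  match a with
  | none => (p : ℕ)
  | some (i, ε) =>
    if (p : ℕ) = i then
      (i : ℕ) + 1 / 2 - 1 / 2 * Complex.exp (((ε : ℤ) : ℂ) * Real.pi * x * Complex.I)
    else if (p : ℕ) = i + 1 then
      (i : ℕ) + 1 / 2 + 1 / 2 * Complex.exp (((ε : ℤ) : ℂ) * Real.pi * x * Complex.I)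
    else (p : ℕ)

/-- The closure of the braid given by a word, as a subset of the 3-sphere. The circle of heights
is divided into `w.length + 1` equal parts; the letters of `w` are performed in the first
`w.length` of them, and all strands are constant in the last one. -/
def BraidWord.closure {s : ℕ} (w : BraidWord s) : Set ThreeSphere :=
  {q | ∃ (k : ℕ) (p : Fin s) (x : ℝ), k ≤ w.length ∧ x ∈ Set.Icc (0 : ℝ) 1 ∧
    q = torusEmbedding (letterMotion w[k]? p x) (2 * Real.pi * (k + x) / (w.length + 1))}

/-- Ambient isotopy of subsets of the 3-sphere. -/
def AmbientIsotopic (K K' : Set ThreeSphere) : Prop :=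
  ∃ H : unitInterval → (ThreeSphere ≃ₜ ThreeSphere),
    Continuous (fun p : unitInterval × ThreeSphere => H p.1 p.2) ∧
    H 0 = Homeomorph.refl ThreeSphere ∧ H 1 '' K = K'

/-- The standard unknot. -/
def unknot : Set ThreeSphere := {q | q.1.1 = 0}

/-- A knot: a link with exactly one component, i.e. a (homeomorphic) circle. -/
def IsKnot (K : Set ThreeSphere) : Prop := Nonempty (K ≃ₜ Circle)

/-- A knot which is not ambient isotopic to the unknot. -/
def IsNontrivialKnot (K : Set ThreeSphere) : Prop := IsKnot K ∧ ¬ AmbientIsotopic K unknot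

/-! ### Positions of the strands -/

/-- The transposition of the positions `i` and `i + 1`. -/
def adjacentSwap {s : ℕ} (i : Fin (s - 1)) : Equiv.Perm (Fin s) :=
  Equiv.swap ⟨i, by omega⟩ ⟨i + 1, by omega⟩

/-- Start position of a strand `↦` its position after the first `k` letters. -/
def BraidWord.position {s : ℕ} (w : BraidWord s) (k : ℕ) : Equiv.Perm (Fin s) :=
  (w.take k).foldl (fun π a => adjacentSwap a.1 * π) 1

/-- Consecutive strands of a braid closing to a knot: strand `0` starts in position `b`, and
strand `j + 1` starts where strand `j` ends. This is the position of strand `j` after the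
first `k` letters. -/
def BraidWord.strandPosition {s : ℕ} (w : BraidWord s) (b : Fin s) (j : Fin s) (k : ℕ) : Fin s :=
  w.position k ((w.position w.length ^ (j : ℕ)) b)

/-! ### Trigonometric polynomials and the strands they parametrize -/

/-- `f(t)` is a trigonometric polynomial of degree at most `d`, i.e. a Laurent polynomial in
`e^{it}` with exponents in `[-d, d]`. -/
def IsTrigPoly (d : ℕ) (f : ℝ → ℂ) : Prop :=
  ∃ c : ℤ → ℂ, ∀ t : ℝ,
    f t = ∑ n ∈ Finset.Icc (-(d : ℤ)) d, c n * Complex.exp (n * t * Complex.I)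

/-- The `j`-th strand `F((t + 2πj)/s)` of the closed curve on `s` strands parametrized by `F`. -/
noncomputable def strand {s : ℕ} (F : ℝ → ℝ) (j : Fin s) (t : ℝ) : ℝ :=
  F ((t + 2 * Real.pi * (j : ℕ)) / s)

/-- The strands of `F` have a (singular) crossing at `t`. -/
def IsCrossingTime (s : ℕ) (F : ℝ → ℝ) (t : ℝ) : Prop :=
  ∃ i j : Fin s, i ≠ j ∧ strand F i t = strand F j t

/-- `F` is generic: its strands form a singular braid. All intersections are transverse and
involve exactly two strands; moreover different intersections have different heights, so that
the singular braid is read off as a word. -/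
def IsGeneric (s : ℕ) (F : ℝ → ℝ) : Prop :=
  ∀ (t : ℝ) (i j : Fin s), i ≠ j → strand F i t = strand F j t →
    deriv (strand F i) t ≠ deriv (strand F j) t ∧
    ∀ i' j' : Fin s, i' ≠ j' → strand F i' t = strand F j' t → s(i', j') = s(i, j)

/-- The value `v` has the sign of the critical point associated with the crossing of the strands
`i` and `j` at `t₀`: for `t` close to `t₀`, it has the sign of `∏ q, (c - X_q(t))` at the critical
point `c` of this polynomial between its roots `X_i(t)` and `X_j(t)`. -/
def HasCriticalSign {s : ℕ} (F : ℝ → ℝ) (i j : Fin s) (t₀ v : ℝ) : Prop :=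
  ∀ᶠ t in nhdsWithin t₀ {t₀}ᶜ, ∀ c : ℝ,
    min (strand F i t) (strand F j t) < c → c < max (strand F i t) (strand F j t) →
    deriv (fun x => ∏ q : Fin s, (x - strand F q t)) c = 0 →
    0 < v * ∏ q : Fin s, (c - strand F q t)

/-- The derivative of the argument of a complex-valued function of a real variable. -/
noncomputable def argDeriv (A : ℝ → ℂ) (t : ℝ) : ℝ :=
  ((A t).re * deriv (fun x => (A x).im) t - (A t).im * deriv (fun x => (A x).re) t) / ‖A t‖ ^ 2

/-! ### The algorithm, for braids that close to a knot -/

/-- The choice of interpolation data in the first step: the start position of the strand with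
label `0`, heights `0 = t_0 < ... < t_ℓ = 2π` (the `k`-th letter is performed between
`t_k` and `t_{k+1}`), and the real parts assigned to the `s` positions. -/
structure InterpolationData {s : ℕ} (w : BraidWord s) where
  base : Fin s
  node : Fin (w.length + 1) → ℝ
  node_strictMono : StrictMono node
  node_zero : node 0 = 0
  node_last : node (Fin.last w.length) = 2 * Real.pi
  level : Fin s → ℝ
  level_strictMono : StrictMono level

/-- An execution, on the braid word `w`, of the steps of the algorithm that produce the
trigonometric polynomials from which the output is formed. The modifications that make the
parametrization generic have size less than `η`. -/
structure Execution {s : ℕ} (w : BraidWord s) (D : InterpolationData w) (η : ℝ) where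
  /-- Step 1: trigonometric interpolation of the positions of the strands at the
  `s * ℓ` data points, by a trigonometric polynomial of degree at most `⌊s * ℓ / 2⌋`. -/
  F : ℝ → ℝ
  F_trig : IsTrigPoly (s * w.length / 2) (fun t => (F t : ℂ))
  F_interpolates : ∀ (j : Fin s) (k : Fin w.length),
    F ((D.node k.castSucc + 2 * Real.pi * (j : ℕ)) / s) =
      D.level (w.strandPosition D.base j k)
  /-- Step 2: a small term of degree at most one makes the parametrization generic ... -/
  Fgen : ℝ → ℝ
  Fgen_eq : ∃ c a b : ℝ, |c| < η ∧ |a| < η ∧ |b| < η ∧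
    ∀ t, Fgen t = F t + (c + a * Real.cos t + b * Real.sin t)
  Fgen_generic : IsGeneric s Fgen
  /-- ... and keeps, at all the heights `t_k`, the order of the strands given by the word, so
  that from `t_k` to `t_{k+1}` the strands undergo the transposition given by the `k`-th letter. -/
  Fgen_order : ∀ (k : Fin (w.length + 1)) (i j : Fin s),
    w.strandPosition D.base i k < w.strandPosition D.base j k →
      strand Fgen i (D.node k) < strand Fgen j (D.node k)
  /-- A small shift of the variable `t`, moving no crossing through `t = 0`, after which there is
  no crossing at `t = π`. -/
  shift : ℝ
  shift_small : |shift| < η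
  shift_no_crossing : ∀ t ∈ Set.uIcc 0 shift, ¬ IsCrossingTime s Fgen t
  Ft : ℝ → ℝ
  Ft_eq : ∀ t, Ft t = Fgen (t + shift / s)
  Ft_pi : ¬ IsCrossingTime s Ft Real.pi
  /-- The singular braid formed by the strands of `Ft`: its crossings, in the order of their
  heights `time k`, the two strands `fst k` and `snd k` crossing there, and the letter
  `letter k`, i.e. the number of strands to the left of the crossing. -/
  crossings : ℕ
  time : Fin crossings → ℝ
  time_strictMono : StrictMono time
  range_time : Set.range time = {t ∈ Set.Icc 0 (2 * Real.pi) | IsCrossingTime s Ft t}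
  fst : Fin crossings → Fin s
  snd : Fin crossings → Fin s
  fst_ne_snd : ∀ k, fst k ≠ snd k
  fst_eq_snd : ∀ k, strand Ft (fst k) (time k) = strand Ft (snd k) (time k)
  letter : Fin crossings → Fin (s - 1)
  letter_eq : ∀ k, (letter k : ℕ) =
    Nat.card {q : Fin s // strand Ft q (time k) < strand Ft (fst k) (time k)}
  /-- Signs for the crossings which give a braid isotopic to the input. -/
  sign : Fin crossings → ℤˣ
  sign_isotopic :
    BraidWord.toBraid (List.ofFn fun k => (letter k, sign k)) = w.toBraid
  /-- The data of the interpolation problem. -/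
  y : Fin crossings → ℝ
  y_sign : ∀ k, HasCriticalSign Ft (fst k) (snd k) (time k) (y k / Real.cos (time k / 2))
  /-- A solution of the interpolation problem, of degree at most the number of crossings. -/
  At : ℝ → ℂ
  At_trig : IsTrigPoly crossings At
  At_value : ∀ k, At (time k) = ((y k / Real.cos (time k / 2) : ℝ) : ℂ)
  At_arg : ∀ k, argDeriv At (time k) = ((sign k : ℤ) : ℝ)

namespace Execution

variable {s : ℕ} {w : BraidWord s} {D : InterpolationData w} {η : ℝ}

/-- `g(u, e^{it}) = ∏ j, (u - F̃((2t + 2πj)/s))`. -/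
noncomputable def g (R : Execution w D η) (u : ℂ) (t : ℝ) : ℂ :=
  ∏ j : Fin s, (u - (strand R.Ft j (2 * t) : ℂ))

/-- `A(e^{it}) = Ã(e^{2it}) cos t`. -/
noncomputable def A (R : Execution w D η) (t : ℝ) : ℂ :=
  R.At (2 * t) * (Real.cos t : ℂ)

/-- `2ks` is greater than the degree of `g` with respect to `e^{it}` and `e^{-it}`. -/
def AdmissibleK (R : Execution w D η) (k : ℕ) : Prop :=
  ∃ n < 2 * k * s, ∀ u : ℂ, IsTrigPoly n (R.g u)

/-- `m` is odd, larger than `2ks`, and larger than the degree of `A` with respect to `e^{it}` and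
`e^{-it}`. -/
def AdmissibleM (R : Execution w D η) (k m : ℕ) : Prop :=
  Odd m ∧ 2 * k * s < m ∧ ∃ n < m, IsTrigPoly n R.A

/-- The polynomial `f` in `u`, `v` and the conjugate of `v` (the variables `0`, `1`, `2`) is the
output for the exponents `k` and `m`: for `r > 0`,
`f(u, re^{it}) = r^{2ks} g(u / r^{2k}, e^{it}) + r^m A(e^{it})`. -/
def IsOutput (R : Execution w D η) (k m : ℕ) (f : MvPolynomial (Fin 3) ℂ) : Prop :=
  ∀ (u : ℂ) (r t : ℝ), 0 < r →
    MvPolynomial.eval ![u, r * Complex.exp (t * Complex.I),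
        (starRingEnd ℂ) (r * Complex.exp (t * Complex.I))] f =
      (r : ℂ) ^ (2 * k * s) * R.g (u / (r : ℂ) ^ (2 * k)) t + (r : ℂ) ^ m * R.A t

end Execution

/-! Two things are needed: the choices demanded by the algorithm exist, and every possible choice
leads to the degree bound.

Degree. Let N ≤ ⌊sℓ/2⌋ be the least degree of F̃. A crossing of two strands whose labels differ by d
is a zero of F̃(x) - F̃(x + 2πd/s), a trigonometric polynomial with at most 2N zeros on the circle
that does not vanish identically, by transversality. Summing over d bounds the number ℓ' of
crossings by s·sℓ (`crossings_le`). As A has degree at most 2ℓ' + 1, the odd number 2sℓ(s+1) + 1 is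
an admissible m, and f has degree at most m once it is a polynomial. The term r^m A is one because
A(t + π) = -A(t) leaves only odd frequencies, of the same parity as m. In g, the coefficient of u^a
is symmetric in the strands, hence a trigonometric polynomial in 2t, of degree at most (s-a)N/s; the
factor r^{2k(s-a)} turns it into a polynomial if N ≤ ks. This inequality follows from the condition
on k because g(0, ·) has degree at least 2N: extreme coefficients multiply without cancellation
(`two_mul_le_of_isTrigPoly_prod`).

Existence. A knot is connected, so the permutation of the braid is a single cycle
(`isCycleOn_of_isKnot`), the strands can be numbered consecutively, and the interpolated F passes
through the right positions at all heights. Adding a cos t + b sin t makes F generic: each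
degeneracy confines (a, b) to countably many C¹ curves, whose union has Hausdorff dimension at most
1 and so has dense complement (`exists_isGeneric`). The one obstruction, two pairs of strands with
proportional differences, is incompatible with a braid word on a cyclic permutation
(`exists_sub_ne_mul_sub`).

Between consecutive heights the crossings of the generic curves spell some word in adjacent
transpositions whose product is a single one, τ_i, whereas signs are wanted that give σ_i^ε. Let the
strands lie in layers, ordered by their positions at the start of the interval. The resulting braid
depends only on the permutation: acting on pairs (permutation, braid), layered crossings satisfy
Coxeter's relations, and these imply all relations between adjacent transpositions
(`CoxeterRelations.prod_eq_one`, `exists_signs`). Finally Ã = a + ib, where a takes the required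
real values and b vanishes at the crossings with prescribed derivative. -/

/-! ### Trigonometric polynomials -/

/-- `f(t)` is `e^{-int/2}` times a polynomial of degree at most `n` in `e^{it}`. -/
def IsHalfTrig (n : ℕ) (f : ℝ → ℂ) : Prop :=
  ∃ P : Polynomial ℂ, P.natDegree ≤ n ∧
    ∀ t : ℝ, f t * Complex.exp (n * t / 2 * Complex.I) = P.eval (Complex.exp (t * Complex.I))

theorem sum_Icc_neg_eq_sum_range (d : ℕ) (φ : ℤ → ℂ) :
    ∑ n ∈ Finset.Icc (-(d : ℤ)) d, φ n = ∑ m ∈ Finset.range (2 * d + 1), φ ((m : ℤ) - d) := by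
  refine Finset.sum_nbij' (fun n => (n + d).toNat) (fun m => (m : ℤ) - d) ?_ ?_ ?_ ?_ ?_
  · intro n hn
    simp only [Finset.mem_Icc, Finset.mem_range] at *
    omega
  · intro n hn
    simp only [Finset.mem_Icc, Finset.mem_range] at *
    omega
  · intro n hn
    simp only [Finset.mem_Icc] at *
    omega
  · intro n hn
    simp
  · intro n hn
    simp only [Finset.mem_Icc] at hn
    congr 1
    omega

/-- Half-integral frequencies are admitted so that sin((t - a)/2), with a single zero on the circle,
can serve as a linear factor. The indices add under multiplication, and an even total leads back to
trigonometric polynomials. -/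
theorem isTrigPoly_iff_isHalfTrig {d : ℕ} {f : ℝ → ℂ} :
    IsTrigPoly d f ↔ IsHalfTrig (2 * d) f := by
  have key : ∀ (t : ℝ) (m : ℕ), Complex.exp ((((m : ℤ) - d : ℤ) : ℂ) * t * Complex.I) *
      Complex.exp (((2 * d : ℕ) : ℂ) * t / 2 * Complex.I) = Complex.exp (t * Complex.I) ^ m := by
    intro t m
    rw [← Complex.exp_add, ← Complex.exp_nat_mul]
    congr 1
    push_cast
    ring
  constructor
  · rintro ⟨c, hc⟩
    refine ⟨∑ m ∈ Finset.range (2 * d + 1), Polynomial.C (c ((m : ℤ) - d)) * Polynomial.X ^ m,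
      ?_, fun t => ?_⟩
    · refine Polynomial.natDegree_sum_le_of_forall_le _ _ fun m hm => ?_
      refine (Polynomial.natDegree_C_mul_X_pow_le _ _).trans ?_
      simp only [Finset.mem_range] at hm
      omega
    · rw [hc, sum_Icc_neg_eq_sum_range, Finset.sum_mul, Polynomial.eval_finsetSum]
      refine Finset.sum_congr rfl fun m _ => ?_
      rw [mul_assoc, key]
      simp
  · rintro ⟨P, hP, h⟩
    refine ⟨fun n => P.coeff (n + d).toNat, fun t => ?_⟩
    rw [sum_Icc_neg_eq_sum_range]
    have he : Complex.exp (((2 * d : ℕ) : ℂ) * t / 2 * Complex.I) ≠ 0 := Complex.exp_ne_zero _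
    apply mul_right_cancel₀ he
    rw [h, Finset.sum_mul, Polynomial.eval_eq_sum_range' (Nat.lt_succ_of_le hP)]
    refine Finset.sum_congr rfl fun m _ => ?_
    rw [mul_assoc, key]
    simp

namespace IsHalfTrig

variable {n m : ℕ} {f g : ℝ → ℂ}

theorem mul (hf : IsHalfTrig n f) (hg : IsHalfTrig m g) :
    IsHalfTrig (n + m) (fun t => f t * g t) := by
  obtain ⟨P, hP, hf⟩ := hf
  obtain ⟨Q, hQ, hg⟩ := hg
  refine ⟨P * Q, Polynomial.natDegree_mul_le.trans (by omega), fun t => ?_⟩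
  rw [Polynomial.eval_mul, ← hf, ← hg]
  have : Complex.exp (((n + m : ℕ) : ℂ) * t / 2 * Complex.I) =
      Complex.exp (n * t / 2 * Complex.I) * Complex.exp (m * t / 2 * Complex.I) := by
    rw [← Complex.exp_add]
    congr 1
    push_cast
    ring
  rw [this]
  ring

theorem congr (h : ∀ t, f t = g t) (hf : IsHalfTrig n f) : IsHalfTrig n g := by
  rwa [← funext h]

theorem add (hf : IsHalfTrig n f) (hg : IsHalfTrig n g) :
    IsHalfTrig n (fun t => f t + g t) := by
  obtain ⟨P, hP, hf⟩ := hf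
  obtain ⟨Q, hQ, hg⟩ := hg
  refine ⟨P + Q, Polynomial.natDegree_add_le_of_degree_le hP hQ, fun t => ?_⟩
  rw [Polynomial.eval_add, ← hf, ← hg]
  ring

theorem const (c : ℂ) : IsHalfTrig 0 (fun _ => c) :=
  ⟨Polynomial.C c, by simp, fun t => by simp⟩

theorem const_mul (c : ℂ) (hf : IsHalfTrig n f) : IsHalfTrig n (fun t => c * f t) := by
  simpa using (const c).mul hf

theorem sin_half (a : ℝ) : IsHalfTrig 1 (fun t => ((Real.sin ((t - a) / 2) : ℝ) : ℂ)) := by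
  refine ⟨Polynomial.C (Complex.exp (-(a / 2) * Complex.I) / (2 * Complex.I)) * Polynomial.X -
    Polynomial.C (Complex.exp (a / 2 * Complex.I) / (2 * Complex.I)), ?_, fun t => ?_⟩
  · refine (Polynomial.natDegree_sub_le _ _).trans ?_
    simp only [Polynomial.natDegree_C, max_le_iff, Nat.zero_le, and_true]
    exact (Polynomial.natDegree_C_mul_le _ _).trans Polynomial.natDegree_X_le
  · have h1 : Complex.exp (t * Complex.I) =
        Complex.exp (t / 2 * Complex.I) * Complex.exp (t / 2 * Complex.I) := by
      rw [← Complex.exp_add]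
      congr 1
      ring
    have h2 : Complex.exp (((t : ℂ) - a) / 2 * Complex.I) =
        Complex.exp (t / 2 * Complex.I) * Complex.exp (-(a / 2) * Complex.I) := by
      rw [← Complex.exp_add]
      congr 1
      ring
    have h3 : Complex.exp (-(((t : ℂ) - a) / 2) * Complex.I) =
        Complex.exp (-(t / 2) * Complex.I) * Complex.exp (a / 2 * Complex.I) := by
      rw [← Complex.exp_add]
      congr 1
      ring
    have h4 : Complex.exp (-((t : ℂ) / 2) * Complex.I) * Complex.exp (t / 2 * Complex.I) = 1 := by
      rw [← Complex.exp_add]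
      simp
    simp only [Complex.ofReal_sin, Complex.ofReal_div, Complex.ofReal_sub, Complex.ofReal_ofNat,
      Polynomial.eval_sub, Polynomial.eval_mul, Polynomial.eval_C, Polynomial.eval_X, Complex.sin,
      Nat.cast_one, one_mul]
    rw [h2, h3, h1]
    generalize Complex.exp (-(a / 2 : ℂ) * Complex.I) = x at *
    generalize Complex.exp (-(t / 2 : ℂ) * Complex.I) = y at *
    generalize Complex.exp ((a / 2 : ℂ) * Complex.I) = z at *
    generalize Complex.exp ((t / 2 : ℂ) * Complex.I) = v at *
    have hI : Complex.I ≠ 0 := Complex.I_ne_zero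
    field_simp
    linear_combination (Complex.I ^ 2 * z) * h4 + (z - v ^ 2 * x) * Complex.I_sq

theorem prod {ι : Type*} (J : Finset ι) (n : ι → ℕ) (f : ι → ℝ → ℂ)
    (h : ∀ i ∈ J, IsHalfTrig (n i) (f i)) :
    IsHalfTrig (∑ i ∈ J, n i) (fun t => ∏ i ∈ J, f i t) := by
  classical
  induction J using Finset.induction_on with
  | empty => simpa using const 1
  | insert a J ha ih =>
    simp only [Finset.sum_insert ha, Finset.prod_insert ha]
    exact (h a (Finset.mem_insert_self a J)).mul
      (ih fun i hi => h i (Finset.mem_insert_of_mem hi))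

end IsHalfTrig

namespace IsTrigPoly

variable {d e : ℕ} {f g : ℝ → ℂ}

theorem congr (h : ∀ t, f t = g t) (hf : IsTrigPoly d f) : IsTrigPoly d g := by
  rwa [← funext h]

theorem mul (hf : IsTrigPoly d f) (hg : IsTrigPoly e g) :
    IsTrigPoly (d + e) (fun t => f t * g t) := by
  rw [isTrigPoly_iff_isHalfTrig] at *
  simpa [mul_add] using hf.mul hg

theorem mono (h : d ≤ e) (hf : IsTrigPoly d f) : IsTrigPoly e f := by
  obtain ⟨c, hc⟩ := hf
  refine ⟨fun n => if n ∈ Finset.Icc (-(d : ℤ)) d then c n else 0, fun t => ?_⟩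
  rw [hc]
  simp only [ite_mul, zero_mul]
  rw [← Finset.sum_filter, Finset.filter_mem_eq_inter, Finset.inter_eq_right.mpr]
  intro n hn
  simp only [Finset.mem_Icc] at *
  omega

theorem const (d : ℕ) (c : ℂ) : IsTrigPoly d (fun _ => c) :=
  mono (Nat.zero_le d) (isTrigPoly_iff_isHalfTrig.2 (by simpa using IsHalfTrig.const c))

theorem add (hf : IsTrigPoly d f) (hg : IsTrigPoly d g) : IsTrigPoly d (fun t => f t + g t) := by
  rw [isTrigPoly_iff_isHalfTrig] at *
  exact hf.add hg

theorem const_mul (c : ℂ) (hf : IsTrigPoly d f) : IsTrigPoly d (fun t => c * f t) := by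
  rw [isTrigPoly_iff_isHalfTrig] at *
  exact hf.const_mul c

theorem sub (hf : IsTrigPoly d f) (hg : IsTrigPoly d g) : IsTrigPoly d (fun t => f t - g t) :=
  (hf.add (hg.const_mul (-1))).congr fun t => by ring

theorem sum {ι : Type*} (J : Finset ι) (f : ι → ℝ → ℂ) (h : ∀ i ∈ J, IsTrigPoly d (f i)) :
    IsTrigPoly d (fun t => ∑ i ∈ J, f i t) := by
  classical
  induction J using Finset.induction_on with
  | empty => simpa using const d 0
  | insert a J ha ih =>
    simp only [Finset.sum_insert ha]
    exact (h a (Finset.mem_insert_self a J)).add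
      (ih fun i hi => h i (Finset.mem_insert_of_mem hi))

theorem comp_add (a : ℝ) (hf : IsTrigPoly d f) : IsTrigPoly d (fun t => f (t + a)) := by
  obtain ⟨c, hc⟩ := hf
  refine ⟨fun n => c n * Complex.exp (n * a * Complex.I), fun t => ?_⟩
  beta_reduce
  rw [hc]
  refine Finset.sum_congr rfl fun n _ => ?_
  rw [mul_assoc (c n), ← Complex.exp_add]
  push_cast
  congr 2
  ring

theorem comp_neg (hf : IsTrigPoly d f) : IsTrigPoly d (fun t => f (-t)) := by
  obtain ⟨c, hc⟩ := hf
  refine ⟨fun n => c (-n), fun t => ?_⟩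
  beta_reduce
  rw [hc]
  refine Finset.sum_nbij' (fun n => -n) (fun n => -n) ?_ ?_ ?_ ?_ ?_
  · intro n hn
    simp only [Finset.mem_Icc] at *
    omega
  · intro n hn
    simp only [Finset.mem_Icc] at *
    omega
  · simp
  · simp
  · intro n _
    simp

theorem periodic (hf : IsTrigPoly d f) : Function.Periodic f (2 * Real.pi) := by
  obtain ⟨c, hc⟩ := hf
  intro t
  rw [hc, hc]
  refine Finset.sum_congr rfl fun n _ => ?_
  congr 1
  rw [Complex.exp_eq_exp_iff_exists_int]
  exact ⟨n, by push_cast; ring⟩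

theorem contDiff (hf : IsTrigPoly d f) : ContDiff ℝ ⊤ f := by
  obtain ⟨c, hc⟩ := hf
  rw [funext hc]
  refine ContDiff.sum fun n _ => contDiff_const.mul ?_
  refine ContDiff.cexp ?_
  exact (contDiff_const.mul Complex.ofRealCLM.contDiff).mul contDiff_const

theorem exists_polynomial (hf : IsTrigPoly d f) : ∃ P : Polynomial ℂ, P.natDegree ≤ 2 * d ∧
    ∀ t : ℝ, f t * Complex.exp (d * t * Complex.I) = P.eval (Complex.exp (t * Complex.I)) := by
  obtain ⟨P, hP, h⟩ := isTrigPoly_iff_isHalfTrig.1 hf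
  refine ⟨P, hP, fun t => ?_⟩
  rw [← h]
  congr 3
  push_cast
  ring

theorem sin_sub (a : ℝ) : IsTrigPoly 1 (fun t => ((Real.sin (t - a) : ℝ) : ℂ)) := by
  -- The double angle formula: the factor with a - π is cos((t - a)/2).
  have h := (((IsHalfTrig.sin_half a).mul (IsHalfTrig.sin_half (a - Real.pi))).const_mul 2)
  rw [isTrigPoly_iff_isHalfTrig]
  refine h.congr fun t => ?_
  rw [show t - a = 2 * ((t - a) / 2) by ring, Real.sin_two_mul,
    show (t - (a - Real.pi)) / 2 = (t - a) / 2 + Real.pi / 2 by ring, Real.sin_add_pi_div_two,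
    show 2 * ((t - a) / 2) / 2 = (t - a) / 2 by ring]
  push_cast
  ring

theorem sin : IsTrigPoly 1 (fun t => ((Real.sin t : ℝ) : ℂ)) := by
  simpa using sin_sub 0

theorem cos : IsTrigPoly 1 (fun t => ((Real.cos t : ℝ) : ℂ)) :=
  (sin.comp_add (Real.pi / 2)).congr fun t => by rw [Real.sin_add_pi_div_two]

/-- A trigonometric polynomial in `t` which has the period `2π/s` is one in `st`. -/
theorem descend {s : ℕ} (hs : 0 < s) (hf : IsTrigPoly d f)
    (hp : Function.Periodic f (2 * Real.pi / s)) : IsTrigPoly (d / s) (fun t => f (t / s)) := by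
  obtain ⟨c, hc⟩ := hf
  have hs' : (s : ℂ) ≠ 0 := by exact_mod_cast hs.ne'
  -- Averaging over the s translates by multiples of 2π/s does not change f and kills every
  -- frequency not divisible by s.
  have havg : ∀ t, f t = ∑ n ∈ Finset.Icc (-(d : ℤ)) d,
      if (s : ℤ) ∣ n then c n * Complex.exp (n * t * Complex.I) else 0 := by
    intro t
    apply mul_left_cancel₀ hs'
    have h1 : (s : ℂ) * f t = ∑ j ∈ Finset.range s, f (t + j * (2 * Real.pi / s)) := by
      rw [Finset.sum_congr rfl fun j _ => hp.nat_mul j t]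
      simp
    rw [h1]
    simp only [hc]
    rw [Finset.sum_comm, Finset.mul_sum]
    refine Finset.sum_congr rfl fun n _ => ?_
    have h2 : ∀ j : ℕ, c n * Complex.exp (n * ((t + j * (2 * Real.pi / s) : ℝ) : ℂ) * Complex.I) =
        c n * Complex.exp (n * t * Complex.I) *
          Complex.exp (n * (2 * Real.pi / s) * Complex.I) ^ j := by
      intro j
      rw [← Complex.exp_nat_mul, mul_assoc (c n), ← Complex.exp_add]
      congr 2
      push_cast
      ring
    simp only [h2, ← Finset.mul_sum]
    set z := Complex.exp (n * (2 * Real.pi / s) * Complex.I) with hz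
    have hzs : z ^ s = 1 := by
      rw [hz, ← Complex.exp_nat_mul, Complex.exp_eq_one_iff]
      exact ⟨n, by field_simp⟩
    split_ifs with hd
    · obtain ⟨q, rfl⟩ := hd
      have : z = 1 := by
        rw [hz, Complex.exp_eq_one_iff]
        exact ⟨q, by push_cast; field_simp⟩
      simp [this]
      ring
    · have hz1 : z ≠ 1 := by
        rw [hz, Ne, Complex.exp_eq_one_iff]
        rintro ⟨q, hq⟩
        apply hd
        refine ⟨q, ?_⟩
        have hpi : (Real.pi : ℂ) ≠ 0 := by exact_mod_cast Real.pi_ne_zero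
        have hI := Complex.I_ne_zero
        field_simp at hq
        exact_mod_cast hq
      rw [geom_sum_eq hz1, hzs]
      simp
  refine ⟨fun n => c (s * n), fun t => ?_⟩
  beta_reduce
  rw [havg, ← Finset.sum_filter]
  have hsz : (0 : ℤ) < s := by exact_mod_cast hs
  refine Finset.sum_nbij' (fun n => n / s) (fun n => s * n) ?_ ?_ ?_ ?_ ?_
  · intro n hn
    simp only [Finset.mem_filter, Finset.mem_Icc] at *
    obtain ⟨⟨h1, h2⟩, q, rfl⟩ := hn
    rw [Int.mul_ediv_cancel_left _ hsz.ne']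
    push_cast
    refine ⟨?_, (Int.le_ediv_iff_mul_le hsz).2 (by linarith)⟩
    have : -q ≤ (d : ℤ) / s := (Int.le_ediv_iff_mul_le hsz).2 (by linarith)
    linarith
  · intro n hn
    simp only [Finset.mem_filter, Finset.mem_Icc] at *
    push_cast at hn
    have h1 : -n ≤ (d : ℤ) / s := by linarith
    have h2 := (Int.le_ediv_iff_mul_le hsz).1 h1
    have h3 := (Int.le_ediv_iff_mul_le hsz).1 hn.2
    exact ⟨⟨by linarith, by linarith⟩, dvd_mul_right _ _⟩
  · intro n hn
    simp only [Finset.mem_filter] at hn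
    exact Int.mul_ediv_cancel' hn.2
  · intro n hn
    exact Int.mul_ediv_cancel_left _ hsz.ne'
  · intro n hn
    simp only [Finset.mem_filter] at hn
    obtain ⟨_, q, rfl⟩ := hn
    rw [Int.mul_ediv_cancel_left _ hsz.ne']
    congr 2
    push_cast
    field_simp

/-- A non-zero trigonometric polynomial of degree `d` has at most `2d` zeros on the circle. -/
theorem exists_zero_finset (hf : IsTrigPoly d f) (h0 : ∃ t, f t ≠ 0) :
    ∃ Z : Finset ℂ, Z.card ≤ 2 * d ∧ ∀ t : ℝ, f t = 0 → Complex.exp (t * Complex.I) ∈ Z := by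
  obtain ⟨P, hP, h⟩ := hf.exists_polynomial
  have hP0 : P ≠ 0 := by
    rintro rfl
    obtain ⟨t, ht⟩ := h0
    have := h t
    simp [ht] at this
  refine ⟨P.roots.toFinset, (Multiset.toFinset_card_le _).trans ((P.card_roots').trans hP),
    fun t ht => ?_⟩
  rw [Multiset.mem_toFinset, Polynomial.mem_roots hP0, Polynomial.IsRoot, ← h, ht, zero_mul]

/-- The zeros lie over finitely many points of the circle, and each fibre of t ↦ e^{it} is empty or
a coset of 2πℤ. -/
theorem countable_zeros (hf : IsTrigPoly d f) (h0 : ∃ t, f t ≠ 0) : {t | f t = 0}.Countable := by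
  obtain ⟨Z, -, hZ⟩ := hf.exists_zero_finset h0
  have h1 : {t | f t = 0} ⊆ ⋃ z ∈ Z, {t : ℝ | Complex.exp (t * Complex.I) = z} := by
    intro t ht
    simp only [Set.mem_iUnion]
    exact ⟨_, hZ t ht, rfl⟩
  refine Set.Countable.mono h1 (Set.Countable.biUnion Z.countable_toSet fun z _ => ?_)
  by_cases hz : ∃ t₀ : ℝ, Complex.exp (t₀ * Complex.I) = z
  · obtain ⟨t₀, rfl⟩ := hz
    refine (Set.countable_range fun n : ℤ => t₀ + n * (2 * Real.pi)).mono ?_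
    intro t ht
    obtain ⟨n, hn⟩ := Complex.exp_eq_exp_iff_exists_int.1 ht
    refine ⟨n, ?_⟩
    have : (t : ℂ) = t₀ + n * (2 * Real.pi) := by
      apply mul_right_cancel₀ Complex.I_ne_zero
      rw [hn]
      ring
    exact_mod_cast this.symm
  · convert Set.countable_empty (α := ℝ)
    ext t
    simp only [Set.mem_ofPred_eq, Set.mem_empty_iff_false, iff_false]
    exact fun h => hz ⟨t, h⟩

end IsTrigPoly

/-! ### Trigonometric interpolation -/

theorem sin_half_sub_ne_zero {x y : ℝ} (h : x ≠ y) (h1 : |x - y| < 2 * Real.pi) :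
    Real.sin ((x - y) / 2) ≠ 0 := by
  obtain ⟨h2, h3⟩ := abs_lt.1 h1
  intro h4
  rw [Real.sin_eq_zero_iff_of_lt_of_lt (by linarith) (by linarith)] at h4
  exact h (by linarith)

/-- Trigonometric Lagrange interpolation. -/
theorem exists_trig_interpolation {ι : Type*} [Fintype ι] (x y : ι → ℝ)
    (hx : ∀ i j, i ≠ j → x i ≠ x j ∧ |x i - x j| < 2 * Real.pi) :
    ∃ F : ℝ → ℝ, IsTrigPoly (Fintype.card ι / 2) (fun t => (F t : ℂ)) ∧ ∀ i, F (x i) = y i := by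
  classical
  have key : ∀ i, ∃ L : ℝ → ℝ, IsTrigPoly (Fintype.card ι / 2) (fun t => (L t : ℂ)) ∧
      L (x i) ≠ 0 ∧ ∀ j, j ≠ i → L (x j) = 0 := by
    intro i
    have hprod : IsHalfTrig (Fintype.card ι - 1) (fun t =>
        ((∏ j ∈ Finset.univ.erase i, Real.sin ((t - x j) / 2) : ℝ) : ℂ)) := by
      have := IsHalfTrig.prod (Finset.univ.erase i) (fun _ => 1)
        (fun j t => ((Real.sin ((t - x j) / 2) : ℝ) : ℂ)) fun j _ => IsHalfTrig.sin_half _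
      simpa [Finset.card_erase_of_mem] using this
    have hne : ∏ j ∈ Finset.univ.erase i, Real.sin ((x i - x j) / 2) ≠ 0 := by
      refine Finset.prod_ne_zero_iff.2 fun j hj => ?_
      have := hx i j (Finset.ne_of_mem_erase hj).symm
      exact sin_half_sub_ne_zero this.1 this.2
    have hz : ∀ j, j ≠ i → ∏ k ∈ Finset.univ.erase i, Real.sin ((x j - x k) / 2) = 0 := by
      intro j hj
      exact Finset.prod_eq_zero (Finset.mem_erase.2 ⟨hj, Finset.mem_univ j⟩) (by simp)
    have hpos : 0 < Fintype.card ι := Fintype.card_pos_iff.2 ⟨i⟩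
    rcases Nat.even_or_odd' (Fintype.card ι) with ⟨q, hq | hq⟩
    -- For an even number of nodes the product has an odd number of half-angle factors. The extra
    -- factor cos((t - x_i)/2), which is 1 at x_i, repairs the parity without exceeding the allowed
    -- degree.
    · refine ⟨fun t => (∏ j ∈ Finset.univ.erase i, Real.sin ((t - x j) / 2)) *
        Real.sin ((t - (x i - Real.pi)) / 2), ?_, ?_, ?_⟩
      · rw [isTrigPoly_iff_isHalfTrig]
        have := hprod.mul (IsHalfTrig.sin_half (x i - Real.pi))
        rw [show Fintype.card ι - 1 + 1 = 2 * (Fintype.card ι / 2) by omega] at this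
        refine this.congr fun t => ?_
        push_cast
        rfl
      · refine mul_ne_zero hne ?_
        rw [show (x i - (x i - Real.pi)) / 2 = Real.pi / 2 by ring, Real.sin_pi_div_two]
        exact one_ne_zero
      · intro j hj
        simp only [hz j hj, zero_mul]
    · refine ⟨fun t => ∏ j ∈ Finset.univ.erase i, Real.sin ((t - x j) / 2), ?_, hne, hz⟩
      rw [isTrigPoly_iff_isHalfTrig]
      rwa [show Fintype.card ι - 1 = 2 * (Fintype.card ι / 2) by omega] at hprod
  choose L hL hL1 hL0 using key
  refine ⟨fun t => ∑ i, y i / L i (x i) * L i t, ?_, fun i => ?_⟩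
  · refine (IsTrigPoly.sum Finset.univ (fun i t => ((y i / L i (x i) : ℝ) : ℂ) * (L i t : ℂ))
      fun i _ => (hL i).const_mul _).congr fun t => ?_
    push_cast
    rfl
  · beta_reduce
    rw [Finset.sum_eq_single i]
    · exact div_mul_cancel₀ _ (hL1 i)
    · intro j _ hj
      rw [hL0 j i hj.symm, mul_zero]
    · simp

/-- Interpolation of real non-zero values and of the derivative of the argument. -/
theorem exists_trig_interpolation_arg {n : ℕ} (x v e : Fin n → ℝ) (hv : ∀ i, v i ≠ 0)
    (hx : ∀ i j, i ≠ j → x i ≠ x j ∧ |x i - x j| < 2 * Real.pi) :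
    ∃ A : ℝ → ℂ, IsTrigPoly n A ∧ (∀ i, A (x i) = (v i : ℂ)) ∧ ∀ i, argDeriv A (x i) = e i := by
  classical
  obtain ⟨a, ha, hav⟩ := exists_trig_interpolation x v hx
  -- The squares give double zeros at the other nodes, so the k-th summand of `b` below affects
  -- neither values nor first derivatives there.
  set Q : Fin n → ℝ → ℝ := fun k t =>
    ∏ j ∈ Finset.univ.erase k, (Real.sin ((t - x j) / 2) * Real.sin ((t - x j) / 2)) with hQ
  have hQ0 : ∀ i, Q i (x i) ≠ 0 := fun i => by
    refine Finset.prod_ne_zero_iff.2 fun j hj => ?_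
    have := hx i j (Finset.ne_of_mem_erase hj).symm
    have h := sin_half_sub_ne_zero this.1 this.2
    exact mul_ne_zero h h
  have hQd : ∀ i, Differentiable ℝ (Q i) := fun i => by
    simp only [hQ]
    fun_prop
  have hb0 : ∀ i k, k ≠ i → HasDerivAt (fun t => Real.sin (t - x k) * Q k t) 0 (x i) ∧
      Q k (x i) = 0 := by
    intro i k hki
    have hmem : i ∈ Finset.univ.erase k := Finset.mem_erase.2 ⟨hki.symm, Finset.mem_univ i⟩
    have hs : HasDerivAt (fun t => Real.sin ((t - x i) / 2))
        (Real.cos ((x i - x i) / 2) * (1 / 2)) (x i) :=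
      ((((hasDerivAt_id' (x i)).sub_const (x i)).div_const 2)).sin
    have hr : Differentiable ℝ (fun t => Real.sin (t - x k) * ∏ j ∈ (Finset.univ.erase k).erase i,
        (Real.sin ((t - x j) / 2) * Real.sin ((t - x j) / 2))) := by
      fun_prop
    have h := (hs.mul hs).mul (hr (x i)).hasDerivAt
    constructor
    · refine (h.congr_deriv ?_).congr_of_eventuallyEq (Filter.Eventually.of_forall fun t => ?_)
      · simp
      · simp only [hQ, Pi.mul_apply]
        rw [← Finset.mul_prod_erase _ _ hmem]
        ring
    · exact Finset.prod_eq_zero hmem (by simp)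
  -- The factor sin(t - x_k) has a simple zero with derivative 1 at x_k; each summand has degree 1 +
  -- (n - 1) = n.
  set b : ℝ → ℝ := fun t => ∑ k, e k * v k / Q k (x k) * (Real.sin (t - x k) * Q k t) with hb
  have hbv : ∀ i, b (x i) = 0 := fun i => by
    refine Finset.sum_eq_zero fun k _ => ?_
    by_cases hki : k = i
    · subst hki
      simp
    · rw [(hb0 i k hki).2]
      simp
  have hbd : ∀ i, HasDerivAt b (e i * v i) (x i) := by
    intro i
    have h : ∀ k ∈ Finset.univ, HasDerivAt
        (fun t => e k * v k / Q k (x k) * (Real.sin (t - x k) * Q k t))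
        (if k = i then e i * v i else 0) (x i) := by
      intro k _
      split_ifs with hki
      · subst hki
        have h1 : HasDerivAt (fun t => Real.sin (t - x k)) (Real.cos (x k - x k) * 1) (x k) :=
          ((hasDerivAt_id' (x k)).sub_const (x k)).sin
        refine ((h1.mul (hQd k (x k)).hasDerivAt).const_mul _).congr_deriv ?_
        have := hQ0 k
        simp
        field_simp
      · simpa using (hb0 i k hki).1.const_mul (e k * v k / Q k (x k))
    refine (HasDerivAt.fun_sum h).congr_deriv ?_
    simp
  have hbt : IsTrigPoly n (fun t => (b t : ℂ)) := by
    refine (IsTrigPoly.sum Finset.univ (fun k t => ((e k * v k / Q k (x k) : ℝ) : ℂ) *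
      (((Real.sin (t - x k) : ℝ) : ℂ) * (Q k t : ℂ))) fun k _ => ?_).congr fun t => ?_
    · refine IsTrigPoly.const_mul _ ?_
      have h1 : IsTrigPoly (n - 1) (fun t => (Q k t : ℂ)) := by
        rw [isTrigPoly_iff_isHalfTrig]
        have := IsHalfTrig.prod (Finset.univ.erase k) (fun _ => 2)
          (fun j t => ((Real.sin ((t - x j) / 2) : ℝ) : ℂ) * ((Real.sin ((t - x j) / 2) : ℝ) : ℂ))
          fun j _ => (IsHalfTrig.sin_half _).mul (IsHalfTrig.sin_half _)
        simp only [Finset.sum_const, Finset.mem_univ, Finset.card_erase_of_mem, Finset.card_univ,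
          Fintype.card_fin, smul_eq_mul] at this
        rw [mul_comm 2]
        refine this.congr fun t => ?_
        simp only [hQ]
        push_cast
        rfl
      have hk : 1 + (n - 1) = n := by
        have := k.pos
        omega
      have := (IsTrigPoly.sin_sub (x k)).mul h1
      rwa [hk] at this
    · simp only [hb]
      push_cast
      rfl
  -- At a node a = v, b = 0 and b' = e v, so the derivative of the argument is v · e v / v² = e.
  refine ⟨fun t => (a t : ℂ) + Complex.I * (b t : ℂ), ?_, fun i => ?_, fun i => ?_⟩
  · refine IsTrigPoly.add (ha.mono ?_) (hbt.const_mul _)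
    rw [Fintype.card_fin]
    omega
  · simp [hav, hbv]
  · have h1 : (fun t : ℝ => ((a t : ℂ) + Complex.I * (b t : ℂ)).im) = b := by
      funext t
      simp
    simp only [argDeriv]
    rw [h1, (hbd i).deriv]
    have := hv i
    simp [hav, hbv]
    field_simp

/-! ### Products over the strands -/

theorem strand_eq {s : ℕ} (F : ℝ → ℝ) (j : Fin s) (t : ℝ) :
    strand F j t = F (t / s + 2 * Real.pi * (j : ℕ) / s) := by
  rw [strand, add_div]

/-- Up to sign, the coefficient of X^a is the elementary symmetric function of degree |J| - a in the
roots. -/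
theorem isTrigPoly_coeff_prod {ι : Type*} {N : ℕ} (J : Finset ι) (f : ι → ℝ → ℂ)
    (h : ∀ i, IsTrigPoly N (f i)) (a : ℕ) :
    IsTrigPoly ((J.card - a) * N)
      (fun t => (∏ i ∈ J, (Polynomial.X - Polynomial.C (f i t))).coeff a) := by
  classical
  induction J using Finset.induction_on generalizing a with
  | empty =>
    simp only [Finset.prod_empty]
    exact IsTrigPoly.const _ _
  | insert i J hi ih =>
    simp only [Finset.prod_insert hi, Finset.card_insert_of_notMem hi]
    cases a with
    | zero =>
      refine (((h i).mul (ih 0)).const_mul (-1)).congr (fun t => ?_) |>.mono ?_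
      · simp [Polynomial.mul_coeff_zero]
      · simp only [Nat.sub_zero]
        linarith
    | succ a =>
      simp only [sub_mul, Polynomial.coeff_sub, Polynomial.coeff_X_mul, Polynomial.coeff_C_mul]
      rw [show J.card + 1 - (a + 1) = J.card - a by omega]
      refine (ih a).sub ?_
      by_cases ha : a + 1 ≤ J.card
      · refine ((h i).mul (ih (a + 1))).mono (le_of_eq ?_)
        obtain ⟨b, hb⟩ := Nat.exists_eq_add_of_le ha
        rw [hb, show a + 1 + b - (a + 1) = b by omega, show a + 1 + b - a = b + 1 by omega]
        ring
      -- Here the subtraction of natural numbers truncates, but the coefficient lies beyond the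
      -- degree of the product and vanishes.
      · have h0 : ∀ t, (∏ i ∈ J, (Polynomial.X - Polynomial.C (f i t))).coeff (a + 1) = 0 := by
          intro t
          apply Polynomial.coeff_eq_zero_of_natDegree_lt
          rw [Polynomial.natDegree_finsetProd_X_sub_C_eq_card]
          omega
        simp only [h0, mul_zero]
        exact IsTrigPoly.const _ _

/-- The coefficient functions of the polynomial with the roots `F(t + 2πj/s)`. -/
noncomputable def strandCoeff (s : ℕ) (F : ℝ → ℝ) (a : ℕ) (t : ℝ) : ℂ :=
  (∏ j : Fin s, (Polynomial.X -
    Polynomial.C ((F (t + 2 * Real.pi * (j : ℕ) / s) : ℝ) : ℂ))).coeff a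

theorem prod_sub_strand_eq_sum {s : ℕ} (F : ℝ → ℝ) (u : ℂ) (t : ℝ) :
    ∏ j : Fin s, (u - (strand F j t : ℂ)) =
      ∑ a ∈ Finset.range (s + 1), u ^ a * strandCoeff s F a (t / s) := by
  have h : ∏ j : Fin s, (u - (strand F j t : ℂ)) = (∏ j : Fin s, (Polynomial.X -
      Polynomial.C ((F (t / s + 2 * Real.pi * (j : ℕ) / s) : ℝ) : ℂ))).eval u := by
    simp [Polynomial.eval_prod, strand_eq]
  rw [h, Polynomial.eval_eq_sum_range' (n := s + 1)]
  · exact Finset.sum_congr rfl fun a _ => mul_comm _ _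
  · rw [Polynomial.natDegree_finsetProd_X_sub_C_eq_card]
    simp

/-- The translation by 2π/s permutes the roots cyclically; the last one becomes the first because F
has period 2π. -/
theorem strandCoeff_periodic {s : ℕ} (F : ℝ → ℝ) (hF : Function.Periodic F (2 * Real.pi))
    (a : ℕ) : Function.Periodic (strandCoeff s F a) (2 * Real.pi / s) := by
  intro t
  rcases s with _ | n
  · simp [strandCoeff]
  have hn : ((n : ℝ) + 1) ≠ 0 := by positivity
  simp only [strandCoeff]
  congr 1
  set φ : ℕ → Polynomial ℂ := fun j => Polynomial.X -
    Polynomial.C ((F (t + 2 * Real.pi * j / (n + 1 : ℕ)) : ℝ) : ℂ) with hφ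
  have h1 : ∀ j : Fin (n + 1), (Polynomial.X - Polynomial.C
      ((F (t + 2 * Real.pi / (n + 1 : ℕ) + 2 * Real.pi * (j : ℕ) / (n + 1 : ℕ)) : ℝ) : ℂ)) =
      φ (j + 1) := by
    intro j
    simp only [hφ]
    congr 4
    push_cast
    field_simp
    ring
  have h2 : φ (n + 1) = φ 0 := by
    simp only [hφ]
    congr 3
    push_cast
    rw [mul_div_assoc, div_self hn]
    simp [hF t]
  rw [Finset.prod_congr rfl fun j _ => h1 j, Fin.prod_univ_eq_prod_range (fun j => φ (j + 1)),
    Fin.prod_univ_eq_prod_range φ, Finset.prod_range_succ, h2, Finset.prod_range_succ']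

/-- Periodicity divides the degree (s - a)N by s. The decrease of this bound with a is what makes
p_k a polynomial: u^a comes with only the power 2k(s - a) of r. -/
theorem isTrigPoly_strandCoeff {s N : ℕ} (hs : 0 < s) {F : ℝ → ℝ}
    (hF : IsTrigPoly N (fun t => (F t : ℂ))) (a : ℕ) :
    IsTrigPoly ((s - a) * N / s) (fun t => strandCoeff s F a (t / s)) := by
  have hp : Function.Periodic F (2 * Real.pi) := fun t => by
    exact_mod_cast hF.periodic t
  refine IsTrigPoly.descend hs ?_ (strandCoeff_periodic F hp a)
  have := isTrigPoly_coeff_prod (Finset.univ : Finset (Fin s))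
    (fun j t => ((F (t + 2 * Real.pi * (j : ℕ) / s) : ℝ) : ℂ)) (fun j => hF.comp_add _) a
  rwa [Finset.card_univ, Fintype.card_fin] at this

theorem infinite_range_exp_mul_I :
    (Set.range fun t : ℝ => Complex.exp (t * Complex.I)).Infinite := by
  have h : Set.InjOn (fun t : ℝ => Complex.exp (t * Complex.I)) (Set.Icc 0 1) := by
    intro x hx y hy hxy
    have h1 : Real.sin x = Real.sin y := by
      have := congrArg Complex.im hxy
      simpa [Complex.exp_ofReal_mul_I_im] using this
    have := Real.pi_gt_three
    exact Real.injOn_sin ⟨by linarith [hx.1], by linarith [hx.2]⟩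
      ⟨by linarith [hy.1], by linarith [hy.2]⟩ h1
  exact ((Set.Icc_infinite zero_lt_one).image h).mono (Set.image_subset_range _ _)

/-- The lowest coefficient of the product is c(-N)^s up to a unit and belongs to the frequency -2N,
where nothing may remain if n < 2N. -/
theorem coeff_eq_zero_of_isTrigPoly_prod {s N n : ℕ} (hs : 0 < s) {F : ℝ → ℂ} {c : ℤ → ℂ}
    (hc : ∀ t : ℝ, F t = ∑ n ∈ Finset.Icc (-(N : ℤ)) N, c n * Complex.exp (n * t * Complex.I))
    (hg : IsTrigPoly n (fun t => ∏ j : Fin s, F ((2 * t + 2 * Real.pi * (j : ℕ)) / s)))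
    (hn : n < 2 * N) : c (-N) = 0 := by
  obtain ⟨B, -, hB⟩ := hg.exists_polynomial
  have hs' : (s : ℂ) ≠ 0 := by exact_mod_cast hs.ne'
  set P : Polynomial ℂ := ∑ m ∈ Finset.range (2 * N + 1),
    Polynomial.C (c ((m : ℤ) - N)) * Polynomial.X ^ m with hP
  have hFP : ∀ t : ℝ, F t * Complex.exp (N * t * Complex.I) =
      P.eval (Complex.exp (t * Complex.I)) := by
    intro t
    rw [hc, sum_Icc_neg_eq_sum_range, Finset.sum_mul, hP, Polynomial.eval_finsetSum]
    refine Finset.sum_congr rfl fun m _ => ?_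
    simp only [Polynomial.eval_mul, Polynomial.eval_C, Polynomial.eval_pow, Polynomial.eval_X]
    rw [mul_assoc, ← Complex.exp_add, ← Complex.exp_nat_mul]
    congr 2
    push_cast
    ring
  have hP0 : P.eval 0 = c (-N) := by
    rw [hP, Polynomial.eval_finsetSum, Finset.sum_range_succ']
    simp
  set ζ : ℕ → ℂ := fun j => Complex.exp ((2 * Real.pi * j / s : ℝ) * Complex.I) with hζ
  set K : ℂ := ∏ j : Fin s, ζ j ^ N with hK
  -- With t = sx and z = e^{ix}, the j-th factor is P(ζ_j z²) up to a monomial. Both sides are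
  -- polynomials agreeing on infinitely many z; at z = 0 the left side vanishes and the right side
  -- is P(0)^s.
  have hid : Polynomial.C K * Polynomial.X ^ ((2 * N - n) * s) * B.comp (Polynomial.X ^ s) =
      ∏ j : Fin s, P.comp (Polynomial.C (ζ j) * Polynomial.X ^ 2) := by
    refine Polynomial.eq_of_infinite_eval_eq _ _ (infinite_range_exp_mul_I.mono ?_)
    rintro _ ⟨x, rfl⟩
    simp only [Set.mem_ofPred_eq, Polynomial.eval_mul, Polynomial.eval_C, Polynomial.eval_pow,
      Polynomial.eval_X, Polynomial.eval_comp, Polynomial.eval_prod]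
    set z := Complex.exp (x * Complex.I) with hz
    have h1 : ∀ j : Fin s, P.eval (ζ j * z ^ 2) =
        F ((2 * (s * x : ℝ) + 2 * Real.pi * (j : ℕ)) / s) * (ζ j ^ N * z ^ (2 * N)) := by
      intro j
      have h2 : ζ j * z ^ 2 =
          Complex.exp (((2 * (s * x) + 2 * Real.pi * (j : ℕ)) / s : ℝ) * Complex.I) := by
        rw [hζ, hz, ← Complex.exp_nat_mul, ← Complex.exp_add]
        congr 1
        push_cast
        field_simp
        ring
      rw [h2, ← hFP]
      congr 1
      rw [hζ, hz, ← Complex.exp_nat_mul, ← Complex.exp_nat_mul, ← Complex.exp_add]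
      congr 1
      push_cast
      field_simp
      ring
    have h3 : B.eval (z ^ s) =
        (∏ j : Fin s, F ((2 * (s * x : ℝ) + 2 * Real.pi * (j : ℕ)) / s)) * z ^ (n * s) := by
      have := hB (s * x)
      rw [hz, ← Complex.exp_nat_mul, ← Complex.exp_nat_mul]
      rw [show (s : ℂ) * (x * Complex.I) = ((s * x : ℝ) : ℂ) * Complex.I by push_cast; ring, ← this]
      congr 2
      push_cast
      ring
    simp only [h1]
    rw [Finset.prod_mul_distrib, Finset.prod_mul_distrib, ← hK, h3, Finset.prod_const,
      Finset.card_univ, Fintype.card_fin, ← pow_mul]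
    have h4 : 2 * N * s = (2 * N - n) * s + n * s := by
      rw [← add_mul]
      congr 1
      omega
    rw [h4, pow_add]
    ring
  have h := congrArg (Polynomial.eval 0) hid
  have hpos : (2 * N - n) * s ≠ 0 := by
    have : 0 < 2 * N - n := by omega
    positivity
  simp only [Polynomial.eval_mul, Polynomial.eval_C, Polynomial.eval_pow,
    Polynomial.eval_X, Polynomial.eval_comp, Polynomial.eval_prod, zero_pow hpos, mul_zero,
    zero_mul, zero_pow two_ne_zero, hP0, Finset.prod_const, Finset.card_univ,
    Fintype.card_fin] at h
  exact pow_eq_zero_iff hs.ne' |>.1 h.symm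

/-- The product over the strands, as a function of half the variable, has at least twice the
degree of the parametrization. -/
theorem two_mul_le_of_isTrigPoly_prod {s N n : ℕ} (hs : 0 < s) {F : ℝ → ℂ}
    (hF : IsTrigPoly N F) (hmin : ∀ d < N, ¬ IsTrigPoly d F)
    (hg : IsTrigPoly n (fun t => ∏ j : Fin s, F ((2 * t + 2 * Real.pi * (j : ℕ)) / s))) :
    2 * N ≤ n := by
  by_contra! hn
  have hper := hF.periodic
  obtain ⟨c, hc⟩ := hF
  have hs' : (s : ℝ) ≠ 0 := by exact_mod_cast hs.ne'
  have h1 := coeff_eq_zero_of_isTrigPoly_prod hs hc hg hn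
  have hc' : ∀ t : ℝ, F (-t) = ∑ n ∈ Finset.Icc (-(N : ℤ)) N,
      c (-n) * Complex.exp (n * t * Complex.I) := by
    intro t
    rw [hc]
    refine Finset.sum_nbij' (fun n => -n) (fun n => -n) ?_ ?_ (by simp) (by simp) (by simp)
    · intro n hn
      simp only [Finset.mem_Icc] at *
      omega
    · intro n hn
      simp only [Finset.mem_Icc] at *
      omega
  have hg' : IsTrigPoly n
      (fun t => ∏ j : Fin s, F (-((2 * t + 2 * Real.pi * (j : ℕ)) / s))) := by
    -- Reflection exchanges c(-N) and c(N). It reverses the order of the strands, and the shift of t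
    -- by π makes j and s - 1 - j differ by a full period of F.
    refine (hg.comp_add Real.pi).comp_neg.congr fun t => ?_
    rw [← Equiv.prod_comp Fin.revPerm]
    refine Finset.prod_congr rfl fun j _ => ?_
    rw [← hper (-((2 * t + 2 * Real.pi * (j : ℕ)) / s))]
    congr 1
    have hj : ((Fin.revPerm j : Fin s) : ℕ) = s - ((j : ℕ) + 1) := by
      simp [Fin.val_rev]
    rw [hj, Nat.cast_sub (by omega)]
    push_cast
    field_simp
    ring
  have h2 := coeff_eq_zero_of_isTrigPoly_prod hs hc' hg' hn
  rw [neg_neg] at h2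
  have hN : 0 < N := by omega
  refine hmin (N - 1) (by omega) ⟨c, fun t => ?_⟩
  rw [hc]
  symm
  refine Finset.sum_subset ?_ ?_
  · intro n hn
    simp only [Finset.mem_Icc] at *
    omega
  · intro n hn hn'
    simp only [Finset.mem_Icc] at *
    have : n = N ∨ n = -N := by omega
    rcases this with rfl | rfl
    · rw [h2, zero_mul]
    · rw [h1, zero_mul]

/-! ### Polynomials in `u`, `v` and the conjugate of `v` -/

/-- The monomial v^a v̄^b equals r^{a+b} e^{i(a-b)t}; the system a + b = q, a - b = e has a solution
in natural numbers exactly when |e| ≤ q and the parities agree. -/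
theorem exists_mvPolynomial {ι : Type*} (J : Finset ι) (q : ℕ) (c : ι → ℂ) (e : ι → ℤ)
    (he : ∀ i ∈ J, -(q : ℤ) ≤ e i ∧ e i ≤ q ∧ (2 : ℤ) ∣ q + e i) :
    ∃ p : MvPolynomial (Fin 3) ℂ, p.totalDegree ≤ q ∧ ∀ (u : ℂ) (r t : ℝ),
      MvPolynomial.eval ![u, r * Complex.exp (t * Complex.I),
        (starRingEnd ℂ) (r * Complex.exp (t * Complex.I))] p =
      (r : ℂ) ^ q * ∑ i ∈ J, c i * Complex.exp (e i * t * Complex.I) := by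
  refine ⟨∑ i ∈ J, MvPolynomial.C (c i) * (MvPolynomial.X 1 ^ ((q + e i) / 2).toNat *
    MvPolynomial.X 2 ^ ((q - e i) / 2).toNat), ?_, fun u r t => ?_⟩
  · refine MvPolynomial.totalDegree_finsetSum_le fun i hi => ?_
    refine (MvPolynomial.totalDegree_mul _ _).trans ?_
    rw [MvPolynomial.totalDegree_C, zero_add]
    refine (MvPolynomial.totalDegree_mul _ _).trans ?_
    simp only [MvPolynomial.totalDegree_X_pow]
    have := he i hi
    omega
  · rw [map_sum, Finset.mul_sum]
    refine Finset.sum_congr rfl fun i hi => ?_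
    obtain ⟨h1, h2, h3⟩ := he i hi
    have hconj : (starRingEnd ℂ) (r * Complex.exp (t * Complex.I)) =
        r * Complex.exp (-(t * Complex.I)) := by
      simp [← Complex.exp_conj]
    rw [hconj]
    simp only [map_mul, map_pow, MvPolynomial.eval_C, MvPolynomial.eval_X, Matrix.cons_val]
    obtain ⟨a, ha⟩ : ∃ a : ℕ, ((q + e i) / 2).toNat = a := ⟨_, rfl⟩
    obtain ⟨b, hb⟩ : ∃ b : ℕ, ((q - e i) / 2).toNat = b := ⟨_, rfl⟩
    have hq : q = a + b := by omega
    have hab : e i = a - b := by omega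
    rw [ha, hb, hab, hq, mul_pow, mul_pow, ← Complex.exp_nat_mul, ← Complex.exp_nat_mul, pow_add]
    have : Complex.exp ((((a : ℤ) - (b : ℤ) : ℤ) : ℂ) * t * Complex.I) =
        Complex.exp (a * (t * Complex.I)) * Complex.exp (b * -(t * Complex.I)) := by
      rw [← Complex.exp_add]
      congr 1
      push_cast
      ring
    rw [this]
    ring

/-! ### The degree of the output -/

namespace InterpolationData

variable {s : ℕ} {w : BraidWord s}

theorem length_pos (D : InterpolationData w) : 0 < w.length := by
  by_contra h
  have h0 : Fin.last w.length = 0 := by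
    apply Fin.ext
    simp only [Fin.val_last, Fin.val_zero]
    omega
  have h1 := D.node_last
  rw [h0, D.node_zero] at h1
  have := Real.pi_pos
  linarith

theorem two_le (D : InterpolationData w) : 2 ≤ s := by
  have := (w[0]'D.length_pos).1.pos
  omega

end InterpolationData

theorem strand_two_pi {s : ℕ} (hs : 0 < s) {F : ℝ → ℝ} (hF : Function.Periodic F (2 * Real.pi))
    (j : Fin s) (t : ℝ) :
    strand F j (t + 2 * Real.pi) = strand F ⟨((j : ℕ) + 1) % s, Nat.mod_lt _ hs⟩ t := by
  have hs' : (s : ℝ) ≠ 0 := by exact_mod_cast hs.ne'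
  simp only [strand]
  rcases Nat.lt_or_ge ((j : ℕ) + 1) s with h | h
  · rw [Nat.mod_eq_of_lt h]
    congr 1
    push_cast
    ring
  · have hj : (j : ℕ) + 1 = s := by omega
    rw [hj, Nat.mod_self, ← hF ((t + 2 * Real.pi * (0 : ℕ)) / s)]
    congr 1
    have hj' : ((j : ℕ) : ℝ) + 1 = s := by exact_mod_cast hj
    have hj'' : ((j : ℕ) : ℝ) = s - 1 := by linarith
    rw [hj'']
    push_cast
    field_simp
    ring

theorem succ_mod_injective {s : ℕ} (hs : 0 < s) :
    Function.Injective (fun j : Fin s => (⟨((j : ℕ) + 1) % s, Nat.mod_lt _ hs⟩ : Fin s)) := by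
  intro i j h
  simp only [Fin.mk.injEq] at h
  apply Fin.ext
  have h1 : (i : ℕ) ≡ j [MOD s] := Nat.ModEq.add_right_cancel' 1 h
  rwa [Nat.ModEq, Nat.mod_eq_of_lt i.2, Nat.mod_eq_of_lt j.2] at h1

theorem IsCrossingTime.sub_two_pi {s : ℕ} {F : ℝ → ℝ} (hF : Function.Periodic F (2 * Real.pi))
    {t : ℝ} (h : IsCrossingTime s F (t + 2 * Real.pi)) : IsCrossingTime s F t := by
  obtain ⟨i, j, hij, h⟩ := h
  have hs : 0 < s := i.pos
  rw [strand_two_pi hs hF, strand_two_pi hs hF] at h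
  exact ⟨_, _, fun h' => hij (succ_mod_injective hs h'), h⟩

/-! ### The degree of the parametrization and the number of crossings. -/

namespace Execution

variable {s : ℕ} {w : BraidWord s} {D : InterpolationData w} {η : ℝ}

theorem isTrigPoly_Fgen (R : Execution w D η) :
    IsTrigPoly (s * w.length / 2) (fun t => (R.Fgen t : ℂ)) := by
  obtain ⟨c, a, b, -, -, -, h⟩ := R.Fgen_eq
  -- Hence the modification of degree one does not raise the degree.
  have h1 : 1 ≤ s * w.length / 2 := by
    have h2 := D.two_le
    have h3 := D.length_pos
    have : 2 * 1 ≤ s * w.length := Nat.mul_le_mul h2 h3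
    omega
  refine (R.F_trig.add (((IsTrigPoly.const _ (c : ℂ)).add
    ((IsTrigPoly.cos.mono h1).const_mul (a : ℂ))).add
    ((IsTrigPoly.sin.mono h1).const_mul (b : ℂ)))).congr fun t => ?_
  rw [h]
  push_cast
  rfl

theorem isTrigPoly_Ft (R : Execution w D η) :
    IsTrigPoly (s * w.length / 2) (fun t => (R.Ft t : ℂ)) :=
  (R.isTrigPoly_Fgen.comp_add (R.shift / s)).congr fun t => by rw [R.Ft_eq]

theorem strand_Ft (R : Execution w D η) (j : Fin s) (t : ℝ) :
    strand R.Ft j t = strand R.Fgen j (t + R.shift) := by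
  rw [strand, strand, R.Ft_eq]
  congr 1
  ring

theorem not_isCrossingTime_zero (R : Execution w D η) : ¬ IsCrossingTime s R.Ft 0 := by
  rintro ⟨i, j, hij, h⟩
  rw [R.strand_Ft, R.strand_Ft, zero_add] at h
  exact R.shift_no_crossing _ Set.right_mem_uIcc ⟨i, j, hij, h⟩

theorem periodic_Ft (R : Execution w D η) : Function.Periodic R.Ft (2 * Real.pi) := fun t => by
  exact_mod_cast R.isTrigPoly_Ft.periodic t

/-- A crossing at 2π would also be one at 0, which the condition on the shift excludes. The heights
thus have distinct images on the circle. -/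
theorem time_mem (R : Execution w D η) (k : Fin R.crossings) :
    0 < R.time k ∧ R.time k < 2 * Real.pi := by
  have h : R.time k ∈ {t ∈ Set.Icc 0 (2 * Real.pi) | IsCrossingTime s R.Ft t} :=
    R.range_time ▸ Set.mem_range_self k
  obtain ⟨⟨h0, h1⟩, h2⟩ := h
  refine ⟨h0.lt_of_ne ?_, h1.lt_of_ne ?_⟩
  · intro h
    rw [← h] at h2
    exact R.not_isCrossingTime_zero h2
  · intro h
    rw [h, ← zero_add (2 * Real.pi)] at h2
    exact R.not_isCrossingTime_zero (h2.sub_two_pi R.periodic_Ft)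

theorem exists_strand_ne (R : Execution w D η) {i j : Fin s} (hij : i ≠ j) :
    ∃ t, strand R.Ft i t ≠ strand R.Ft j t := by
  by_contra! h
  have h' : strand R.Fgen i = strand R.Fgen j := by
    funext t
    have := h (t - R.shift)
    rwa [R.strand_Ft, R.strand_Ft, sub_add_cancel] at this
  exact (R.Fgen_generic 0 i j hij (congrFun h' 0)).1 (by rw [h'])

/-- A crossing of the strands p < q at height t is recorded by d = q - p and the point e^{i(t +
2πp)/s}, a zero of F̃(x) - F̃(x + 2πd/s). For each of the s - 1 values of d there are at most 2N
such points. -/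
theorem crossings_le (R : Execution w D η) : R.crossings ≤ s * (s * w.length) := by
  classical
  have hs : 0 < s := by have := D.two_le; omega
  have hs' : (s : ℝ) ≠ 0 := by exact_mod_cast hs.ne'
  set N := s * w.length / 2 with hN
  set G : ℤ → ℝ → ℝ := fun d t => R.Ft t - R.Ft (t + 2 * Real.pi * d / s) with hG
  have hGt : ∀ d, IsTrigPoly N (fun t => (G d t : ℂ)) := fun d =>
    (R.isTrigPoly_Ft.sub (R.isTrigPoly_Ft.comp_add _)).congr fun t => by
      simp only [hG]
      push_cast
      rfl
  have hGs : ∀ (i j : Fin s) (t : ℝ), G ((j : ℤ) - (i : ℤ)) ((t + 2 * Real.pi * (i : ℕ)) / s) =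
      strand R.Ft i t - strand R.Ft j t := by
    intro i j t
    simp only [hG, strand]
    congr 2
    push_cast
    ring
  set I : Finset ℤ := (Finset.Icc 1 ((s : ℤ) - 1)) with hI
  have hZ : ∀ d : ℤ, ∃ Z : Finset ℂ, Z.card ≤ 2 * N ∧ ((∃ t, G d t ≠ 0) →
      ∀ t : ℝ, G d t = 0 → Complex.exp (t * Complex.I) ∈ Z) := by
    intro d
    by_cases h : ∃ t, G d t ≠ 0
    · obtain ⟨Z, h1, h2⟩ := (hGt d).exists_zero_finset (by
        obtain ⟨t, ht⟩ := h
        exact ⟨t, by exact_mod_cast ht⟩)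
      exact ⟨Z, h1, fun _ t ht => h2 t (by rw [ht]; simp)⟩
    · exact ⟨∅, by simp, fun h' => absurd h' h⟩
  choose Z hZc hZm using hZ
  have hord : ∀ k, ∃ i j : Fin s, i < j ∧ strand R.Ft i (R.time k) = strand R.Ft j (R.time k) := by
    intro k
    rcases lt_or_gt_of_ne (R.fst_ne_snd k) with h | h
    · exact ⟨_, _, h, R.fst_eq_snd k⟩
    · exact ⟨_, _, h, (R.fst_eq_snd k).symm⟩
  choose p q hpq hst using hord
  have hmap : ∀ k ∈ (Finset.univ : Finset (Fin R.crossings)),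
      (⟨(q k : ℤ) - (p k : ℤ), Complex.exp
        (((R.time k + 2 * Real.pi * (p k : ℕ)) / s : ℝ) * Complex.I)⟩ : Σ _ : ℤ, ℂ) ∈
      I.sigma Z := by
    intro k _
    rw [Finset.mem_sigma]
    have := hpq k
    have h2 := (q k).2
    refine ⟨by simp only [hI, Finset.mem_Icc]; omega, ?_⟩
    refine hZm _ ?_ _ ?_
    · obtain ⟨t, ht⟩ := R.exists_strand_ne this.ne
      refine ⟨(t + 2 * Real.pi * (p k : ℕ)) / s, ?_⟩
      rw [hGs]
      exact sub_ne_zero.2 ht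
    · rw [hGs, hst k, sub_self]
  have hcard := Finset.card_le_card_of_injOn _ hmap (by
    intro k _ l _ hkl
    simp only [Sigma.mk.injEq, heq_eq_eq] at hkl
    obtain ⟨n, hn⟩ := Complex.exp_eq_exp_iff_exists_int.1 hkl.2
    have h1 : R.time k + 2 * Real.pi * (p k : ℕ) =
        R.time l + 2 * Real.pi * (p l : ℕ) + n * (2 * Real.pi) * s := by
      have h2 : (R.time k + 2 * Real.pi * (p k : ℕ)) / s =
          (R.time l + 2 * Real.pi * (p l : ℕ)) / s + n * (2 * Real.pi) := by
        have : (((R.time k + 2 * Real.pi * (p k : ℕ)) / s : ℝ) : ℂ) =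
            (((R.time l + 2 * Real.pi * (p l : ℕ)) / s + n * (2 * Real.pi) : ℝ) : ℂ) := by
          apply mul_right_cancel₀ Complex.I_ne_zero
          rw [hn]
          push_cast
          ring
        exact_mod_cast this
      field_simp at h2
      linarith
    have hk := R.time_mem k
    have hl := R.time_mem l
    have hpi := Real.pi_pos
    -- Equal records force the heights to differ by 2πx; both lie strictly between 0 and 2π, so x =
    -- 0.
    set x : ℤ := (p k : ℤ) - (p l : ℤ) - n * s with hx
    have h3 : R.time l - R.time k = 2 * Real.pi * x := by
      rw [hx]
      push_cast
      linarith
    have h4 : x = 0 := by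
      have h5 : (x : ℝ) < 1 := by
        by_contra! h
        nlinarith
      have h6 : (-1 : ℝ) < x := by
        by_contra! h
        nlinarith
      have h7 : x < 1 := by exact_mod_cast h5
      have h8 : -1 < x := by exact_mod_cast h6
      omega
    rw [h4] at h3
    apply R.time_strictMono.injective
    push_cast at h3
    linarith)
  rw [Finset.card_univ, Fintype.card_fin, Finset.card_sigma] at hcard
  refine hcard.trans ((Finset.sum_le_sum fun d _ => hZc d).trans ?_)
  rw [Finset.sum_const, hI, Int.card_Icc, smul_eq_mul]
  exact Nat.mul_le_mul (by omega) (by omega)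

theorem g_eq_sum (R : Execution w D η) (u : ℂ) (t : ℝ) :
    R.g u t = ∑ a ∈ Finset.range (s + 1), u ^ a * strandCoeff s R.Ft a (2 * t / s) :=
  prod_sub_strand_eq_sum _ _ _

end Execution

theorem IsTrigPoly.comp_two_mul {d : ℕ} {f : ℝ → ℂ} (hf : IsTrigPoly d f) :
    IsTrigPoly (2 * d) (fun t => f (2 * t)) := by
  obtain ⟨c, hc⟩ := hf
  have hk : ∀ n ∈ Finset.Icc (-(d : ℤ)) d, IsTrigPoly (2 * d)
      (fun t : ℝ => c n * Complex.exp (n * ((2 * t : ℝ) : ℂ) * Complex.I)) := by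
    intro n hn
    refine ⟨fun l => if l = 2 * n then c n else 0, fun t => ?_⟩
    simp only [Finset.mem_Icc] at hn
    have hmem : 2 * n ∈ Finset.Icc (-((2 * d : ℕ) : ℤ)) (2 * d : ℕ) := by
      simp only [Finset.mem_Icc]
      push_cast
      omega
    simp only [ite_mul, zero_mul, Finset.sum_ite_eq', hmem, if_true]
    congr 2
    push_cast
    ring
  exact (IsTrigPoly.sum _ _ hk).congr fun t => (hc (2 * t)).symm

/-! ### The two summands of the output as polynomials. -/

namespace Execution

variable {s : ℕ} {w : BraidWord s} {D : InterpolationData w} {η : ℝ}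

theorem isTrigPoly_g (R : Execution w D η) (u : ℂ) :
    IsTrigPoly (2 * (s * w.length / 2)) (R.g u) := by
  have hs : 0 < s := by have := D.two_le; omega
  refine (IsTrigPoly.sum (Finset.range (s + 1))
    (fun a t => u ^ a * strandCoeff s R.Ft a (2 * t / s)) fun a _ => ?_).congr
      fun t => (R.g_eq_sum u t).symm
  refine IsTrigPoly.const_mul _ ?_
  refine ((isTrigPoly_strandCoeff hs R.isTrigPoly_Ft a).comp_two_mul).mono ?_
  refine Nat.mul_le_mul_left 2 (Nat.div_le_of_le_mul ?_)
  exact Nat.mul_le_mul (Nat.sub_le s a) le_rfl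

theorem isTrigPoly_A (R : Execution w D η) : IsTrigPoly (2 * R.crossings + 1) R.A :=
  R.At_trig.comp_two_mul.mul IsTrigPoly.cos

/-- The factor cos t changes sign under t ↦ t + π while Ã(e^{2it}) does not, so A has only odd
frequencies, and m is odd. -/
theorem exists_mvPolynomial_A (R : Execution w D η) {n m : ℕ} (hA : IsTrigPoly n R.A)
    (hn : n < m) (hm : Odd m) :
    ∃ p : MvPolynomial (Fin 3) ℂ, p.totalDegree ≤ m ∧ ∀ (u : ℂ) (r t : ℝ),
      MvPolynomial.eval ![u, r * Complex.exp (t * Complex.I),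
        (starRingEnd ℂ) (r * Complex.exp (t * Complex.I))] p = (r : ℂ) ^ m * R.A t := by
  obtain ⟨c, hc⟩ := hA
  obtain ⟨p, hp, hpe⟩ := exists_mvPolynomial
    ((Finset.Icc (-(n : ℤ)) n).filter Odd) m c (fun l => l) (by
      intro l hl
      simp only [Finset.mem_filter, Finset.mem_Icc] at hl
      obtain ⟨h1, h2⟩ := hl
      refine ⟨by omega, by omega, ?_⟩
      have : Odd (m : ℤ) := by exact_mod_cast hm
      exact (this.add_odd h2).two_dvd)
  refine ⟨p, hp, fun u r t => ?_⟩
  rw [hpe]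
  congr 1
  have hanti : R.A (t + Real.pi) = -R.A t := by
    have hper : R.At (2 * (t + Real.pi)) = R.At (2 * t) := by
      have := R.At_trig.periodic (2 * t)
      rw [← this]
      congr 1
      ring
    simp only [A, hper, Real.cos_add_pi]
    push_cast
    ring
  -- This antisymmetrization removes the even terms from the given expansion without discussing its
  -- coefficients.
  have h2 : 2 * R.A t = R.A t - R.A (t + Real.pi) := by
    rw [hanti]
    ring
  apply mul_left_cancel₀ (two_ne_zero (α := ℂ))
  rw [h2, hc, hc, ← Finset.sum_sub_distrib, Finset.mul_sum, Finset.sum_filter]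
  refine Finset.sum_congr rfl fun l _ => ?_
  have h3 : Complex.exp (l * ((t + Real.pi : ℝ) : ℂ) * Complex.I) =
      Complex.exp (l * t * Complex.I) * (-1) ^ l := by
    rw [← Complex.exp_pi_mul_I, ← Complex.exp_int_mul, ← Complex.exp_add]
    congr 1
    push_cast
    ring
  rw [h3]
  split_ifs with hl
  · rw [hl.neg_one_zpow]
    ring
  · rw [(Int.not_odd_iff_even.1 hl).neg_one_zpow]
    ring

/-- Only even frequencies 2l with |l| ≤ (s - a)N/s occur in the coefficient of u^a, and they fit
under r^{2k(s-a)} once N ≤ ks. Admissibility speaks of g, so this is recovered from the lower bound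
for the degree of g at u = 0. -/
theorem exists_mvPolynomial_g (R : Execution w D η) {k : ℕ} (hk : R.AdmissibleK k) :
    ∃ p : MvPolynomial (Fin 3) ℂ, p.totalDegree ≤ 2 * k * s ∧ ∀ (u : ℂ) (r t : ℝ), 0 < r →
      MvPolynomial.eval ![u, r * Complex.exp (t * Complex.I),
        (starRingEnd ℂ) (r * Complex.exp (t * Complex.I))] p =
        (r : ℂ) ^ (2 * k * s) * R.g (u / (r : ℂ) ^ (2 * k)) t := by
  classical
  have hs : 0 < s := by have := D.two_le; omega
  obtain ⟨n, hn, hg⟩ := hk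
  have hex : ∃ d, IsTrigPoly d (fun t => (R.Ft t : ℂ)) := ⟨_, R.isTrigPoly_Ft⟩
  set N := Nat.find hex with hN
  have hNt : IsTrigPoly N (fun t => (R.Ft t : ℂ)) := Nat.find_spec hex
  have h2N : 2 * N ≤ n := by
    refine two_mul_le_of_isTrigPoly_prod hs hNt (fun d hd => Nat.find_min hex hd) ?_
    refine ((hg 0).const_mul ((-1) ^ s)).congr fun t => ?_
    have : R.g 0 t = (-1) ^ s * ∏ j : Fin s, (R.Ft ((2 * t + 2 * Real.pi * (j : ℕ)) / s) : ℂ) := by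
      simp only [g, zero_sub, strand]
      rw [Finset.prod_neg]
      simp
    rw [this, ← mul_assoc, ← mul_pow]
    simp
  have hNk : N ≤ k * s := by
    have : 2 * k * s = 2 * (k * s) := by ring
    omega
  have hkpos : 0 < k := by
    by_contra h
    have : k = 0 := by omega
    simp [this] at hn
  have hco : ∀ a, ∃ p : MvPolynomial (Fin 3) ℂ, p.totalDegree ≤ 2 * k * (s - a) ∧
      ∀ (u : ℂ) (r t : ℝ), MvPolynomial.eval ![u, r * Complex.exp (t * Complex.I),
        (starRingEnd ℂ) (r * Complex.exp (t * Complex.I))] p =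
        (r : ℂ) ^ (2 * k * (s - a)) * strandCoeff s R.Ft a (2 * t / s) := by
    intro a
    obtain ⟨c, hc⟩ := isTrigPoly_strandCoeff hs hNt a
    obtain ⟨p, hp, hpe⟩ := exists_mvPolynomial
      (Finset.Icc (-(((s - a) * N / s : ℕ) : ℤ)) ((s - a) * N / s : ℕ)) (2 * k * (s - a)) c
      (fun l => 2 * l) (by
        intro l hl
        simp only [Finset.mem_Icc] at hl
        have h1 : (s - a) * N / s ≤ k * (s - a) := by
          refine Nat.div_le_of_le_mul ((Nat.mul_le_mul_left (s - a) hNk).trans (le_of_eq ?_))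
          ring
        have h2 : 2 * k * (s - a) = 2 * (k * (s - a)) := by ring
        rw [h2]
        generalize k * (s - a) = y at *
        generalize (s - a) * N / s = x at *
        push_cast
        omega)
    refine ⟨p, hp, fun u r t => ?_⟩
    rw [hpe]
    refine congrArg _ (Eq.trans ?_ (hc (2 * t)).symm)
    refine Finset.sum_congr rfl fun l _ => ?_
    congr 2
    push_cast
    ring
  choose p hp hpe using hco
  refine ⟨∑ a ∈ Finset.range (s + 1), MvPolynomial.X 0 ^ a * p a, ?_, fun u r t hr => ?_⟩
  · refine MvPolynomial.totalDegree_finsetSum_le fun a ha => ?_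
    refine (MvPolynomial.totalDegree_mul _ _).trans ?_
    rw [MvPolynomial.totalDegree_X_pow]
    refine (Nat.add_le_add_left (hp a) a).trans ?_
    have ha' : a ≤ s := by simpa [Nat.lt_succ_iff] using ha
    obtain ⟨b, rfl⟩ := Nat.exists_eq_add_of_le ha'
    rw [Nat.add_sub_cancel_left, mul_add]
    -- Since k > 0, the total degree a + 2k(s - a) of a term is at most 2ks.
    have : a * 1 ≤ 2 * k * a := by
      rw [mul_comm]
      exact Nat.mul_le_mul_right a (by omega)
    omega
  · rw [map_sum, g_eq_sum, Finset.mul_sum]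
    refine Finset.sum_congr rfl fun a ha => ?_
    have ha' : a ≤ s := by simpa [Nat.lt_succ_iff] using ha
    obtain ⟨b, hb⟩ := Nat.exists_eq_add_of_le ha'
    have hsa : s - a = b := by omega
    have hsk : 2 * k * s = 2 * k * b + 2 * k * a := by rw [hb]; ring
    have hr' : (r : ℂ) ≠ 0 := by exact_mod_cast hr.ne'
    rw [map_mul, map_pow, MvPolynomial.eval_X, hpe, hsa, hsk, div_pow, ← pow_mul, pow_add]
    simp only [Matrix.cons_val]
    field_simp

/-- For the least admissible exponents the output is a polynomial of the asserted degree. -/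
theorem exists_output (R : Execution w D η) : ∃ (k m : ℕ) (f : MvPolynomial (Fin 3) ℂ),
    IsLeast {k' | R.AdmissibleK k'} k ∧ IsLeast {m' | R.AdmissibleM k m'} m ∧
    R.IsOutput k m f ∧ f.totalDegree ≤ 2 * s * w.length * (s + 1) + 1 := by
  classical
  have h2 := D.two_le
  have hl := D.length_pos
  -- With this k, 2ks ≥ s(ℓ + 1) > sℓ, which bounds the degree of g.
  have hk0 : R.AdmissibleK (w.length / 2 + 1) := by
    refine ⟨2 * (s * w.length / 2), ?_, R.isTrigPoly_g⟩
    have h1 : s * (w.length + 1) ≤ s * (2 * (w.length / 2 + 1)) :=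
      Nat.mul_le_mul_left s (by omega)
    have h3 : 2 * (w.length / 2 + 1) * s = s * (2 * (w.length / 2 + 1)) := by ring
    rw [mul_add, mul_one] at h1
    omega
  have hkex : ∃ k, R.AdmissibleK k := ⟨_, hk0⟩
  obtain ⟨k, hk, hkmin⟩ : ∃ k, IsLeast {k' | R.AdmissibleK k'} k :=
    ⟨Nat.find hkex, Nat.find_spec hkex, fun k' hk' => Nat.find_min' hkex hk'⟩
  have hkle : k ≤ w.length / 2 + 1 := hkmin hk0
  -- The bound 2s²ℓ + 1 for the degree of A leaves a margin of 2sℓ, and 2ks ≤ (ℓ + 2)s ≤ 3sℓ.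
  have hm0 : R.AdmissibleM k (2 * s * w.length * (s + 1) + 1) := by
    refine ⟨⟨s * w.length * (s + 1), by ring⟩, ?_, 2 * R.crossings + 1, ?_, R.isTrigPoly_A⟩
    · have h3 : 2 * k * s ≤ (w.length + 2) * s := Nat.mul_le_mul_right s (by omega)
      have h4 : (w.length + 2) * s ≤ 2 * s * w.length * (s + 1) :=
        calc (w.length + 2) * s ≤ 3 * w.length * s := Nat.mul_le_mul_right s (by omega)
          _ = s * w.length * 3 := by ring
          _ ≤ s * w.length * (2 * (s + 1)) := Nat.mul_le_mul_left _ (by omega)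
          _ = 2 * s * w.length * (s + 1) := by ring
      omega
    · have h3 := R.crossings_le
      have h4 : 0 < s * w.length := by positivity
      have h5 : 2 * s * w.length * (s + 1) = 2 * (s * (s * w.length)) + 2 * (s * w.length) := by
        ring
      omega
  have hmex : ∃ m, R.AdmissibleM k m := ⟨_, hm0⟩
  obtain ⟨m, hm, hmmin⟩ : ∃ m, IsLeast {m' | R.AdmissibleM k m'} m :=
    ⟨Nat.find hmex, Nat.find_spec hmex, fun m' hm' => Nat.find_min' hmex hm'⟩
  have hmle := hmmin hm0
  obtain ⟨p, hp, hpe⟩ := R.exists_mvPolynomial_g hk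
  obtain ⟨hodd, hkm, n, hn, hA⟩ := hm
  obtain ⟨q, hq, hqe⟩ := R.exists_mvPolynomial_A hA hn hodd
  refine ⟨k, m, p + q, ⟨hk, hkmin⟩, ⟨⟨hodd, hkm, n, hn, hA⟩, hmmin⟩, fun u r t hr => ?_, ?_⟩
  · rw [map_add, hpe u r t hr, hqe]
  · refine (MvPolynomial.totalDegree_add _ _).trans (max_le ?_ (hq.trans hmle))
    exact hp.trans (hkm.le.trans hmle)

end Execution

/-! ### Words in adjacent transpositions -/

/-- Coxeter's relations of type `A` for the elements `f 0, ..., f (n - 1)`. -/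
structure CoxeterRelations {G : Type*} [Group G] (n : ℕ) (f : ℕ → G) : Prop where
  sq : ∀ j < n, f j * f j = 1
  comm : ∀ i j, i + 1 < j → j < n → f i * f j = f j * f i
  braid : ∀ i, i + 1 < n → f i * f (i + 1) * f i = f (i + 1) * f i * f (i + 1)

/-- The product `f n * f (n - 1) * ⋯` of `k` factors. -/
def descendingProd {G : Type*} [Group G] (f : ℕ → G) (n : ℕ) : ℕ → G
  | 0 => 1
  | k + 1 => descendingProd f n k * f (n - k)

section Coxeter

variable {G : Type*} [Group G] {n : ℕ} {f : ℕ → G}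

/-- All factors have index at least n - k + 1, which exceeds n - i by at least 2. -/
theorem descendingProd_mul_comm (h : CoxeterRelations (n + 1) f) {i k : ℕ} (hki : k < i)
    (hi : i ≤ n) : descendingProd f n k * f (n - i) = f (n - i) * descendingProd f n k := by
  induction k with
  | zero => simp [descendingProd]
  | succ k ih =>
    rw [descendingProd, mul_assoc, ← h.comm (n - i) (n - k) (by omega) (by omega), ← mul_assoc,
      ih (by omega), mul_assoc]

/-- The generator commutes with the last factors until it meets f(n-i) f(n-i-1); the braid relation
turns it into f(n-i-1), which commutes with the remaining factors on its left. -/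
theorem descendingProd_mul_of_lt (h : CoxeterRelations (n + 1) f) {i k : ℕ} (hik : i + 2 ≤ k)
    (hk : k ≤ n + 1) :
    descendingProd f n k * f (n - i) = f (n - (i + 1)) * descendingProd f n k := by
  induction k, hik using Nat.le_induction with
  | base =>
    have hb := h.braid (n - (i + 1)) (by omega)
    rw [show n - (i + 1) + 1 = n - i by omega] at hb
    rw [descendingProd, descendingProd, mul_assoc, mul_assoc, ← mul_assoc (f (n - i)), ← hb,
      mul_assoc (f _), ← mul_assoc, descendingProd_mul_comm h (Nat.lt_succ_self i) (by omega)]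
    simp only [mul_assoc]
  | succ k hik ih =>
    rw [descendingProd, mul_assoc, h.comm (n - k) (n - i) (by omega) (by omega), ← mul_assoc,
      ih (by omega), mul_assoc]

/-- The descending products represent the cosets of the subgroup generated by f 0, ..., f (n-1).
Right multiplication by f (n-i) either passes a generator into the subgroup (i > k or i + 1 < k), or
lengthens (i = k) or shortens (i + 1 = k) the product. -/
theorem exists_normal_form (h : CoxeterRelations (n + 1) f) (L : List ℕ) (hL : ∀ j ∈ L, j < n + 1) :
    ∃ (L' : List ℕ) (k : ℕ), (∀ j ∈ L', j < n) ∧ k ≤ n + 1 ∧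
      (L.map f).prod = (L'.map f).prod * descendingProd f n k := by
  induction L using List.reverseRecOn with
  | nil => exact ⟨[], 0, by simp, by simp, by simp [descendingProd]⟩
  | append_singleton L j ih =>
    obtain ⟨L', k, h1, h2, h3⟩ := ih fun i hi => hL i (by simp [hi])
    have hj : j < n + 1 := hL j (by simp)
    obtain ⟨i, hi, rfl⟩ : ∃ i ≤ n, j = n - i := ⟨n - j, by omega, by omega⟩
    rw [List.map_append, List.prod_append, h3]
    simp only [List.map_cons, List.map_nil, List.prod_cons, List.prod_nil, mul_one, mul_assoc]
    rcases lt_trichotomy i k with hik | rfl | hik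
    · rcases Nat.lt_or_ge (i + 1) k with hik' | hik'
      · refine ⟨L' ++ [n - (i + 1)], k, ?_, h2, ?_⟩
        · intro a ha
          rcases List.mem_append.1 ha with ha | ha
          · exact h1 a ha
          · simp only [List.mem_singleton] at ha
            omega
        · rw [descendingProd_mul_of_lt h hik' h2]
          simp [mul_assoc]
      · obtain rfl : k = i + 1 := by omega
        refine ⟨L', i, h1, by omega, ?_⟩
        rw [descendingProd, mul_assoc, h.sq _ hj, mul_one]
    · exact ⟨L', i + 1, h1, by omega, rfl⟩
    · refine ⟨L' ++ [n - i], k, ?_, h2, ?_⟩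
      · intro a ha
        rcases List.mem_append.1 ha with ha | ha
        · exact h1 a ha
        · simp only [List.mem_singleton] at ha
          omega
      · rw [descendingProd_mul_comm h hik hi]
        simp [mul_assoc]

/-- The transposition of `j` and `j + 1`. -/
def natSwap (j : ℕ) : Equiv.Perm ℕ := Equiv.swap j (j + 1)

theorem coxeterRelations_natSwap (n : ℕ) : CoxeterRelations n natSwap where
  sq j _ := Equiv.swap_mul_self _ _
  comm i j hij _ := by
    ext x
    simp only [natSwap, Equiv.Perm.mul_apply, Equiv.swap_apply_def]
    split_ifs <;> omega
  braid i _ := by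
    ext x
    simp only [natSwap, Equiv.Perm.mul_apply, Equiv.swap_apply_def]
    split_ifs <;> omega

theorem CoxeterRelations.prod {H : Type*} [Group H] {g : ℕ → H} (hf : CoxeterRelations n f)
    (hg : CoxeterRelations n g) : CoxeterRelations n (fun j => (f j, g j)) where
  sq j hj := Prod.ext (hf.sq j hj) (hg.sq j hj)
  comm i j hij hj := Prod.ext (hf.comm i j hij hj) (hg.comm i j hij hj)
  braid i hi := Prod.ext (hf.braid i hi) (hg.braid i hi)

theorem CoxeterRelations.mono {m : ℕ} (h : m ≤ n) (hf : CoxeterRelations n f) :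
    CoxeterRelations m f where
  sq j hj := hf.sq j (hj.trans_le h)
  comm i j hij hj := hf.comm i j hij (hj.trans_le h)
  braid i hi := hf.braid i (hi.trans_le h)

/-- This lets k be read off from the permutation. -/
theorem descendingProd_natSwap {n k : ℕ} (hk : k ≤ n + 1) :
    descendingProd natSwap n k (n + 1 - k) = n + 1 := by
  induction k with
  | zero => simp [descendingProd]
  | succ k ih =>
    rw [descendingProd, Equiv.Perm.mul_apply]
    convert ih (by omega) using 2
    rw [natSwap, show n + 1 - (k + 1) = n - k by omega, Equiv.swap_apply_left]
    omega

theorem prod_natSwap_apply_of_lt (L : List ℕ) {x : ℕ} (hL : ∀ j ∈ L, j + 1 < x) :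
    (L.map natSwap).prod x = x := by
  induction L with
  | nil => simp
  | cons j L ih =>
    have hj := hL j (by simp)
    rw [List.map_cons, List.prod_cons, Equiv.Perm.mul_apply, ih fun i hi => hL i (by simp [hi]),
      natSwap, Equiv.swap_apply_of_ne_of_ne (by omega) (by omega)]

/-- Relations between adjacent transpositions follow from Coxeter's relations. -/
theorem CoxeterRelations.prod_eq_one (hf : CoxeterRelations n f) (L : List ℕ)
    (hL : ∀ j ∈ L, j < n) (h : (L.map natSwap).prod = 1) : (L.map f).prod = 1 := by
  induction n generalizing L with
  | zero =>
    cases L with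
    | nil => simp
    | cons j L => exact absurd (hL j (by simp)) (by omega)
  | succ n ih =>
    -- Working in the product group gives the same normal form for f and for the transpositions.
    have hp := hf.prod (coxeterRelations_natSwap (n + 1))
    obtain ⟨L', k, h1, h2, h3⟩ := exists_normal_form hp L hL
    have hfst : ∀ M : List ℕ, (M.map fun j => (f j, natSwap j)).prod =
        ((M.map f).prod, (M.map natSwap).prod) := by
      intro M
      induction M with
      | nil => rfl
      | cons a M ihM => simp [ihM]
    have hdesc : ∀ k, descendingProd (fun j => (f j, natSwap j)) n k =
        (descendingProd f n k, descendingProd natSwap n k) := by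
      intro k
      induction k with
      | zero => rfl
      | succ k ihk => simp [descendingProd, ihk]
    rw [hfst, hfst, hdesc, Prod.mk_mul_mk, Prod.mk.injEq] at h3
    obtain ⟨h4, h5⟩ := h3
    -- The descending product sends n + 1 - k to n + 1, which L' fixes; as the whole word is
    -- trivial, k = 0.
    have h6 := congrArg (fun π : Equiv.Perm ℕ => π (n + 1 - k)) h5
    simp only [h, Equiv.Perm.mul_apply, descendingProd_natSwap h2, Equiv.Perm.one_apply] at h6
    rw [prod_natSwap_apply_of_lt L' fun j hj => by have := h1 j hj; omega] at h6
    obtain rfl : k = 0 := by omega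
    simp only [descendingProd, mul_one] at h4 h5
    rw [h4]
    exact ih (hf.mono (Nat.le_succ n)) L' h1 (by rw [← h5, h])

end Coxeter

/-! ### Signs for which a word of crossings represents a single generator -/

/-- The excluded sign patterns (1, -1, 1) and (-1, 1, -1) are those of three strands lying
cyclically over each other. -/
theorem zpow_braid {G : Type*} [Group G] {x y : G} (h : x * y * x = y * x * y) (a b c : ℤˣ)
    (hb : b = a ∨ b = c) :
    x ^ (a : ℤ) * y ^ (b : ℤ) * x ^ (c : ℤ) = y ^ (c : ℤ) * x ^ (b : ℤ) * y ^ (a : ℤ) := by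
  have key : ∀ {x y : G}, x * y * x = y * x * y → x * y * x⁻¹ = y⁻¹ * x * y := by
    intro x y h
    rw [mul_inv_eq_iff_eq_mul, mul_assoc, mul_assoc, eq_inv_mul_iff_mul_eq, ← mul_assoc, ← h,
      mul_assoc]
  have h1 := key h
  have h2 := key h.symm
  have h3 : x⁻¹ * y⁻¹ * x⁻¹ = y⁻¹ * x⁻¹ * y⁻¹ := by
    have := congrArg (·⁻¹) h
    simpa [mul_assoc] using this
  have h4 := congrArg (·⁻¹) h1
  have h5 := congrArg (·⁻¹) h2
  simp only [mul_inv_rev, inv_inv, ← mul_assoc] at h4 h5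
  rcases Int.units_eq_one_or a with rfl | rfl <;> rcases Int.units_eq_one_or b with rfl | rfl <;>
    rcases Int.units_eq_one_or c with rfl | rfl <;>
    simp_all

theorem commute_of {s : ℕ} {i j : Fin (s - 1)} (hij : (i : ℕ) + 1 < j) :
    Commute (PresentedGroup.of i : BraidGroup s) (PresentedGroup.of j) :=
  PresentedGroup.mk_eq_mk_of_mul_inv_mem (Or.inl ⟨i, j, hij, rfl⟩)

theorem braid_of {s : ℕ} {i j : Fin (s - 1)} (hij : (i : ℕ) + 1 = j) :
    (PresentedGroup.of i * PresentedGroup.of j * PresentedGroup.of i : BraidGroup s) =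
      PresentedGroup.of j * PresentedGroup.of i * PresentedGroup.of j :=
  PresentedGroup.mk_eq_mk_of_mul_inv_mem (Or.inr ⟨i, j, hij, rfl⟩)

/-- The sign of a crossing of the strands in the positions `j` and `j + 1` when the strands with
a smaller number lie over (`ε = 1`), or under (`ε = -1`), those with a larger number. -/
def layerSign {s : ℕ} (ε : ℤˣ) (j : Fin (s - 1)) (π : Equiv.Perm (Fin s)) : ℤˣ :=
  if π⁻¹ ⟨j, by omega⟩ < π⁻¹ ⟨j + 1, by omega⟩ then ε else -ε

/-- The effect of a crossing on the positions of the strands and on the braid. -/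
def crossStep {s : ℕ} (ε : ℤˣ) (j : Fin (s - 1)) (x : Equiv.Perm (Fin s) × BraidGroup s) :
    Equiv.Perm (Fin s) × BraidGroup s :=
  (adjacentSwap j * x.1, x.2 * PresentedGroup.of j ^ (layerSign ε j x.1 : ℤ))

theorem adjacentSwap_val {s : ℕ} (j : Fin (s - 1)) (p : Fin s) :
    ((adjacentSwap j p : Fin s) : ℕ) = natSwap j p := by
  simp only [adjacentSwap, natSwap, Equiv.swap_apply_def, Fin.ext_iff]
  split_ifs <;> rfl

theorem inv_adjacentSwap_mul {s : ℕ} (j : Fin (s - 1)) (π : Equiv.Perm (Fin s)) (p : Fin s) :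
    (adjacentSwap j * π)⁻¹ p = π⁻¹ (adjacentSwap j p) := by
  rw [mul_inv_rev, Equiv.Perm.mul_apply, adjacentSwap, Equiv.swap_inv]

theorem adjacentSwap_mul_self {s : ℕ} (j : Fin (s - 1)) :
    (adjacentSwap j * adjacentSwap j : Equiv.Perm (Fin s)) = 1 := Equiv.swap_mul_self _ _

theorem adjacentSwap_mul_comm {s : ℕ} {i j : Fin (s - 1)} (hij : (i : ℕ) + 1 < j) :
    (adjacentSwap i * adjacentSwap j : Equiv.Perm (Fin s)) = adjacentSwap j * adjacentSwap i := by
  ext p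
  have := congrArg (fun π : Equiv.Perm ℕ => π p)
    ((coxeterRelations_natSwap s).comm i j hij (by omega))
  rwa [Equiv.Perm.mul_apply, Equiv.Perm.mul_apply, adjacentSwap_val, adjacentSwap_val,
    adjacentSwap_val, adjacentSwap_val]

theorem adjacentSwap_braid {s : ℕ} {i j : Fin (s - 1)} (hij : (i : ℕ) + 1 = j) :
    (adjacentSwap i * adjacentSwap j * adjacentSwap i : Equiv.Perm (Fin s)) =
      adjacentSwap j * adjacentSwap i * adjacentSwap j := by
  ext p
  have := congrArg (fun π : Equiv.Perm ℕ => π p)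
    ((coxeterRelations_natSwap s).braid i (by omega))
  simp only [Equiv.Perm.mul_apply, hij] at this
  rw [Equiv.Perm.mul_apply, Equiv.Perm.mul_apply, Equiv.Perm.mul_apply, Equiv.Perm.mul_apply,
    adjacentSwap_val, adjacentSwap_val, adjacentSwap_val, adjacentSwap_val, adjacentSwap_val,
    adjacentSwap_val, this]

theorem adjacentSwap_left {s : ℕ} (j : Fin (s - 1)) :
    adjacentSwap j ⟨j, by omega⟩ = (⟨j + 1, by omega⟩ : Fin s) := Equiv.swap_apply_left _ _

theorem adjacentSwap_right {s : ℕ} (j : Fin (s - 1)) :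
    adjacentSwap j ⟨j + 1, by omega⟩ = (⟨j, by omega⟩ : Fin s) := Equiv.swap_apply_right _ _

theorem adjacentSwap_of_ne {s : ℕ} (j : Fin (s - 1)) {p : ℕ} (hp : p < s) (h1 : p ≠ j)
    (h2 : p ≠ j + 1) : adjacentSwap j ⟨p, hp⟩ = (⟨p, hp⟩ : Fin s) :=
  Equiv.swap_apply_of_ne_of_ne (by simpa [Fin.ext_iff] using h1) (by simpa [Fin.ext_iff] using h2)

/-- When two strands cross again at once, their order has been reversed; the second sign is opposite
and the crossings cancel. -/
theorem crossStep_involutive {s : ℕ} (ε : ℤˣ) (j : Fin (s - 1)) :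
    Function.Involutive (crossStep ε j) := by
  rintro ⟨π, β⟩
  have hne : π⁻¹ (⟨j, by omega⟩ : Fin s) ≠ π⁻¹ ⟨j + 1, by omega⟩ := by
    simp [Fin.ext_iff]
  have hs : layerSign ε j (adjacentSwap j * π) = -layerSign ε j π := by
    simp only [layerSign, inv_adjacentSwap_mul, adjacentSwap_left, adjacentSwap_right]
    rcases lt_or_gt_of_ne hne with h | h
    · rw [if_pos h, if_neg h.not_gt]
    · rw [if_pos h, if_neg h.not_gt, neg_neg]
  simp only [crossStep, hs, ← mul_assoc, adjacentSwap_mul_self, one_mul]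
  simp [mul_assoc]

/-- The steps `crossStep` as permutations, with natural numbers as indices. -/
noncomputable def crossPerm (s : ℕ) (ε : ℤˣ) (j : ℕ) :
    Equiv.Perm (Equiv.Perm (Fin s) × BraidGroup s) :=
  if h : j < s - 1 then (crossStep_involutive ε ⟨j, h⟩).toPerm else 1

theorem crossPerm_apply {s : ℕ} (ε : ℤˣ) {j : ℕ} (h : j < s - 1)
    (x : Equiv.Perm (Fin s) × BraidGroup s) : crossPerm s ε j x = crossStep ε ⟨j, h⟩ x := by
  simp [crossPerm, h]

/-- A sign depends only on the two strands that cross. In the braid relation the same three pairs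
cross in opposite orders, and `zpow_braid` applies because the layers are linearly ordered. -/
theorem coxeterRelations_crossPerm (s : ℕ) (ε : ℤˣ) :
    CoxeterRelations (s - 1) (crossPerm s ε) where
  sq j hj := by
    ext1 x
    rw [Equiv.Perm.mul_apply, crossPerm_apply ε hj, crossPerm_apply ε hj,
      crossStep_involutive ε ⟨j, hj⟩ x, Equiv.Perm.one_apply]
  comm i j hij hj := by
    have hi : i < s - 1 := by omega
    ext1 ⟨π, β⟩
    simp only [Equiv.Perm.mul_apply, crossPerm_apply ε hj, crossPerm_apply ε hi, crossStep,
      layerSign, inv_adjacentSwap_mul]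
    rw [adjacentSwap_of_ne ⟨i, hi⟩ (p := j) (by omega) (by simp; omega) (by simp; omega),
      adjacentSwap_of_ne ⟨i, hi⟩ (p := j + 1) (by omega) (by simp; omega) (by simp; omega),
      adjacentSwap_of_ne ⟨j, hj⟩ (p := i) (by omega) (by simp; omega) (by simp; omega),
      adjacentSwap_of_ne ⟨j, hj⟩ (p := i + 1) (by omega) (by simp; omega) (by simp; omega)]
    refine Prod.ext ?_ ?_
    · simp only [← mul_assoc]
      exact congrArg (· * π) (adjacentSwap_mul_comm (i := ⟨i, hi⟩) (j := ⟨j, hj⟩) hij)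
    · simp only [mul_assoc]
      congr 1
      have hc : Commute (PresentedGroup.of ⟨i, hi⟩ : BraidGroup s) (PresentedGroup.of ⟨j, hj⟩) :=
        commute_of hij
      exact (hc.zpow_zpow _ _).eq.symm
  braid i hi := by
    have hi' : i < s - 1 := by omega
    ext1 ⟨π, β⟩
    simp only [Equiv.Perm.mul_apply, crossPerm_apply ε hi, crossPerm_apply ε hi', crossStep,
      layerSign, inv_adjacentSwap_mul]
    have e1 := adjacentSwap_left ⟨i, hi'⟩
    have e2 := adjacentSwap_right ⟨i, hi'⟩
    have e3 := adjacentSwap_left ⟨i + 1, hi⟩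
    have e4 := adjacentSwap_right ⟨i + 1, hi⟩
    have e5 := adjacentSwap_of_ne ⟨i, hi'⟩ (p := i + 1 + 1) (by omega) (by simp; omega)
      (by simp)
    have e6 := adjacentSwap_of_ne ⟨i + 1, hi⟩ (p := i) (by omega) (by simp) (by simp; omega)
    simp only at e1 e2 e3 e4 e5 e6
    simp only [e1, e2, e3, e4, e5, e6]
    refine Prod.ext ?_ ?_
    · simp only [← mul_assoc]
      exact congrArg (· * π) (adjacentSwap_braid (i := ⟨i, hi'⟩) (j := ⟨i + 1, hi⟩) rfl)
    · simp only [mul_assoc]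
      congr 1
      have hb : (PresentedGroup.of ⟨i, hi'⟩ * PresentedGroup.of ⟨i + 1, hi⟩ *
          PresentedGroup.of ⟨i, hi'⟩ : BraidGroup s) = _ := braid_of rfl
      simp only [← mul_assoc]
      refine zpow_braid hb _ _ _ ?_
      -- A middle sign different from both outer ones would make the order of the three strands
      -- cyclic.
      split_ifs <;> first | exact Or.inl rfl | exact Or.inr rfl | (exfalso; order)

theorem prod_reverse_map_apply {X ι : Type*} (f : ι → Equiv.Perm X) (L : List ι) (x : X) :
    (L.reverse.map f).prod x = L.foldl (fun x j => f j x) x := by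
  induction L generalizing x with
  | nil => simp
  | cons a L ih =>
    rw [List.reverse_cons, List.map_append, List.prod_append, Equiv.Perm.mul_apply, ih]
    simp

theorem prod_natSwap_apply {s : ℕ} (L : List (Fin (s - 1))) (p : Fin s) :
    (L.map (fun j : Fin (s - 1) => natSwap (j : ℕ))).prod (p : ℕ) = ((L.map adjacentSwap).prod p : Fin s) := by
  induction L with
  | nil => simp
  | cons a L ih =>
    rw [List.map_cons, List.prod_cons, Equiv.Perm.mul_apply, ih, List.map_cons, List.prod_cons,
      Equiv.Perm.mul_apply, adjacentSwap_val]

theorem exists_foldl_crossStep {s : ℕ} (ε : ℤˣ) (L : List (Fin (s - 1)))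
    (x : Equiv.Perm (Fin s) × BraidGroup s) : ∃ v : BraidWord s, v.map Prod.fst = L ∧
      (L.foldl (fun x j => crossStep ε j x) x).2 = x.2 * v.toBraid := by
  induction L generalizing x with
  | nil => exact ⟨[], rfl, by simp [BraidWord.toBraid]⟩
  | cons a L ih =>
    obtain ⟨v, h1, h2⟩ := ih (crossStep ε a x)
    refine ⟨(a, layerSign ε a x.1) :: v, by simp [h1], ?_⟩
    rw [List.foldl_cons, h2, crossStep, BraidWord.toBraid, BraidWord.toBraid, List.map_cons,
      List.prod_cons, mul_assoc]

/-- Layered signs give a braid depending only on the permutation, so L yields the same braid as the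
one-letter word i. -/
theorem exists_signs {s : ℕ} (L : List (Fin (s - 1))) (i : Fin (s - 1)) (ε : ℤˣ)
    (h : (L.reverse.map adjacentSwap).prod = (adjacentSwap i : Equiv.Perm (Fin s))) :
    ∃ v : BraidWord s, v.map Prod.fst = L ∧
      v.toBraid = (PresentedGroup.of i : BraidGroup s) ^ (ε : ℤ) := by
  have hrel := coxeterRelations_crossPerm s ε
  have hprod := hrel.prod_eq_one ((i :: L.reverse).map (fun j : Fin (s - 1) => (j : ℕ)))
    (by
      intro j hj
      obtain ⟨a, -, rfl⟩ := List.mem_map.1 hj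
      exact a.2)
    (by
      ext x
      rw [List.map_map]
      by_cases hx : x < s
      · have := prod_natSwap_apply (i :: L.reverse) ⟨x, hx⟩
        refine this.trans ?_
        rw [List.map_cons, List.prod_cons, h, adjacentSwap_mul_self]
        rfl
      · rw [← List.map_map]
        refine prod_natSwap_apply_of_lt _ fun j hj => ?_
        obtain ⟨a, -, rfl⟩ := List.mem_map.1 hj
        omega)
  rw [List.map_map, List.map_cons, List.prod_cons] at hprod
  -- The step at i is its own inverse, so the word L acts as that single step; it is applied to the
  -- identity permutation and the trivial braid.
  have h1 := congrArg (fun π => π (1, 1)) (mul_left_cancel (hprod.trans (hrel.sq i i.2).symm))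
  simp only [prod_reverse_map_apply, Function.comp_apply] at h1
  simp only [crossPerm_apply ε (Fin.is_lt _), Fin.eta] at h1
  obtain ⟨v, hv1, hv2⟩ := exists_foldl_crossStep ε L ((1, 1) : Equiv.Perm (Fin s) × BraidGroup s)
  refine ⟨v, hv1, ?_⟩
  rw [h1, one_mul] at hv2
  rw [← hv2, crossStep, layerSign, if_pos, one_mul]
  simp [Fin.lt_def]

/-! ### The permutation of a braid that closes to a knot -/

/-- The modulus of the second coordinate determines the common denominator. -/
theorem torusEmbedding_inj {z z' : ℂ} {θ θ' : ℝ} (h : torusEmbedding z θ = torusEmbedding z' θ') :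
    z = z' ∧ Complex.exp (θ * Complex.I) = Complex.exp (θ' * Complex.I) := by
  have hpos : ∀ z : ℂ, 0 < √(1 + ‖z‖ ^ 2) := fun z => Real.sqrt_pos.2 (by positivity)
  simp only [torusEmbedding, Subtype.mk.injEq, Prod.mk.injEq] at h
  obtain ⟨h1, h2⟩ := h
  have h3 := congrArg norm h2
  simp only [norm_div, Complex.norm_exp_ofReal_mul_I, Complex.norm_real, Real.norm_eq_abs,
    abs_of_pos (hpos z), abs_of_pos (hpos z')] at h3
  have h4 : √(1 + ‖z‖ ^ 2) = √(1 + ‖z'‖ ^ 2) := by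
    have := hpos z
    have := hpos z'
    field_simp at h3
    exact h3.symm
  have h5 : ((√(1 + ‖z'‖ ^ 2) : ℝ) : ℂ) ≠ 0 := by exact_mod_cast (hpos z').ne'
  rw [h4] at h1 h2
  exact ⟨(div_left_inj' h5).1 h1, (div_left_inj' h5).1 h2⟩

theorem letterMotion_injective {s : ℕ} (a : Option (Fin (s - 1) × ℤˣ)) (x : ℝ) {p q : Fin s}
    (h : letterMotion a p x = letterMotion a q x) : p = q := by
  rcases a with _ | ⟨i, ε⟩
  · simp only [letterMotion] at h
    exact Fin.ext (by exact_mod_cast h)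
  set E := Complex.exp (((ε : ℤ) : ℂ) * Real.pi * x * Complex.I) with hE
  have hE1 : ‖E‖ = 1 := by
    rw [hE, show ((ε : ℤ) : ℂ) * Real.pi * x * Complex.I =
      (((ε : ℤ) * Real.pi * x : ℝ) : ℂ) * Complex.I by push_cast; ring]
    exact Complex.norm_exp_ofReal_mul_I _
  have hE0 : E ≠ 0 := Complex.exp_ne_zero _
  -- The moving strands stay on the circle with diameter [i, i + 1], which contains no other
  -- integer.
  have hfar : ∀ r : ℕ, r ≠ i → r ≠ i + 1 → ∀ c : ℂ, ‖c‖ = 1 →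
      (r : ℂ) ≠ (i : ℕ) + 1 / 2 + 1 / 2 * c := by
    intro r h1 h2 c hc h3
    have h4 : 2 * ((r : ℂ) - (i : ℕ)) - 1 = c := by
      rw [h3]
      ring
    have h5 : |2 * ((r : ℝ) - (i : ℕ)) - 1| = 1 := by
      rw [← Real.norm_eq_abs, ← Complex.norm_real]
      push_cast
      rw [h4, hc]
    have h6 : |2 * ((r : ℤ) - (i : ℕ)) - 1| = 1 := by exact_mod_cast h5
    rcases abs_cases (2 * ((r : ℤ) - (i : ℕ)) - 1) with h7 | h7 <;> omega
  have hneg : ‖-E‖ = 1 := by rw [norm_neg, hE1]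
  simp only [letterMotion, ← hE] at h
  by_contra hpq
  have hpq' : (p : ℕ) ≠ q := fun h => hpq (Fin.ext h)
  split_ifs at h with h1 h2 h3 h4 h5 h6 h7 h8
  · omega
  · apply hE0
    linear_combination -h
  · exact hfar q h2 h3 (-E) hneg (by rw [← h]; ring)
  · apply hE0
    linear_combination h
  · omega
  · exact hfar q h5 h6 E hE1 h.symm
  · exact hfar p h1 h4 (-E) hneg (by rw [h]; ring)
  · exact hfar p h1 h4 E hE1 h
  · exact hpq' (by exact_mod_cast h)

theorem letterMotion_zero {s : ℕ} (a : Option (Fin (s - 1) × ℤˣ)) (p : Fin s) :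
    letterMotion a p 0 = (p : ℕ) := by
  rcases a with _ | ⟨i, ε⟩
  · rfl
  · simp only [letterMotion]
    split_ifs with h1 h2
    · simp [h1]
    · simp [h2]
      ring
    · rfl

theorem letterMotion_some_one {s : ℕ} (a : Fin (s - 1) × ℤˣ) (p : Fin s) :
    letterMotion (some a) p 1 = ((adjacentSwap a.1 p : Fin s) : ℕ) := by
  obtain ⟨i, ε⟩ := a
  have hE : Complex.exp (((ε : ℤ) : ℂ) * Real.pi * (1 : ℝ) * Complex.I) = -1 := by
    rcases Int.units_eq_one_or ε with rfl | rfl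
    · simp
    · have : -(Real.pi : ℂ) * Complex.I = -(Real.pi * Complex.I) := by ring
      simp [this, Complex.exp_neg]
  rw [adjacentSwap_val]
  simp only [letterMotion, hE, natSwap, Equiv.swap_apply_def]
  split_ifs with h1 h2
  · push_cast
    ring
  · ring
  · rfl

theorem continuous_letterMotion {s : ℕ} (a : Option (Fin (s - 1) × ℤˣ)) (p : Fin s) :
    Continuous (letterMotion a p) := by
  rcases a with _ | ⟨i, ε⟩
  · exact continuous_const
  · unfold letterMotion
    dsimp only
    split_ifs <;> fun_prop

theorem continuous_torusEmbedding {f : ℝ → ℂ} {g : ℝ → ℝ} (hf : Continuous f)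
    (hg : Continuous g) : Continuous fun x => torusEmbedding (f x) (g x) := by
  have h : ∀ x, ((√(1 + ‖f x‖ ^ 2) : ℝ) : ℂ) ≠ 0 := fun x => by
    exact_mod_cast (Real.sqrt_pos.2 (by positivity)).ne'
  refine Continuous.subtype_mk (Continuous.prodMk ?_ ?_) _
  · exact hf.div (by fun_prop) h
  · exact Continuous.div (by fun_prop) (by fun_prop) h

namespace BraidWord

variable {s : ℕ} (w : BraidWord s)

theorem position_zero : w.position 0 = 1 := rfl

theorem position_succ {k : ℕ} (hk : k < w.length) :
    w.position (k + 1) = adjacentSwap w[k].1 * w.position k := by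
  rw [position, List.take_add_one, List.getElem?_eq_getElem hk, Option.toList_some,
    List.foldl_append]
  rfl

/-- The point of the closure on the strand starting in position `p`, in the `k`-th interval. -/
noncomputable def closurePoint (k : ℕ) (p : Fin s) (x : ℝ) : ThreeSphere :=
  torusEmbedding (letterMotion w[k]? (w.position k p) x)
    (2 * Real.pi * (k + x) / (w.length + 1))

/-- The part of the closure formed by the strands which start in `S`. -/
def closurePart (S : Set (Fin s)) : Set ThreeSphere :=
  ⋃ k ∈ Finset.range (w.length + 1), ⋃ p ∈ S, w.closurePoint k p '' Set.Icc 0 1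

theorem isClosed_closurePart (S : Set (Fin s)) : IsClosed (w.closurePart S) := by
  refine (Finset.range (w.length + 1)).finite_toSet.isClosed_biUnion fun k _ => ?_
  refine S.toFinite.isClosed_biUnion fun p _ => ?_
  refine (isCompact_Icc.image ?_).isClosed
  exact continuous_torusEmbedding (continuous_letterMotion _ _) (by fun_prop)

theorem mem_closurePart {S : Set (Fin s)} {q : ThreeSphere} : q ∈ w.closurePart S ↔
    ∃ k ≤ w.length, ∃ p ∈ S, ∃ x ∈ Set.Icc (0 : ℝ) 1, w.closurePoint k p x = q := by
  simp only [closurePart, Set.mem_iUnion, Set.mem_image, Finset.mem_range, Nat.lt_succ_iff,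
    exists_prop]

/-- The half-open interval makes the parameters of a point unique, as disjointness requires. An end
point belongs to the next interval, and after the last one to the next strand, again in S by
invariance. -/
theorem exists_lt_one_of_mem_closurePart {S : Set (Fin s)}
    (hS : ∀ p ∈ S, w.position w.length p ∈ S) {q : ThreeSphere} (hq : q ∈ w.closurePart S) :
    ∃ k ≤ w.length, ∃ p ∈ S, ∃ x ∈ Set.Ico (0 : ℝ) 1, w.closurePoint k p x = q := by
  obtain ⟨k, hk, p, hp, x, hx, rfl⟩ := w.mem_closurePart.1 hq
  rcases hx.2.lt_or_eq with hx1 | rfl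
  · exact ⟨k, hk, p, hp, x, ⟨hx.1, hx1⟩, rfl⟩
  rcases hk.lt_or_eq with hk | rfl
  · refine ⟨k + 1, hk, p, hp, 0, by simp, ?_⟩
    simp only [closurePoint]
    rw [letterMotion_zero, List.getElem?_eq_getElem hk, letterMotion_some_one, position_succ w hk]
    simp
  · refine ⟨0, Nat.zero_le _, _, hS p hp, 0, by simp, ?_⟩
    simp only [closurePoint, letterMotion_zero]
    rw [List.getElem?_eq_none le_rfl, letterMotion, position_zero, Equiv.Perm.one_apply]
    have h1 : (2 * Real.pi * ((w.length : ℝ) + 1) / (w.length + 1)) = 2 * Real.pi := by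
      field_simp
    have h2 : Complex.exp (((2 * Real.pi : ℝ) : ℂ) * Complex.I) = 1 := by
      push_cast
      exact Complex.exp_two_pi_mul_I
    rw [h1]
    simp [torusEmbedding, Complex.exp_two_pi_mul_I]

/-- The angle determines the interval and the time in it; different strands have different positions
at each time. -/
theorem closurePart_disjoint {S T : Set (Fin s)} (hST : Disjoint S T)
    (hS : ∀ p ∈ S, w.position w.length p ∈ S) (hT : ∀ p ∈ T, w.position w.length p ∈ T) :
    w.closurePart S ∩ w.closurePart T = ∅ := by
  rw [Set.eq_empty_iff_forall_notMem]
  rintro q ⟨hq1, hq2⟩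
  obtain ⟨k, hk, p, hp, x, hx, rfl⟩ := w.exists_lt_one_of_mem_closurePart hS hq1
  obtain ⟨k', hk', p', hp', x', hx', h⟩ := w.exists_lt_one_of_mem_closurePart hT hq2
  obtain ⟨h1, h2⟩ := torusEmbedding_inj h
  obtain ⟨n, hn⟩ := Complex.exp_eq_exp_iff_exists_int.1 h2
  have hL : (0 : ℝ) < w.length + 1 := by positivity
  have h3 : (k' : ℝ) + x' = k + x + n * (w.length + 1) := by
    have h4 : 2 * Real.pi * (k' + x') / (w.length + 1) =
        2 * Real.pi * (k + x) / (w.length + 1) + n * (2 * Real.pi) := by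
      have : ((2 * Real.pi * (k' + x') / (w.length + 1) : ℝ) : ℂ) =
          ((2 * Real.pi * (k + x) / (w.length + 1) + n * (2 * Real.pi) : ℝ) : ℂ) := by
        apply mul_right_cancel₀ Complex.I_ne_zero
        rw [hn]
        push_cast
        ring
      exact_mod_cast this
    have hpi := Real.pi_pos
    field_simp at h4
    linarith
  have hk1 : (k : ℝ) ≤ w.length := by exact_mod_cast hk
  have hk1' : (k' : ℝ) ≤ w.length := by exact_mod_cast hk'
  have hk0 : (0 : ℝ) ≤ k := Nat.cast_nonneg k
  have hk0' : (0 : ℝ) ≤ k' := Nat.cast_nonneg k'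
  have hn0 : n = 0 := by
    have h5 : (n : ℝ) < 1 := by
      by_contra! h
      nlinarith [hx.1, hx'.2]
    have h6 : (-1 : ℝ) < n := by
      by_contra! h
      nlinarith [hx.2, hx'.1]
    have h7 : n < 1 := by exact_mod_cast h5
    have h8 : -1 < n := by exact_mod_cast h6
    omega
  subst hn0
  have hkk : k' = k := by
    have h5 : (k' : ℝ) < k + 1 := by
      push_cast at h3
      linarith [hx'.1, hx.2]
    have h6 : (k : ℝ) < k' + 1 := by
      push_cast at h3
      linarith [hx'.2, hx.1]
    have h7 : k' < k + 1 := by exact_mod_cast h5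
    have h8 : k < k' + 1 := by exact_mod_cast h6
    omega
  subst hkk
  have hxx : x' = x := by
    push_cast at h3
    linarith
  subst hxx
  have := (w.position k').injective (letterMotion_injective _ _ h1)
  subst this
  exact Set.disjoint_left.1 hST hp hp'

/-- If the closure is a knot, then the permutation of the braid is a cycle. -/
theorem isCycleOn_of_isKnot (h : IsKnot w.closure) :
    (w.position w.length).IsCycleOn Set.univ := by
  obtain ⟨e⟩ := h
  have hconn : IsPreconnected w.closure := by
    have h := isPreconnected_range (continuous_subtype_val.comp e.symm.continuous)
    rwa [e.symm.surjective.range_comp, Subtype.range_coe] at h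
  refine ⟨Set.bijOn_univ.2 (w.position w.length).bijective, fun x _ y _ => ?_⟩
  by_contra hxy
  -- If the orbit of x missed y, the orbit and its complement would split the connected closure into
  -- two disjoint non-empty closed parts.
  set S : Set (Fin s) := {p | (w.position w.length).SameCycle x p} with hSdef
  have hS : ∀ p ∈ S, w.position w.length p ∈ S := fun p hp =>
    Equiv.Perm.sameCycle_apply_right.2 hp
  have hSc : ∀ p ∈ Sᶜ, w.position w.length p ∈ Sᶜ := fun p hp h =>
    hp (Equiv.Perm.sameCycle_apply_right.1 h)
  have hdisj := w.closurePart_disjoint disjoint_compl_right hS hSc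
  have hcover : w.closure ⊆ w.closurePart S ∪ w.closurePart Sᶜ := by
    rintro q ⟨k, p, t, hk, ht, rfl⟩
    have hq : w.closurePoint k ((w.position k)⁻¹ p) t =
        torusEmbedding (letterMotion w[k]? p t) (2 * Real.pi * (k + t) / (w.length + 1)) := by
      simp [closurePoint]
    by_cases hp : (w.position k)⁻¹ p ∈ S
    · exact Or.inl (w.mem_closurePart.2 ⟨k, hk, _, hp, t, ht, hq⟩)
    · exact Or.inr (w.mem_closurePart.2 ⟨k, hk, _, hp, t, ht, hq⟩)
  have hmem : ∀ p : Fin s, w.closurePoint 0 p 0 ∈ w.closure := fun p =>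
    ⟨0, w.position 0 p, 0, Nat.zero_le _, by simp, by simp [closurePoint]⟩
  have hpart : ∀ (T : Set (Fin s)) (p : Fin s), p ∈ T → w.closurePoint 0 p 0 ∈ w.closurePart T :=
    fun T p hp => w.mem_closurePart.2 ⟨0, Nat.zero_le _, p, hp, 0, by simp, rfl⟩
  have hx : x ∈ S := Equiv.Perm.SameCycle.refl _ _
  have hy : y ∈ Sᶜ := hxy
  rcases isPreconnected_iff_subset_of_disjoint_closed.1 hconn _ _ (w.isClosed_closurePart S)
    (w.isClosed_closurePart Sᶜ) hcover (by rw [hdisj, Set.inter_empty]) with h | h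
  · have : w.closurePoint 0 y 0 ∈ w.closurePart S ∩ w.closurePart Sᶜ :=
      ⟨h (hmem y), hpart _ y hy⟩
    rw [hdisj] at this
    exact this
  · have : w.closurePoint 0 x 0 ∈ w.closurePart S ∩ w.closurePart Sᶜ :=
      ⟨hpart _ x hx, h (hmem x)⟩
    rw [hdisj] at this
    exact this

end BraidWord

/-! ### Reading off a word from the crossings of real curves -/

section Crossings

variable {s : ℕ} {X : Fin s → ℝ → ℝ}

/-- Two of the curves meet at `t`. -/
def Meet (X : Fin s → ℝ → ℝ) (t : ℝ) : Prop := ∃ i j, i ≠ j ∧ X i t = X j t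

/-- `π` gives the positions of the curves at `t`. -/
def OrderedBy (X : Fin s → ℝ → ℝ) (π : Equiv.Perm (Fin s)) (t : ℝ) : Prop :=
  ∀ i j, π i < π j → X i t < X j t

/-- The curves meet transversely, in pairs and at different heights. -/
def GenericFamily (X : Fin s → ℝ → ℝ) : Prop :=
  ∀ (t : ℝ) (i j : Fin s), i ≠ j → X i t = X j t →
    deriv (X i) t ≠ deriv (X j) t ∧ ∀ i' j' : Fin s, i' ≠ j' → X i' t = X j' t → s(i', j') = s(i, j)

/-- The letter `l` is the position of the crossing at `t`. -/
def IsLetterAt (X : Fin s → ℝ → ℝ) (l : Fin (s - 1)) (t : ℝ) : Prop :=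
  ∃ i j, i ≠ j ∧ X i t = X j t ∧ (l : ℕ) = Nat.card {q : Fin s // X q t < X i t}

theorem OrderedBy.lt_iff {π : Equiv.Perm (Fin s)} {t : ℝ} (h : OrderedBy X π t) (i j : Fin s) :
    π i < π j ↔ X i t < X j t := by
  refine ⟨h i j, fun hij => ?_⟩
  by_contra hn
  rcases (not_lt.1 hn).lt_or_eq with h1 | h1
  · exact lt_asymm hij (h _ _ h1)
  · rw [π.injective h1] at hij
    exact lt_irrefl _ hij

theorem OrderedBy.not_meet {π : Equiv.Perm (Fin s)} {t : ℝ} (h : OrderedBy X π t) :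
    ¬ Meet X t := by
  rintro ⟨i, j, hij, he⟩
  rcases lt_or_gt_of_ne (π.injective.ne hij) with h1 | h1
  · exact (h _ _ h1).ne he
  · exact (h _ _ h1).ne he.symm

theorem card_lt_perm (π : Equiv.Perm (Fin s)) (i : Fin s) :
    Nat.card {q : Fin s // π q < π i} = π i := by
  rw [Nat.card_congr (π.subtypeEquiv (q := fun p => p < π i) fun a => Iff.rfl),
    Nat.card_eq_fintype_card, Fintype.card_subtype]
  have : (Finset.univ.filter fun p : Fin s => p < π i) = Finset.Iio (π i) := by
    ext
    simp
  rw [this, Fin.card_Iio]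

/-- The position of a curve is the number of curves to its left. -/
theorem OrderedBy.unique {π π' : Equiv.Perm (Fin s)} {t : ℝ} (h : OrderedBy X π t)
    (h' : OrderedBy X π' t) : π = π' := by
  ext i
  rw [← card_lt_perm π i, ← card_lt_perm π' i]
  simp only [h.lt_iff, h'.lt_iff]

theorem lt_of_forall_ne {f g : ℝ → ℝ} (hf : Continuous f) (hg : Continuous g) {a b : ℝ}
    (hab : a ≤ b) (h : ∀ t ∈ Set.Icc a b, f t ≠ g t) (ha : f a < g a) : f b < g b := by
  by_contra! hb
  obtain ⟨t, ht, h0⟩ := intermediate_value_Icc' hab ((hg.sub hf).continuousOn (s := Set.Icc a b))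
    (show (0 : ℝ) ∈ Set.Icc _ _ from ⟨by simpa using hb, by simpa using ha.le⟩)
  exact h t ht (sub_eq_zero.1 h0).symm

theorem OrderedBy.of_not_meet (hX : ∀ i, Continuous (X i)) {π : Equiv.Perm (Fin s)} {a b : ℝ}
    (hab : a ≤ b) (h : ∀ t ∈ Set.Icc a b, ¬ Meet X t) (ha : OrderedBy X π a) :
    OrderedBy X π b := fun i j hij =>
  lt_of_forall_ne (hX i) (hX j) hab
    (fun t ht he => h t ht ⟨i, j, fun hij' => (hij' ▸ hij).ne rfl, he⟩) (ha i j hij)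

theorem adjacentSwap_lt_iff (l : Fin (s - 1)) {p q : Fin s}
    (h : adjacentSwap l p < adjacentSwap l q) :
    p < q ∨ ((p : ℕ) = l + 1 ∧ (q : ℕ) = l) := by
  rw [Fin.lt_def, adjacentSwap_val, adjacentSwap_val] at h
  rw [Fin.lt_def]
  simp only [natSwap, Equiv.swap_apply_def] at h
  split_ifs at h <;> omega

theorem not_adjacentSwap_lt (l : Fin (s - 1)) {p q : Fin s}
    (h : adjacentSwap l p < adjacentSwap l q) : ¬ ((p : ℕ) = l ∧ (q : ℕ) = l + 1) := by
  rw [Fin.lt_def, adjacentSwap_val, adjacentSwap_val] at h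
  simp only [natSwap, Equiv.swap_apply_def] at h
  split_ifs at h <;> omega

/-- At an isolated transverse crossing the order is changed by an adjacent transposition. -/
theorem OrderedBy.cross (hX : ∀ i, Differentiable ℝ (X i)) (hg : GenericFamily X)
    {π : Equiv.Perm (Fin s)} {a t c : ℝ} (hat : a < t) (htc : t < c)
    (h : ∀ x ∈ Set.Icc a c, Meet X x → x = t) (ha : OrderedBy X π a) {l : Fin (s - 1)}
    (hl : IsLetterAt X l t) : OrderedBy X (adjacentSwap l * π) c := by
  obtain ⟨i, j, hij, he, hl⟩ : ∃ i j, π i < π j ∧ X i t = X j t ∧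
      (l : ℕ) = Nat.card {q : Fin s // X q t < X i t} := by
    obtain ⟨i, j, hij, he, hl⟩ := hl
    rcases lt_or_gt_of_ne (π.injective.ne hij) with h1 | h1
    · exact ⟨i, j, h1, he, hl⟩
    · exact ⟨j, i, h1, he.symm, he ▸ hl⟩
  have hij' : i ≠ j := fun h' => (h' ▸ hij).ne rfl
  have hXc : ∀ i, Continuous (X i) := fun i => (hX i).continuous
  obtain ⟨hd, hpair⟩ := hg t i j hij' he
  have hother : ∀ x ∈ Set.Icc a c, ∀ q r, q ≠ r → s(q, r) ≠ s(i, j) → X q x ≠ X r x := by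
    intro x hx q r hqr hne heq
    obtain rfl := h x hx ⟨q, r, hqr, heq⟩
    exact hne (hpair q r hqr heq)
  have hothert : ∀ q r, q ≠ r → s(q, r) ≠ s(i, j) → (X q a < X r a → X q t < X r t) :=
    fun q r hqr hne => lt_of_forall_ne (hXc q) (hXc r) hat.le
      fun x hx => hother x ⟨hx.1, hx.2.trans htc.le⟩ q r hqr hne
  have hotherc : ∀ q r, q ≠ r → s(q, r) ≠ s(i, j) → (X q a < X r a → X q c < X r c) :=
    fun q r hqr hne => lt_of_forall_ne (hXc q) (hXc r) (hat.trans htc).le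
      fun x hx => hother x hx q r hqr hne
  have hsym : ∀ q r : Fin s, q ≠ i → q ≠ j → s(q, r) ≠ s(i, j) := by
    intro q r h1 h2 h3
    rcases Sym2.eq_iff.1 h3 with ⟨h4, -⟩ | ⟨h4, -⟩
    · exact h1 h4
    · exact h2 h4
  have hsym' : ∀ q r : Fin s, q ≠ i → q ≠ j → s(r, q) ≠ s(i, j) := by
    intro q r h1 h2
    rw [Sym2.eq_swap]
    exact hsym q r h1 h2
  -- Only i and j meet in [a, c], so the strands to the left of the crossing are those to the left
  -- of i at a.
  have hli : (l : ℕ) = π i := by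
    rw [hl, ← card_lt_perm π i]
    refine Nat.card_congr (Equiv.subtypeEquivRight fun q => ?_)
    rw [ha.lt_iff]
    by_cases hqi : q = i
    · simp [hqi]
    by_cases hqj : q = j
    · subst hqj
      simp only [he, lt_irrefl, false_iff]
      exact (ha i q hij).not_gt
    · refine ⟨fun h1 => ?_, hothert q i hqi (hsym q i hqi hqj)⟩
      by_contra h2
      have h3 : X i a < X q a := by
        refine lt_of_le_of_ne (not_lt.1 h2) ?_
        exact (hother a ⟨le_rfl, (hat.trans htc).le⟩ q i hqi (hsym q i hqi hqj)).symm
      exact lt_asymm h1 (hothert i q (Ne.symm hqi) (hsym' q i hqi hqj) h3)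
  -- A strand between i and j at a would lie strictly between two equal values at t.
  have hlj : (π j : ℕ) = l + 1 := by
    by_contra hne
    have hlt : (π i : ℕ) + 1 < π j := by
      have := Fin.lt_def.1 hij
      omega
    obtain ⟨r, hr⟩ := π.surjective ⟨(π i : ℕ) + 1, by omega⟩
    have hir : π i < π r := by
      rw [hr, Fin.lt_def]
      simp
    have hrj : π r < π j := by
      rw [hr, Fin.lt_def]
      exact hlt
    have hri : r ≠ i := fun h' => (h' ▸ hir).ne rfl
    have hrj' : r ≠ j := fun h' => (h' ▸ hrj).ne rfl
    have h1 := hothert i r hri.symm (hsym' r i hri hrj') (ha _ _ hir)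
    have h2 := hothert r j hrj' (hsym r j hri hrj') (ha _ _ hrj)
    rw [he] at h1
    exact lt_asymm h1 h2
  -- The difference is positive before t and vanishes at t with non-zero derivative, so it becomes
  -- negative.
  have hflip : X j c < X i c := by
    set f : ℝ → ℝ := fun x => X j x - X i x with hf
    have hf0 : f t = 0 := by simp [hf, he]
    have hfd : deriv f t = deriv (X j) t - deriv (X i) t :=
      deriv_fun_sub (hX j t) (hX i t)
    have hfne : deriv f t ≠ 0 := by
      rw [hfd]
      exact sub_ne_zero.2 hd.symm
    rcases lt_or_gt_of_ne hfne with hneg | hpos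
    · have hev := eventually_nhdsWithin_sign_eq_of_deriv_neg hneg hf0
      have hev' := (hev.filter_mono (nhdsWithin_le_nhds (s := Set.Ioi t))).and
        (Ioo_mem_nhdsGT htc)
      obtain ⟨x, hx1, hx2⟩ := hev'.exists
      have hxneg : f x < 0 := by
        rw [sign_neg (by linarith [hx2.1] : t - x < 0)] at hx1
        exact sign_eq_neg_one_iff.1 hx1
      refine lt_of_forall_ne (hXc j) (hXc i) hx2.2.le ?_ (by simpa [hf] using hxneg)
      intro y hy heq
      have := h y ⟨by linarith [hx2.1, hy.1], hy.2⟩ ⟨j, i, hij'.symm, heq⟩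
      linarith [hx2.1, hy.1]
    · exfalso
      have hev := eventually_nhdsWithin_sign_eq_of_deriv_pos hpos hf0
      have hev' := (hev.filter_mono (nhdsWithin_le_nhds (s := Set.Iio t))).and
        (Ioo_mem_nhdsLT hat)
      obtain ⟨x, hx1, hx2⟩ := hev'.exists
      have hxneg : f x < 0 := by
        rw [sign_neg (by linarith [hx2.2] : x - t < 0)] at hx1
        exact sign_eq_neg_one_iff.1 hx1
      have : X i x < X j x := by
        refine lt_of_forall_ne (hXc i) (hXc j) hx2.1.le ?_ (ha i j hij)
        intro y hy heq
        have := h y ⟨hy.1, by linarith [hx2.2, hy.2]⟩ ⟨i, j, hij', heq⟩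
        linarith [hx2.2, hy.2]
      simp only [hf] at hxneg
      linarith
  intro q r hqr
  rw [Equiv.Perm.mul_apply, Equiv.Perm.mul_apply] at hqr
  have hnot := not_adjacentSwap_lt l hqr
  rcases adjacentSwap_lt_iff l hqr with h1 | ⟨h1, h2⟩
  · refine hotherc q r (fun h' => (h' ▸ h1).ne rfl) ?_ (ha q r h1)
    intro h3
    rcases Sym2.eq_iff.1 h3 with ⟨rfl, rfl⟩ | ⟨rfl, rfl⟩
    · exact hnot ⟨hli.symm, hlj⟩
    · exact lt_asymm hij h1
  · have hqj : q = j := π.injective (Fin.ext (by omega))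
    have hri : r = i := π.injective (Fin.ext (by omega))
    rw [hqj, hri]
    exact hflip

/-- Later crossings act on the left of the positions, hence the reversed list. -/
theorem OrderedBy.cross_list (hX : ∀ i, Differentiable ℝ (X i)) (hg : GenericFamily X)
    (lt : ℝ → Fin (s - 1)) (hlt : ∀ t, Meet X t → IsLetterAt X (lt t) t) (T : List ℝ)
    (hT : T.Pairwise (· < ·)) {a b : ℝ} (hab : a < b)
    (hmem : ∀ t, t ∈ T ↔ (a < t ∧ t < b) ∧ Meet X t) {π : Equiv.Perm (Fin s)}
    (ha : OrderedBy X π a) (hb : ¬ Meet X b) :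
    OrderedBy X (((T.map lt).reverse.map adjacentSwap).prod * π) b := by
  induction T generalizing a π with
  | nil =>
    simp only [List.map_nil, List.reverse_nil, List.prod_nil, one_mul]
    refine ha.of_not_meet (fun i => (hX i).continuous) hab.le fun t ht hm => ?_
    rcases ht.1.lt_or_eq with h1 | rfl
    · rcases ht.2.lt_or_eq with h2 | rfl
      · simpa using (hmem t).2 ⟨⟨h1, h2⟩, hm⟩
      · exact hb hm
    · exact ha.not_meet hm
  | cons t T ih =>
    obtain ⟨⟨hat, htb⟩, hmt⟩ := (hmem t).1 (by simp)
    obtain ⟨htT, hT'⟩ := List.pairwise_cons.1 hT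
    obtain ⟨c, htc, hcb, hcT⟩ : ∃ c, t < c ∧ c < b ∧ ∀ x ∈ T, c < x := by
      have h1 : ∀ᶠ c in nhdsWithin t (Set.Ioi t), ∀ x ∈ T.toFinset, c < x := by
        rw [Filter.eventually_all_finset]
        intro x hx
        filter_upwards [Ioo_mem_nhdsGT (htT x (List.mem_toFinset.1 hx))] with c hc using hc.2
      obtain ⟨c, hc1, hc2⟩ := (h1.and (Ioo_mem_nhdsGT htb)).exists
      exact ⟨c, hc2.1, hc2.2, fun x hx => hc1 x (List.mem_toFinset.2 hx)⟩
    have hac : ∀ x ∈ Set.Icc a c, Meet X x → x = t := by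
      intro x hx hm
      have hax : a < x := by
        refine lt_of_le_of_ne hx.1 fun h => ?_
        subst h
        exact ha.not_meet hm
      rcases List.mem_cons.1 ((hmem x).2 ⟨⟨hax, by linarith [hx.2]⟩, hm⟩) with h | h
      · exact h
      · have := hcT x h
        linarith [hx.2]
    have hc := ha.cross hX hg hat htc hac (hlt t hmt)
    have := ih hT' hcb (fun x => ?_) hc
    · rw [List.map_cons, List.reverse_cons, List.map_append, List.prod_append]
      simpa [mul_assoc] using this
    · constructor
      · intro hx
        obtain ⟨⟨_, h2⟩, h3⟩ := (hmem x).1 (by simp [hx])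
        exact ⟨⟨hcT x hx, h2⟩, h3⟩
      · rintro ⟨⟨h1, h2⟩, h3⟩
        rcases List.mem_cons.1 ((hmem x).2 ⟨⟨by linarith, h2⟩, h3⟩) with h | h
        · linarith
        · exact h

theorem filter_append_filter_of_pairwise (T : List ℝ) (hT : T.Pairwise (· < ·)) (c : ℝ) :
    T = T.filter (· < c) ++ T.filter (c ≤ ·) := by
  induction T with
  | nil => rfl
  | cons a T ih =>
    obtain ⟨h1, h2⟩ := List.pairwise_cons.1 hT
    by_cases hac : a < c
    · rw [List.filter_cons_of_pos (by simpa using hac),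
        List.filter_cons_of_neg (by simpa using hac), List.cons_append, ← ih h2]
    · have h3 : ∀ x ∈ a :: T, c ≤ x := by
        intro x hx
        rcases List.mem_cons.1 hx with rfl | hx
        · exact not_lt.1 hac
        · exact (not_lt.1 hac).trans (h1 x hx).le
      rw [List.filter_eq_nil_iff.2 fun x hx => by simpa using h3 x hx,
        List.filter_eq_self.2 fun x hx => by simpa using h3 x hx, List.nil_append]

/-- If the curves are ordered at the heights `node k` as by a braid word, then there are signs for
which their crossings give the same braid. -/
theorem exists_signed_word (hX : ∀ i, Differentiable ℝ (X i)) (hg : GenericFamily X)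
    (lt : ℝ → Fin (s - 1)) (hlt : ∀ t, Meet X t → IsLetterAt X (lt t) t) (w : BraidWord s)
    (node : ℕ → ℝ) (hnode : ∀ k < w.length, node k < node (k + 1)) (π₀ : Equiv.Perm (Fin s))
    (hord : ∀ k ≤ w.length, OrderedBy X (w.position k * π₀) (node k)) (k : ℕ) (hk : k ≤ w.length)
    (T : List ℝ) (hT : T.Pairwise (· < ·))
    (hmem : ∀ t, t ∈ T ↔ (node 0 < t ∧ t < node k) ∧ Meet X t) :
    ∃ v : BraidWord s, v.map Prod.fst = T.map lt ∧
      v.toBraid = BraidWord.toBraid (w.take k : BraidWord s) := by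
  induction k generalizing T with
  | zero =>
    have : T = [] := by
      refine List.eq_nil_iff_forall_not_mem.2 fun t ht => ?_
      obtain ⟨⟨h1, h2⟩, -⟩ := (hmem t).1 ht
      linarith
    subst this
    exact ⟨[], rfl, rfl⟩
  | succ k ih =>
    have hk' : k < w.length := hk
    have h0k : node 0 ≤ node k := by
      clear hmem ih
      induction k with
      | zero => rfl
      | succ k ihk => exact (ihk (by omega) (by omega)).trans (hnode k (by omega)).le
    have hkk := hnode k hk'
    have hsplit := filter_append_filter_of_pairwise T hT (node k)
    obtain ⟨v, hv1, hv2⟩ := ih hk'.le (T.filter (· < node k)) (hT.filter _) (fun t => by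
      simp only [List.mem_filter, hmem, decide_eq_true_eq]
      constructor
      · rintro ⟨⟨⟨h1, h2⟩, h3⟩, h4⟩
        exact ⟨⟨h1, h4⟩, h3⟩
      · rintro ⟨⟨h1, h2⟩, h3⟩
        exact ⟨⟨⟨h1, h2.trans hkk⟩, h3⟩, h2⟩)
    have hcross := (hord k hk'.le).cross_list hX hg lt hlt (T.filter (node k ≤ ·)) (hT.filter _)
      hkk (fun t => by
        simp only [List.mem_filter, hmem, decide_eq_true_eq]
        constructor
        · rintro ⟨⟨⟨h1, h2⟩, h3⟩, h4⟩
          refine ⟨⟨h4.lt_of_ne ?_, h2⟩, h3⟩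
          rintro rfl
          exact (hord k hk'.le).not_meet h3
        · rintro ⟨⟨h1, h2⟩, h3⟩
          exact ⟨⟨⟨h0k.trans_lt h1, h2⟩, h3⟩, h1.le⟩) (hord (k + 1) hk).not_meet
    -- The crossings between the two heights and the k-th letter effect the same permutation.
    have heq := hcross.unique (hord (k + 1) hk)
    rw [w.position_succ hk', ← mul_assoc] at heq
    have heq' := mul_right_cancel (mul_right_cancel heq)
    obtain ⟨v', hv1', hv2'⟩ := exists_signs _ _ w[k].2 heq'
    refine ⟨v ++ v', ?_, ?_⟩
    · conv_rhs => rw [hsplit]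
      rw [List.map_append, List.map_append, hv1, hv1']
    · have hva : BraidWord.toBraid (v ++ v') = BraidWord.toBraid v * BraidWord.toBraid v' := by
        simp [BraidWord.toBraid]
      rw [hva, hv2, hv2', List.take_add_one, List.getElem?_eq_getElem hk', Option.toList_some]
      simp only [BraidWord.toBraid]
      rw [List.map_append, List.prod_append, List.map_singleton, List.prod_singleton]

end Crossings

/-! ### Generic perturbations -/

/-- A countable union of C¹ curves has Hausdorff dimension at most 1 < 2, so its complement in the
plane is dense. -/
theorem exists_small_notMem_range (C : Set (ℝ → ℝ × ℝ)) (hC : C.Countable)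
    (h : ∀ γ ∈ C, ContDiff ℝ 1 γ) {δ : ℝ} (hδ : 0 < δ) :
    ∃ a b : ℝ, |a| < δ ∧ |b| < δ ∧ ∀ γ ∈ C, (a, b) ∉ Set.range γ := by
  have hdim : dimH (⋃ γ ∈ C, Set.range γ) ≤ 1 := by
    rw [dimH_bUnion hC]
    refine iSup₂_le fun γ hγ => ?_
    simpa using (h γ hγ).dimH_range_le
  have hdense : Dense (⋃ γ ∈ C, Set.range γ)ᶜ := by
    apply dense_compl_of_dimH_lt_finrank
    refine hdim.trans_lt ?_
    simp
  obtain ⟨⟨a, b⟩, hx, hab⟩ := hdense.exists_dist_lt (0 : ℝ × ℝ) hδ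
  rw [dist_comm, dist_zero_right, Prod.norm_mk, max_lt_iff] at hab
  refine ⟨a, b, hab.1, hab.2, fun γ hγ hr => hx ?_⟩
  exact Set.mem_biUnion hγ hr

section Perturbation

variable {s : ℕ} (F : ℝ → ℝ)

/-- The midpoint of the angles at which two strands are evaluated. -/
noncomputable def midAngle (i j : Fin s) (t : ℝ) : ℝ :=
  (t + Real.pi * ((i : ℕ) + (j : ℕ))) / s

/-- Twice the sine of half the difference of the angles of two strands. -/
noncomputable def chord (i j : Fin s) : ℝ := 2 * Real.sin (Real.pi * ((j : ℕ) - (i : ℕ)) / s)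

/-- The value of `a sin φ - b cos φ` for which the perturbed strands meet. -/
noncomputable def meetLevel (i j : Fin s) (t : ℝ) : ℝ :=
  -(strand F i t - strand F j t) / chord i j

theorem chord_ne_zero {i j : Fin s} (hij : i ≠ j) : chord i j ≠ 0 := by
  have hs : (0 : ℝ) < s := by exact_mod_cast i.pos
  have hi : ((i : ℕ) : ℝ) < s := by exact_mod_cast i.2
  have hj : ((j : ℕ) : ℝ) < s := by exact_mod_cast j.2
  have hi0 : (0 : ℝ) ≤ (i : ℕ) := Nat.cast_nonneg _
  have hj0 : (0 : ℝ) ≤ (j : ℕ) := Nat.cast_nonneg _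
  have hpi := Real.pi_pos
  refine mul_ne_zero two_ne_zero fun h => hij ?_
  rw [Real.sin_eq_zero_iff_of_lt_of_lt] at h
  · rw [div_eq_zero_iff, mul_eq_zero] at h
    have : ((j : ℕ) : ℝ) = (i : ℕ) := by
      rcases h with (h | h) | h
      · exact absurd h hpi.ne'
      · linarith
      · exact absurd h hs.ne'
    exact Fin.ext (by exact_mod_cast this.symm)
  · rw [lt_div_iff₀ hs]
    nlinarith
  · rw [div_lt_iff₀ hs]
    nlinarith

/-- By the sum-to-product formulas, meeting at a given height is one linear equation for (a, b),
with unit normal (sin φ, -cos φ). -/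
theorem strand_perturbed_sub {i j : Fin s} (hij : i ≠ j) (a b t : ℝ) :
    strand (fun t => F t + (0 + a * Real.cos t + b * Real.sin t)) i t -
      strand (fun t => F t + (0 + a * Real.cos t + b * Real.sin t)) j t =
    chord i j * (a * Real.sin (midAngle i j t) - b * Real.cos (midAngle i j t) -
      meetLevel F i j t) := by
  have hs : (s : ℝ) ≠ 0 := by exact_mod_cast i.pos.ne'
  have hc := chord_ne_zero hij
  have h1 : chord i j * meetLevel F i j t = -(strand F i t - strand F j t) := by
    rw [meetLevel]
    field_simp
  have hi : (t + 2 * Real.pi * (i : ℕ)) / s =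
      midAngle i j t - Real.pi * ((j : ℕ) - (i : ℕ)) / s := by
    rw [midAngle]
    field_simp
    ring
  have hj : (t + 2 * Real.pi * (j : ℕ)) / s =
      midAngle i j t + Real.pi * ((j : ℕ) - (i : ℕ)) / s := by
    rw [midAngle]
    field_simp
    ring
  rw [mul_sub, h1]
  simp only [strand]
  rw [hi, hj, Real.cos_sub, Real.cos_add, Real.sin_sub, Real.sin_add, chord]
  ring

theorem contDiff_of_isTrigPoly {d : ℕ} {F : ℝ → ℝ} (hF : IsTrigPoly d (fun t => (F t : ℂ))) :
    ContDiff ℝ 2 F := by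
  have h : ContDiff ℝ 2 (fun t => ((F t : ℂ)).re) :=
    Complex.reCLM.contDiff.comp (hF.contDiff.of_le le_top)
  simpa using h

theorem contDiff_strand {F : ℝ → ℝ} (hF : ContDiff ℝ 2 F) (i : Fin s) :
    ContDiff ℝ 2 (strand F i) :=
  hF.comp ((contDiff_id.add contDiff_const).div_const _)

theorem contDiff_midAngle {n : WithTop ℕ∞} (i j : Fin s) : ContDiff ℝ n (midAngle i j) :=
  (contDiff_id.add contDiff_const).div_const _

theorem contDiff_meetLevel {F : ℝ → ℝ} (hF : ContDiff ℝ 2 F) (i j : Fin s) :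
    ContDiff ℝ 2 (meetLevel F i j) :=
  ((contDiff_strand hF i).sub (contDiff_strand hF j)).neg.div_const _

theorem hasDerivAt_midAngle (i j : Fin s) (t : ℝ) : HasDerivAt (midAngle i j) (1 / s) t :=
  ((hasDerivAt_id' t).add_const _).div_const _

/-- The parameters for which two given strands have a common tangent lie on a curve. -/
theorem exists_curve_of_tangency {F : ℝ → ℝ} (hF : ContDiff ℝ 2 F) {i j : Fin s} (hij : i ≠ j) :
    ∃ γ : ℝ → ℝ × ℝ, ContDiff ℝ 1 γ ∧ ∀ a b t : ℝ,
      strand (fun t => F t + (0 + a * Real.cos t + b * Real.sin t)) i t =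
        strand (fun t => F t + (0 + a * Real.cos t + b * Real.sin t)) j t →
      deriv (strand (fun t => F t + (0 + a * Real.cos t + b * Real.sin t)) i) t =
        deriv (strand (fun t => F t + (0 + a * Real.cos t + b * Real.sin t)) j) t →
      (a, b) ∈ Set.range γ := by
  have hs : (s : ℝ) ≠ 0 := by exact_mod_cast i.pos.ne'
  set φ := midAngle i j with hφ
  set p := meetLevel F i j with hp
  have hpc : ContDiff ℝ 2 p := contDiff_meetLevel hF i j
  have hpd : ContDiff ℝ 1 (deriv p) := hpc.deriv'
  have hp1 : ContDiff ℝ 1 p := hpc.of_le (by norm_num)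
  have hφc : ContDiff ℝ 1 φ := contDiff_midAngle i j
  -- Meeting and tangency read a sin φ - b cos φ = p and, since φ' = 1/s, a cos φ + b sin φ = s p'.
  -- Rotation by φ solves this system.
  refine ⟨fun t => (p t * Real.sin (φ t) + s * deriv p t * Real.cos (φ t),
    -(p t * Real.cos (φ t)) + s * deriv p t * Real.sin (φ t)), ?_, fun a b t h hd => ?_⟩
  · fun_prop
  have hc := chord_ne_zero hij
  set Y := fun i : Fin s => strand (fun t => F t + (0 + a * Real.cos t + b * Real.sin t)) i with hY
  have hYd : ∀ i, Differentiable ℝ (Y i) := by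
    intro i
    refine (contDiff_strand (F := fun t => F t + (0 + a * Real.cos t + b * Real.sin t)) ?_
      i).differentiable (by norm_num)
    fun_prop
  have hdiff : ∀ t, Y i t - Y j t =
      chord i j * (a * Real.sin (φ t) - b * Real.cos (φ t) - p t) :=
    fun t => strand_perturbed_sub F hij a b t
  have h1 : a * Real.sin (φ t) - b * Real.cos (φ t) = p t := by
    have := hdiff t
    rw [sub_eq_zero.2 h] at this
    rcases mul_eq_zero.1 this.symm with h' | h'
    · exact absurd h' hc
    · linarith
  have hφd := hasDerivAt_midAngle i j t
  have hpd' : HasDerivAt p (deriv p t) t := (hp1.differentiable (by norm_num) t).hasDerivAt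
  have hder := ((((hφd.sin.const_mul a).sub (hφd.cos.const_mul b)).sub hpd').const_mul (chord i j))
  have hder' : HasDerivAt (fun t => Y i t - Y j t) (deriv (Y i) t - deriv (Y j) t) t :=
    (hYd i t).hasDerivAt.sub (hYd j t).hasDerivAt
  have huniq := hder'.unique (hder.congr_of_eventuallyEq (Filter.Eventually.of_forall hdiff))
  have h2 : a * Real.cos (φ t) + b * Real.sin (φ t) = s * deriv p t := by
    rw [sub_eq_zero.2 hd] at huniq
    rcases mul_eq_zero.1 huniq.symm with h' | h'
    · exact absurd h' hc
    · rw [← hφ] at h'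
      field_simp at h'
      linarith
  refine ⟨t, ?_⟩
  have hsc := Real.sin_sq_add_cos_sq (φ t)
  refine Prod.ext ?_ ?_
  · simp only
    rw [← h1, ← h2]
    linear_combination a * hsc
  · simp only
    rw [← h1, ← h2]
    linear_combination b * hsc

/-- The parameters for which two given pairs of strands meet at the same height lie on countably
many curves, unless the differences of the strands in these pairs are proportional. -/
theorem exists_curves_of_coincidence {d : ℕ} {F : ℝ → ℝ}
    (hFt : IsTrigPoly d (fun t => (F t : ℂ))) {i j i' j' : Fin s} (hij : i ≠ j) (hij' : i' ≠ j')
    (hprop : ∀ c : ℝ, c ≠ 0 →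
      ∃ t, strand F i' t - strand F j' t ≠ c * (strand F i t - strand F j t)) :
    ∃ C : Set (ℝ → ℝ × ℝ), C.Countable ∧ (∀ γ ∈ C, ContDiff ℝ 1 γ) ∧ ∀ a b t : ℝ,
      strand (fun t => F t + (0 + a * Real.cos t + b * Real.sin t)) i t =
        strand (fun t => F t + (0 + a * Real.cos t + b * Real.sin t)) j t →
      strand (fun t => F t + (0 + a * Real.cos t + b * Real.sin t)) i' t =
        strand (fun t => F t + (0 + a * Real.cos t + b * Real.sin t)) j' t →
      ∃ γ ∈ C, (a, b) ∈ Set.range γ := by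
  have hs : (s : ℝ) ≠ 0 := by exact_mod_cast i.pos.ne'
  have hF := contDiff_of_isTrigPoly hFt
  set φ := midAngle i j with hφ
  set p := meetLevel F i j with hp
  set φ' := midAngle i' j' with hφ'
  set p' := meetLevel F i' j' with hp'
  have hpc : ContDiff ℝ 1 p := (contDiff_meetLevel hF i j).of_le (by norm_num)
  have hpc' : ContDiff ℝ 1 p' := (contDiff_meetLevel hF i' j').of_le (by norm_num)
  have hφc : ContDiff ℝ 1 φ := contDiff_midAngle i j
  have hφc' : ContDiff ℝ 1 φ' := contDiff_midAngle i' j'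
  have hlevel : ∀ {i j : Fin s} (_ : i ≠ j) {a b t : ℝ},
      strand (fun t => F t + (0 + a * Real.cos t + b * Real.sin t)) i t =
        strand (fun t => F t + (0 + a * Real.cos t + b * Real.sin t)) j t →
      a * Real.sin (midAngle i j t) - b * Real.cos (midAngle i j t) = meetLevel F i j t := by
    intro i j hij a b t h
    have := strand_perturbed_sub F hij a b t
    rw [sub_eq_zero.2 h] at this
    rcases mul_eq_zero.1 this.symm with h' | h'
    · exact absurd h' (chord_ne_zero hij)
    · linarith
  set α : ℝ := Real.pi * (((i' : ℕ) + (j' : ℕ)) - ((i : ℕ) + (j : ℕ))) / s with hα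
  have hφα : ∀ t, φ' t = φ t + α := by
    intro t
    simp only [hφ, hφ', midAngle, hα]
    field_simp
    ring
  -- For fixed t the two meeting conditions are lines in the (a, b)-plane at angle α. If they are
  -- parallel they must coincide, which happens only for the zeros t of a trigonometric polynomial.
  by_cases hσ : Real.sin α = 0
  · set κ := Real.cos α with hκ
    have hκ2 : κ ^ 2 = 1 := by
      have := Real.sin_sq_add_cos_sq α
      rw [hσ] at this
      linarith
    have hκ0 : κ ≠ 0 := by
      rintro h
      rw [h] at hκ2
      norm_num at hκ2
    have hcount : {t | p' t - κ * p t = 0}.Countable := by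
      have htrig : IsTrigPoly d (fun x => ((p' (s * x) - κ * p (s * x) : ℝ) : ℂ)) := by
        have hst : ∀ i : Fin s, IsTrigPoly d (fun x => ((strand F i (s * x) : ℝ) : ℂ)) := by
          intro i
          refine (hFt.comp_add (2 * Real.pi * (i : ℕ) / s)).congr fun x => ?_
          rw [strand_eq, mul_div_cancel_left₀ _ hs]
        have hpt : ∀ i j : Fin s, IsTrigPoly d (fun x => ((meetLevel F i j (s * x) : ℝ) : ℂ)) := by
          intro i j
          refine (((hst i).sub (hst j)).const_mul (-(chord i j : ℂ)⁻¹)).congr fun x => ?_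
          simp only [meetLevel]
          push_cast
          ring
        refine ((hpt i' j').sub ((hpt i j).const_mul (κ : ℂ))).congr fun x => ?_
        push_cast
        rfl
      have hne : ∃ x, ((p' (s * x) - κ * p (s * x) : ℝ) : ℂ) ≠ 0 := by
        have hc := chord_ne_zero hij
        have hc' := chord_ne_zero hij'
        obtain ⟨t, ht⟩ := hprop (κ * chord i' j' / chord i j)
          (div_ne_zero (mul_ne_zero hκ0 hc') hc)
        refine ⟨t / s, ?_⟩
        rw [mul_div_cancel₀ _ hs]
        intro h0
        apply ht
        have h0' : p' t - κ * p t = 0 := by exact_mod_cast h0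
        simp only [hp, hp', meetLevel] at h0'
        field_simp at h0' ⊢
        linarith
      refine ((htrig.countable_zeros hne).image (fun x => s * x)).mono fun t ht => ?_
      refine ⟨t / s, ?_, mul_div_cancel₀ _ hs⟩
      have ht' : p' t - κ * p t = 0 := ht
      rw [Set.mem_ofPred_eq, mul_div_cancel₀ _ hs, ht']
      simp
    -- Each exceptional height contributes a whole line of parameters.
    refine ⟨(fun t x => (p t * Real.sin (φ t) + x * Real.cos (φ t),
      -(p t * Real.cos (φ t)) + x * Real.sin (φ t))) '' {t | p' t - κ * p t = 0},
      hcount.image _, ?_, ?_⟩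
    · rintro _ ⟨t, -, rfl⟩
      fun_prop
    · intro a b t h h'
      have h1 : a * Real.sin (φ t) - b * Real.cos (φ t) = p t := hlevel hij h
      have h2 : a * Real.sin (φ' t) - b * Real.cos (φ' t) = p' t := hlevel hij' h'
      rw [hφα, Real.sin_add, Real.cos_add, hσ] at h2
      refine ⟨_, ⟨t, ?_, rfl⟩, a * Real.cos (φ t) + b * Real.sin (φ t), ?_⟩
      · show p' t - κ * p t = 0
        rw [← h2, ← h1]
        ring
      · have hsc := Real.sin_sq_add_cos_sq (φ t)
        refine Prod.ext ?_ ?_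
        · simp only
          rw [← h1]
          linear_combination a * hsc
        · simp only
          rw [← h1]
          linear_combination b * hsc
  -- The lines are transverse; their intersection, by Cramer's rule, traces a curve in t.
  · refine ⟨{fun t => (-(p t * Real.cos (φ' t) - p' t * Real.cos (φ t)) / Real.sin α,
      -(p t * Real.sin (φ' t) - p' t * Real.sin (φ t)) / Real.sin α)},
      Set.countable_singleton _, ?_, ?_⟩
    · rintro _ rfl
      fun_prop
    · intro a b t h h'
      have h1 : a * Real.sin (φ t) - b * Real.cos (φ t) = p t := hlevel hij h
      have h2 : a * Real.sin (φ' t) - b * Real.cos (φ' t) = p' t := hlevel hij' h'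
      have h3 : Real.sin α =
          Real.sin (φ' t) * Real.cos (φ t) - Real.cos (φ' t) * Real.sin (φ t) := by
        rw [← Real.sin_sub, hφα]
        congr 1
        ring
      refine ⟨_, rfl, t, ?_⟩
      refine Prod.ext ?_ ?_
      · simp only
        rw [div_eq_iff hσ, ← h1, ← h2, h3]
        ring
      · simp only
        rw [div_eq_iff hσ, ← h1, ← h2, h3]
        ring

/-- An arbitrarily small term of degree one makes the strands generic. -/
theorem exists_isGeneric {d : ℕ} {F : ℝ → ℝ} (hF : IsTrigPoly d (fun t => (F t : ℂ)))
    (hprop : ∀ i j i' j' : Fin s, i ≠ j → i' ≠ j' → s(i', j') ≠ s(i, j) → ∀ c : ℝ, c ≠ 0 →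
      ∃ t, strand F i' t - strand F j' t ≠ c * (strand F i t - strand F j t))
    {δ : ℝ} (hδ : 0 < δ) : ∃ a b : ℝ, |a| < δ ∧ |b| < δ ∧
      IsGeneric s (fun t => F t + (0 + a * Real.cos t + b * Real.sin t)) := by
  classical
  have h1 : ∀ x : {x : Fin s × Fin s // x.1 ≠ x.2}, _ := fun x =>
    exists_curve_of_tangency (contDiff_of_isTrigPoly hF) x.2
  choose γ hγc hγ using h1
  have h2 : ∀ x : {x : (Fin s × Fin s) × (Fin s × Fin s) // x.1.1 ≠ x.1.2 ∧ x.2.1 ≠ x.2.2 ∧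
      s(x.2.1, x.2.2) ≠ s(x.1.1, x.1.2)}, _ := fun x =>
    exists_curves_of_coincidence hF x.2.1 x.2.2.1
      (hprop _ _ _ _ x.2.1 x.2.2.1 x.2.2.2)
  choose C hCc hCd hC using h2
  obtain ⟨a, b, ha, hb, hab⟩ := exists_small_notMem_range (Set.range γ ∪ ⋃ x, C x)
    ((Set.countable_range γ).union (Set.countable_iUnion hCc)) (by
      rintro _ (⟨x, rfl⟩ | hx)
      · exact hγc x
      · obtain ⟨x, hx⟩ := Set.mem_iUnion.1 hx
        exact hCd x _ hx) hδ
  refine ⟨a, b, ha, hb, fun t i j hij h => ⟨fun hd => ?_, fun i' j' hij' h' => ?_⟩⟩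
  · exact hab _ (Or.inl ⟨⟨(i, j), hij⟩, rfl⟩) (hγ ⟨(i, j), hij⟩ a b t h hd)
  · by_contra hne
    obtain ⟨γ', hγ', hr⟩ := hC ⟨((i, j), (i', j')), hij, hij', hne⟩ a b t h h'
    exact hab γ' (Or.inr (Set.mem_iUnion.2 ⟨_, hγ'⟩)) hr

/-- If the strands are ordered at the heights `node k` as by a braid word, then the differences
of two different pairs of strands are not proportional. -/
theorem exists_sub_ne_mul_sub (hF : Function.Periodic F (2 * Real.pi)) (w : BraidWord s)
    (node : ℕ → ℝ) (h0 : node 0 = 0) (hl : node w.length = 2 * Real.pi)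
    (π₀ : Equiv.Perm (Fin s))
    (hord : ∀ k ≤ w.length, OrderedBy (strand F) (w.position k * π₀) (node k))
    {i j i' j' : Fin s} (hij : i ≠ j) (hne : s(i', j') ≠ s(i, j)) {c : ℝ}
    (hc : c ≠ 0) : ∃ t, strand F i' t - strand F j' t ≠ c * (strand F i t - strand F j t) := by
  have hs : 0 < s := i.pos
  by_contra! hprop
  set succ : Fin s → Fin s := fun j => ⟨((j : ℕ) + 1) % s, Nat.mod_lt _ hs⟩ with hsucc
  have hsuccinj : Function.Injective succ := succ_mod_injective hs
  have hstrand : ∀ j t, strand F j (t + 2 * Real.pi) = strand F (succ j) t := fun j t =>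
    strand_two_pi hs hF j t
  -- One letter exchanges just one pair, but proportional differences would have to change sign
  -- together. So the order of i and j is the same at all heights, and at 2π they continue as their
  -- successors.
  have hpers : ∀ (i j i' j' : Fin s), i ≠ j → s(i', j') ≠ s(i, j) →
      (∀ t, strand F i' t - strand F j' t = c * (strand F i t - strand F j t)) →
      strand F i 0 < strand F j 0 → strand F (succ i) 0 < strand F (succ j) 0 := by
    intro i j i' j' hij hne hprop hlt
    have hk : ∀ k ≤ w.length, strand F i (node k) < strand F j (node k) := by
      intro k
      induction k with
      | zero => intro _; rwa [h0]
      | succ k ih =>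
        intro hk
        have hprev := ih (by omega)
        have hO := hord k (by omega)
        have hO' := hord (k + 1) hk
        rw [w.position_succ (by omega), mul_assoc] at hO'
        set π := w.position k * π₀ with hπ
        have hcase : ∀ p q : Fin s, strand F p (node k) < strand F q (node k) →
            strand F q (node (k + 1)) < strand F p (node (k + 1)) →
            s(π p, π q) = s(⟨w[k].1, by omega⟩, ⟨w[k].1 + 1, by omega⟩) := by
          intro p q h1 h2
          have h3 := (hO.lt_iff _ _).2 h1
          have h4 := (hO'.lt_iff _ _).2 h2
          rw [Equiv.Perm.mul_apply, Equiv.Perm.mul_apply] at h4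
          rcases adjacentSwap_lt_iff _ h4 with h5 | ⟨h5, h6⟩
          · exact absurd h3 h5.not_gt
          · rw [Sym2.eq_iff]
            exact Or.inl ⟨Fin.ext h6, Fin.ext h5⟩
        by_contra hnot
        have hrev : strand F j (node (k + 1)) < strand F i (node (k + 1)) := by
          refine lt_of_le_of_ne (not_lt.1 hnot) fun he => ?_
          exact (hord (k + 1) hk).not_meet ⟨j, i, hij.symm, he⟩
        have e1 := hcase i j hprev hrev
        have e2 : s(π i', π j') = s(⟨w[k].1, by omega⟩, ⟨w[k].1 + 1, by omega⟩) := by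
          have hp1 := hprop (node k)
          have hp2 := hprop (node (k + 1))
          rcases lt_or_gt_of_ne hc with hc | hc
          · rw [Sym2.eq_swap]
            refine hcase j' i' ?_ ?_
            · nlinarith
            · nlinarith
          · refine hcase i' j' ?_ ?_
            · nlinarith
            · nlinarith
        have e3 : Sym2.map π s(i', j') = Sym2.map π s(i, j) := by
          rw [Sym2.map_mk, Sym2.map_mk]
          exact e2.trans e1.symm
        exact hne (Sym2.map.injective π.injective e3)
    have h := hk w.length le_rfl
    rw [hl, ← zero_add (2 * Real.pi), hstrand, hstrand] at h
    exact h
  have hiter : ∀ (i j i' j' : Fin s), i ≠ j → s(i', j') ≠ s(i, j) →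
      (∀ t, strand F i' t - strand F j' t = c * (strand F i t - strand F j t)) →
      strand F i 0 < strand F j 0 →
      ∀ n, strand F (succ^[n] i) 0 < strand F (succ^[n] j) 0 := by
    intro i j i' j' hij hne hprop hlt n
    induction n generalizing i j i' j' with
    | zero => exact hlt
    | succ n ih =>
      rw [Function.iterate_succ_apply, Function.iterate_succ_apply]
      refine ih (succ i) (succ j) (succ i') (succ j') (hsuccinj.ne hij) ?_ ?_
        (hpers i j i' j' hij hne hprop hlt)
      · intro h
        rw [← Sym2.map_mk, ← Sym2.map_mk] at h
        exact hne (Sym2.map.injective hsuccinj h)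
      · intro t
        have := hprop (t + 2 * Real.pi)
        simpa only [hstrand] using this
  have hreach : ∀ i m : Fin s, ∃ n, succ^[n] i = m := by
    intro i m
    have hval : ∀ n, ((succ^[n] i : Fin s) : ℕ) = ((i : ℕ) + n) % s := by
      intro n
      induction n with
      | zero => simp [Nat.mod_eq_of_lt i.2]
      | succ n ih =>
        rw [Function.iterate_succ_apply']
        show (((succ^[n] i : Fin s) : ℕ) + 1) % s = _
        rw [ih, Nat.mod_add_mod, add_assoc]
    refine ⟨(m : ℕ) + (s - i), Fin.ext ?_⟩
    rw [hval, show (i : ℕ) + ((m : ℕ) + (s - i)) = m + s by omega, Nat.add_mod_right,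
      Nat.mod_eq_of_lt m.2]
  -- Passing to successors repeatedly, i becomes the rightmost strand at height 0, which cannot be
  -- to the left of another.
  have hcontra : ∀ (i j i' j' : Fin s), i ≠ j → s(i', j') ≠ s(i, j) →
      (∀ t, strand F i' t - strand F j' t = c * (strand F i t - strand F j t)) →
      ¬ strand F i 0 < strand F j 0 := by
    intro i j i' j' hij hne hprop hlt
    have : Nonempty (Fin s) := ⟨i⟩
    obtain ⟨m, hm⟩ := Finite.exists_max fun q : Fin s => strand F q 0
    obtain ⟨n, hn⟩ := hreach i m
    have := hiter i j i' j' hij hne hprop hlt n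
    rw [hn] at this
    exact absurd this (not_lt.2 (hm _))
  have hz : strand F i 0 ≠ strand F j 0 := by
    intro he
    have := (hord 0 (Nat.zero_le _)).not_meet
    rw [h0] at this
    exact this ⟨i, j, hij, he⟩
  rcases lt_or_gt_of_ne hz with h | h
  · exact hcontra i j i' j' hij hne hprop h
  · refine hcontra j i j' i' hij.symm (by rwa [Sym2.eq_swap, Sym2.eq_swap (a := j)]) ?_ h
    intro t
    linarith [hprop t]

end Perturbation

/-! ### Crossings of the strands -/

section StrandCrossings

variable {s : ℕ} {X : Fin s → ℝ → ℝ}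

theorem isClosed_meet (hX : ∀ i, Continuous (X i)) : IsClosed {t | Meet X t} := by
  have : {t | Meet X t} = ⋃ x : {x : Fin s × Fin s // x.1 ≠ x.2},
      {t | X x.1.1 t = X x.1.2 t} := by
    ext t
    simp [Meet]
  rw [this]
  exact isClosed_iUnion_of_finite fun x => isClosed_eq (hX _) (hX _)

/-- A difference of two strands is a trigonometric polynomial in t/s, non-zero by transversality; t
↦ e^{it/s} is injective on [0, 2π] because s ≥ 2. -/
theorem finite_meet {d : ℕ} (hs : 2 ≤ s) {F : ℝ → ℝ} (hF : IsTrigPoly d (fun t => (F t : ℂ)))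
    (hg : IsGeneric s F) : {t ∈ Set.Icc 0 (2 * Real.pi) | IsCrossingTime s F t}.Finite := by
  have hs0 : (s : ℝ) ≠ 0 := by
    have : s ≠ 0 := by omega
    exact_mod_cast this
  have hs2 : (2 : ℝ) ≤ s := by exact_mod_cast hs
  have hpair : ∀ i j : Fin s, i ≠ j →
      {t ∈ Set.Icc 0 (2 * Real.pi) | strand F i t = strand F j t}.Finite := by
    intro i j hij
    have hst : ∀ i : Fin s, IsTrigPoly d (fun x => ((strand F i (s * x) : ℝ) : ℂ)) := by
      intro i
      refine (hF.comp_add (2 * Real.pi * (i : ℕ) / s)).congr fun x => ?_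
      rw [strand_eq, mul_div_cancel_left₀ _ hs0]
    obtain ⟨Z, -, hZ⟩ := ((hst i).sub (hst j)).exists_zero_finset (by
      by_contra! h
      have h' : strand F i = strand F j := by
        funext t
        have := h (t / s)
        rw [mul_div_cancel₀ _ hs0, sub_eq_zero] at this
        exact_mod_cast this
      exact (hg 0 i j hij (congrFun h' 0)).1 (by rw [h']))
    refine Set.Finite.of_finite_image (f := fun t : ℝ => Complex.exp ((t / s : ℝ) * Complex.I))
      (Z.finite_toSet.subset ?_) ?_
    · rintro _ ⟨t, ⟨-, ht⟩, rfl⟩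
      apply hZ
      rw [mul_div_cancel₀ _ hs0, ht, sub_self]
    · rintro x ⟨⟨hx0, hx1⟩, -⟩ y ⟨⟨hy0, hy1⟩, -⟩ hxy
      obtain ⟨n, hn⟩ := Complex.exp_eq_exp_iff_exists_int.1 hxy
      have h1 : x / s = y / s + n * (2 * Real.pi) := by
        have : ((x / s : ℝ) : ℂ) = ((y / s + n * (2 * Real.pi) : ℝ) : ℂ) := by
          apply mul_right_cancel₀ Complex.I_ne_zero
          rw [hn]
          push_cast
          ring
        exact_mod_cast this
      have h2 : x = y + n * (2 * Real.pi) * s := by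
        field_simp at h1
        linarith
      have hpi := Real.pi_pos
      have hn0 : n = 0 := by
        have h5 : (n : ℝ) < 1 := by
          by_contra! h
          have : 2 * Real.pi * 2 ≤ n * (2 * Real.pi) * s := by
            have : 2 * Real.pi ≤ n * (2 * Real.pi) := by nlinarith
            nlinarith
          linarith
        have h6 : (-1 : ℝ) < n := by
          by_contra! h
          have : 2 * Real.pi * 2 ≤ -n * (2 * Real.pi) * s := by
            have : 2 * Real.pi ≤ -n * (2 * Real.pi) := by nlinarith
            nlinarith
          linarith
        have h7 : n < 1 := by exact_mod_cast h5
        have h8 : -1 < n := by exact_mod_cast h6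
        omega
      rw [h2, hn0]
      simp
  refine (Set.finite_iUnion fun x : {x : Fin s × Fin s // x.1 ≠ x.2} =>
    hpair x.1.1 x.1.2 x.2).subset ?_
  rintro t ⟨ht, i, j, hij, h⟩
  exact Set.mem_iUnion.2 ⟨⟨(i, j), hij⟩, ht, h⟩

/-- Neither of the two meeting curves is counted, so the count is at most s - 2. -/
theorem exists_isLetterAt {t : ℝ} (h : Meet X t) : ∃ l, IsLetterAt X l t := by
  classical
  obtain ⟨i, j, hij, he⟩ := h
  have hlt : Nat.card {q : Fin s // X q t < X i t} < s - 1 := by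
    rw [Nat.card_eq_fintype_card, Fintype.card_subtype]
    have hsub : (Finset.univ.filter fun q => X q t < X i t) ⊆ (Finset.univ.erase i).erase j := by
      intro q hq
      simp only [Finset.mem_filter, Finset.mem_univ, true_and] at hq
      simp only [Finset.mem_erase, Finset.mem_univ, and_true]
      constructor
      · rintro rfl
        exact hq.ne he.symm
      · rintro rfl
        exact lt_irrefl _ hq
    have h1 := Finset.card_le_card hsub
    rw [Finset.card_erase_of_mem (by simp [hij.symm]), Finset.card_erase_of_mem (by simp),
      Finset.card_univ, Fintype.card_fin] at h1
    have : i.val ≠ j.val := fun h => hij (Fin.ext h)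
    omega
  exact ⟨⟨_, hlt⟩, i, j, hij, he, rfl⟩

/-- The sign of the critical value between two strands close to their crossing. -/
theorem exists_hasCriticalSign {F : ℝ → ℝ} (hX : ∀ i : Fin s, Continuous (strand F i))
    (hg : IsGeneric s F) {i j : Fin s} (hij : i ≠ j) {t₀ : ℝ}
    (he : strand F i t₀ = strand F j t₀) : ∃ v : ℝ, v ≠ 0 ∧ HasCriticalSign F i j t₀ v := by
  classical
  set J := (Finset.univ.erase i).erase j with hJ
  set H : ℝ × ℝ → ℝ := fun x => ∏ q ∈ J, (x.1 - strand F q x.2) with hH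
  have hHc : Continuous H := by
    refine continuous_finsetProd _ fun q _ => ?_
    exact continuous_fst.sub ((hX q).comp continuous_snd)
  set x₀ := strand F i t₀ with hx₀
  have hH0 : H (x₀, t₀) ≠ 0 := by
    refine Finset.prod_ne_zero_iff.2 fun q hq => ?_
    simp only [hJ, Finset.mem_erase, Finset.mem_univ, and_true] at hq
    refine sub_ne_zero.2 fun h => ?_
    have := (hg t₀ i j hij he).2 i q hq.2.symm h
    rcases Sym2.eq_iff.1 this with ⟨-, h⟩ | ⟨h, -⟩
    · exact hq.1 h
    · exact hij h
  -- Between the two roots their factors have negative product, and the remaining factors keep the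
  -- sign of H near the crossing.
  refine ⟨-H (x₀, t₀), neg_ne_zero.2 hH0, ?_⟩
  have hev : ∀ᶠ x in nhds (x₀, t₀), 0 < H (x₀, t₀) * H x := by
    have h1 : 0 < H (x₀, t₀) * H (x₀, t₀) := mul_self_pos.2 hH0
    exact (continuous_const.mul hHc).continuousAt.eventually (lt_mem_nhds h1)
  rw [nhds_prod_eq, Filter.eventually_prod_iff] at hev
  obtain ⟨p, hp, r, hr, hpr⟩ := hev
  obtain ⟨ε, hε, hball⟩ := Metric.eventually_nhds_iff.1 hp
  have hi : ∀ᶠ t in nhds t₀, dist (strand F i t) x₀ < ε :=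
    (hX i).continuousAt.eventually (Metric.ball_mem_nhds x₀ hε)
  have hj : ∀ᶠ t in nhds t₀, dist (strand F j t) x₀ < ε := by
    have := (hX j).continuousAt.eventually (Metric.ball_mem_nhds (strand F j t₀) hε)
    rwa [← he] at this
  refine Filter.Eventually.filter_mono nhdsWithin_le_nhds ?_
  filter_upwards [hi, hj, hr] with t hti htj htr c hc1 hc2 _
  have hc : dist c x₀ < ε := by
    rw [Real.dist_eq, abs_lt] at *
    rcases le_total (strand F i t) (strand F j t) with h | h
    · rw [min_eq_left h] at hc1
      rw [max_eq_right h] at hc2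
      constructor <;> linarith
    · rw [min_eq_right h] at hc1
      rw [max_eq_left h] at hc2
      constructor <;> linarith
  have hpos := hpr (hball hc) htr
  have hneg : (c - strand F i t) * (c - strand F j t) < 0 := by
    rcases le_total (strand F i t) (strand F j t) with h | h
    · rw [min_eq_left h] at hc1
      rw [max_eq_right h] at hc2
      exact mul_neg_of_pos_of_neg (by linarith) (by linarith)
    · rw [min_eq_right h] at hc1
      rw [max_eq_left h] at hc2
      exact mul_neg_of_neg_of_pos (by linarith) (by linarith)
  have hprod : ∏ q : Fin s, (c - strand F q t) =
      (c - strand F i t) * ((c - strand F j t) * H (c, t)) := by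
    rw [← Finset.mul_prod_erase Finset.univ _ (Finset.mem_univ i),
      ← Finset.mul_prod_erase (Finset.univ.erase i) _
        (Finset.mem_erase.2 ⟨hij.symm, Finset.mem_univ j⟩)]
  rw [hprod]
  nlinarith [mul_pos (neg_pos.2 hneg) hpos]

theorem GenericFamily.comp_add (hg : GenericFamily X) (a : ℝ) :
    GenericFamily (fun i t => X i (t + a)) := by
  intro t i j hij h
  obtain ⟨h1, h2⟩ := hg (t + a) i j hij h
  refine ⟨?_, h2⟩
  rw [deriv_comp_add_const, deriv_comp_add_const]
  exact h1

end StrandCrossings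

/-! ### Existence of an execution -/

theorem exists_gap {s : ℕ} {f : Fin s → ℝ} (hf : StrictMono f) :
    ∃ g > 0, ∀ p q, p < q → f p + g ≤ f q := by
  cases isEmpty_or_nonempty {x : Fin s × Fin s // x.1 < x.2} with
  | inl h => exact ⟨1, one_pos, fun p q hpq => (h.false ⟨(p, q), hpq⟩).elim⟩
  | inr h =>
    obtain ⟨m, hm⟩ := Finite.exists_min fun x : {x : Fin s × Fin s // x.1 < x.2} =>
      f x.1.2 - f x.1.1
    refine ⟨f m.1.2 - f m.1.1, sub_pos.2 (hf m.2), fun p q hpq => ?_⟩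
    have := hm ⟨(p, q), hpq⟩
    simp only at this
    linarith

namespace InterpolationData

variable {s : ℕ} {w : BraidWord s} (D : InterpolationData w)

theorem exists_interpolation : ∃ F : ℝ → ℝ, IsTrigPoly (s * w.length / 2) (fun t => (F t : ℂ)) ∧
    ∀ (j : Fin s) (k : Fin w.length), F ((D.node k.castSucc + 2 * Real.pi * (j : ℕ)) / s) =
      D.level (w.strandPosition D.base j k) := by
  have hs : (0 : ℝ) < s := by
    have := D.two_le
    exact_mod_cast (by omega : 0 < s)
  have hpi := Real.pi_pos
  have hnode : ∀ k : Fin w.length, 0 ≤ D.node k.castSucc ∧ D.node k.castSucc < 2 * Real.pi := by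
    intro k
    rw [← D.node_zero, ← D.node_last]
    exact ⟨D.node_strictMono.monotone (Fin.zero_le _), D.node_strictMono (Fin.castSucc_lt_last k)⟩
  -- The height 2π is left out, so all data points are distinct in [0, 2π).
  have hx : ∀ x y : Fin s × Fin w.length, x ≠ y →
      (D.node x.2.castSucc + 2 * Real.pi * (x.1 : ℕ)) / s ≠
        (D.node y.2.castSucc + 2 * Real.pi * (y.1 : ℕ)) / s ∧
      |(D.node x.2.castSucc + 2 * Real.pi * (x.1 : ℕ)) / s -
        (D.node y.2.castSucc + 2 * Real.pi * (y.1 : ℕ)) / s| < 2 * Real.pi := by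
    rintro ⟨j, k⟩ ⟨j', k'⟩ hne
    have hk := hnode k
    have hk' := hnode k'
    constructor
    · intro h
      apply hne
      simp only at h
      field_simp at h
      have h1 : (j : ℕ) = (j' : ℕ) := by
        have h2 : ((j : ℕ) : ℝ) < (j' : ℕ) + 1 := by
          by_contra! h
          nlinarith
        have h3 : ((j' : ℕ) : ℝ) < (j : ℕ) + 1 := by
          by_contra! h
          nlinarith
        have h4 : (j : ℕ) < (j' : ℕ) + 1 := by exact_mod_cast h2
        have h5 : (j' : ℕ) < (j : ℕ) + 1 := by exact_mod_cast h3
        omega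
      rw [h1] at h
      have h6 := D.node_strictMono.injective (add_right_cancel h)
      rw [Prod.mk.injEq]
      exact ⟨Fin.ext h1, Fin.castSucc_injective _ h6⟩
    · have hb : ∀ (j : Fin s) (k : Fin w.length),
          0 ≤ (D.node k.castSucc + 2 * Real.pi * (j : ℕ)) / s ∧
          (D.node k.castSucc + 2 * Real.pi * (j : ℕ)) / s < 2 * Real.pi := by
        intro j k
        have hk := hnode k
        refine ⟨div_nonneg (by have := hk.1; positivity) hs.le, ?_⟩
        rw [div_lt_iff₀ hs]
        have hj : ((j : ℕ) : ℝ) + 1 ≤ s := by exact_mod_cast j.2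
        nlinarith
      have h1 := hb j k
      have h2 := hb j' k'
      rw [abs_lt]
      constructor <;> linarith [h1.1, h1.2, h2.1, h2.2]
  obtain ⟨F, hF, hFv⟩ := exists_trig_interpolation
    (fun x : Fin s × Fin w.length => (D.node x.2.castSucc + 2 * Real.pi * (x.1 : ℕ)) / s)
    (fun x => D.level (w.strandPosition D.base x.1 x.2)) hx
  refine ⟨F, ?_, fun j k => hFv (j, k)⟩
  simpa using hF

/-- The height `t_k`. -/
noncomputable def nodeAt (k : ℕ) : ℝ := if h : k < w.length + 1 then D.node ⟨k, h⟩ else 0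

theorem nodeAt_val (k : Fin (w.length + 1)) : D.nodeAt k = D.node k := by
  simp [nodeAt, k.2]

theorem nodeAt_zero : D.nodeAt 0 = 0 := by
  rw [← D.node_zero, ← D.nodeAt_val]
  rfl

theorem nodeAt_last : D.nodeAt w.length = 2 * Real.pi := by
  rw [← D.node_last, ← D.nodeAt_val]
  rfl

theorem nodeAt_lt {k : ℕ} (hk : k < w.length) : D.nodeAt k < D.nodeAt (k + 1) := by
  have h1 := D.nodeAt_val ⟨k, by omega⟩
  have h2 := D.nodeAt_val ⟨k + 1, by omega⟩
  simp only at h1 h2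
  rw [h1, h2]
  exact D.node_strictMono (by simp [Fin.lt_def])

end InterpolationData

/-! ### Consecutive numbering of the strands along the cycle. -/

namespace BraidWord

variable {s : ℕ} {w : BraidWord s}

theorem pow_position_apply_eq_iff (hc : (w.position w.length).IsCycleOn Set.univ) (a : Fin s)
    (m n : ℕ) :
    (w.position w.length ^ m) a = (w.position w.length ^ n) a ↔ m ≡ n [MOD s] := by
  have hc' : (w.position w.length).IsCycleOn ((Finset.univ : Finset (Fin s)) : Set (Fin s)) := by
    rwa [Finset.coe_univ]
  have := hc'.pow_apply_eq_pow_apply (m := m) (n := n) (Finset.mem_univ a)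
  rwa [Finset.card_univ, Fintype.card_fin] at this

/-- The start positions of the consecutive strands. -/
noncomputable def startPerm (hc : (w.position w.length).IsCycleOn Set.univ) (b : Fin s) :
    Equiv.Perm (Fin s) :=
  Equiv.ofBijective (fun j => (w.position w.length ^ (j : ℕ)) b)
    (Finite.injective_iff_bijective.1 fun i j h => by
      have := (pow_position_apply_eq_iff hc b i j).1 h
      rw [Nat.ModEq, Nat.mod_eq_of_lt i.2, Nat.mod_eq_of_lt j.2] at this
      exact Fin.ext this)

end BraidWord

namespace InterpolationData

variable {s : ℕ} {w : BraidWord s} (D : InterpolationData w)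

/-- The height 2π is not among the data: strand j ends there where strand j + 1 starts, and for j =
s - 1 the numbering closes up because the cycle has length s. -/
theorem strand_nodeAt (hc : (w.position w.length).IsCycleOn Set.univ) {F : ℝ → ℝ}
    (hF : Function.Periodic F (2 * Real.pi))
    (hFv : ∀ (j : Fin s) (k : Fin w.length), F ((D.node k.castSucc + 2 * Real.pi * (j : ℕ)) / s) =
      D.level (w.strandPosition D.base j k)) (j : Fin s) {k : ℕ} (hk : k ≤ w.length) :
    strand F j (D.nodeAt k) = D.level (w.strandPosition D.base j k) := by
  have hlt : ∀ (j : Fin s) (k : ℕ), k < w.length →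
      strand F j (D.nodeAt k) = D.level (w.strandPosition D.base j k) := by
    intro j k hk
    have h := hFv j ⟨k, hk⟩
    have h1 := D.nodeAt_val (Fin.castSucc ⟨k, hk⟩)
    rw [← h1] at h
    exact h
  rcases hk.lt_or_eq with hk | rfl
  · exact hlt j k hk
  · have hs : 0 < s := j.pos
    rw [D.nodeAt_last, ← zero_add (2 * Real.pi), strand_two_pi hs hF, ← D.nodeAt_zero,
      hlt _ 0 D.length_pos]
    congr 1
    have h1 : (w.position w.length ^ (((j : ℕ) + 1) % s)) D.base =
        (w.position w.length ^ ((j : ℕ) + 1)) D.base :=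
      (BraidWord.pow_position_apply_eq_iff hc _ _ _).2 (Nat.mod_modEq _ _)
    rw [pow_succ'] at h1
    exact h1

/-- A generic parametrization which keeps the order of the strands at all the heights `t_k`. -/
theorem exists_generic_parametrization (hc : (w.position w.length).IsCycleOn Set.univ)
    {F : ℝ → ℝ} (hF : IsTrigPoly (s * w.length / 2) (fun t => (F t : ℂ)))
    (hFv : ∀ (j : Fin s) (k : Fin w.length), F ((D.node k.castSucc + 2 * Real.pi * (j : ℕ)) / s) =
      D.level (w.strandPosition D.base j k)) {η : ℝ} (hη : 0 < η) :
    ∃ a b : ℝ, |a| < η ∧ |b| < η ∧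
      IsGeneric s (fun t => F t + (0 + a * Real.cos t + b * Real.sin t)) ∧
      ∀ k ≤ w.length, OrderedBy (strand fun t => F t + (0 + a * Real.cos t + b * Real.sin t))
        (w.position k * BraidWord.startPerm hc D.base) (D.nodeAt k) := by
  have hper : Function.Periodic F (2 * Real.pi) := fun t => by exact_mod_cast hF.periodic t
  obtain ⟨g, hg, hgap⟩ := exists_gap D.level_strictMono
  have hnode : ∀ (j : Fin s) {k : ℕ}, k ≤ w.length → strand F j (D.nodeAt k) =
      D.level ((w.position k * BraidWord.startPerm hc D.base) j) :=
    fun j k hk => D.strand_nodeAt hc hper hFv j hk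
  have hord : ∀ k ≤ w.length, OrderedBy (strand F)
      (w.position k * BraidWord.startPerm hc D.base) (D.nodeAt k) := by
    intro k hk i j hij
    rw [hnode i hk, hnode j hk]
    exact D.level_strictMono hij
  -- Coefficients below g/4 move each strand by less than g/2, half the smallest gap between levels.
  obtain ⟨a, b, ha, hb, hgen⟩ := exists_isGeneric hF (fun i j i' j' hij _ hne c hc' =>
    exists_sub_ne_mul_sub F hper w D.nodeAt D.nodeAt_zero D.nodeAt_last _ hord hij hne hc')
    (lt_min hη (by positivity : 0 < g / 4))
  rw [lt_min_iff] at ha hb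
  refine ⟨a, b, ha.1, hb.1, hgen, fun k hk i j hij => ?_⟩
  have hsmall : ∀ x, |a * Real.cos x + b * Real.sin x| < g / 2 := by
    intro x
    have h1 : |a * Real.cos x| ≤ |a| := by
      rw [abs_mul]
      exact mul_le_of_le_one_right (abs_nonneg a) (Real.abs_cos_le_one x)
    have h2 : |b * Real.sin x| ≤ |b| := by
      rw [abs_mul]
      exact mul_le_of_le_one_right (abs_nonneg b) (Real.abs_sin_le_one x)
    have := abs_add_le (a * Real.cos x) (b * Real.sin x)
    linarith [ha.2, hb.2]
  have hi := hnode i hk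
  have hj := hnode j hk
  have hij' := hgap _ _ hij
  rw [← hi, ← hj] at hij'
  simp only [strand] at hij' ⊢
  have h1 := abs_lt.1 (hsmall ((D.nodeAt k + 2 * Real.pi * (i : ℕ)) / s))
  have h2 := abs_lt.1 (hsmall ((D.nodeAt k + 2 * Real.pi * (j : ℕ)) / s))
  linarith [h1.2, h2.1]

end InterpolationData

/-- A small shift of the variable. -/
theorem exists_shift {s d : ℕ} (hs : 2 ≤ s) {F : ℝ → ℝ} (hF : IsTrigPoly d (fun t => (F t : ℂ)))
    (hg : IsGeneric s F) (h0 : ¬ IsCrossingTime s F 0) {η : ℝ} (hη : 0 < η) :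
    ∃ x, 0 < x ∧ x < η ∧ (∀ t ∈ Set.Icc 0 x, ¬ IsCrossingTime s F t) ∧
      ¬ IsCrossingTime s F (Real.pi + x) := by
  have hpi := Real.pi_pos
  have hXc : ∀ i : Fin s, Continuous (strand F i) := fun i =>
    (contDiff_strand (contDiff_of_isTrigPoly hF) i).continuous
  have hopen : ∀ᶠ t in nhds (0 : ℝ), ¬ IsCrossingTime s F t :=
    (isClosed_meet hXc).isOpen_compl.mem_nhds h0
  obtain ⟨ε, hε, hball⟩ := Metric.eventually_nhds_iff.1 hopen
  -- The crossings other than a possible one at π are finite in number, so a small shift away from π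
  -- meets none of them.
  have hfin := (finite_meet hs hF hg).subset
    (Set.sdiff_subset (s := {t ∈ Set.Icc 0 (2 * Real.pi) | IsCrossingTime s F t}) (t := {Real.pi}))
  have hnear : ∀ᶠ t in nhds Real.pi,
      t ∉ {t ∈ Set.Icc 0 (2 * Real.pi) | IsCrossingTime s F t} \ {Real.pi} :=
    hfin.isClosed.isOpen_compl.mem_nhds fun h => h.2 rfl
  obtain ⟨ε', hε', hball'⟩ := Metric.eventually_nhds_iff.1 hnear
  obtain ⟨x, hx0, hx⟩ := exists_between (lt_min (lt_min hη hε) (lt_min hε' hpi))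
  simp only [lt_min_iff] at hx
  obtain ⟨⟨h1, h2⟩, h3, h4⟩ := hx
  refine ⟨x, hx0, h1, fun t ht => hball ?_, fun h => ?_⟩
  · rw [Real.dist_eq, sub_zero, abs_of_nonneg ht.1]
    exact ht.2.trans_lt h2
  · refine hball' (y := Real.pi + x) ?_ ⟨⟨⟨by linarith, by linarith⟩, h⟩, ?_⟩
    · rw [Real.dist_eq, add_sub_cancel_left, abs_of_pos hx0]
      exact h3
    · intro h
      have : Real.pi + x = Real.pi := h
      linarith

theorem nonempty_execution {s : ℕ} {w : BraidWord s}
    (hc : (w.position w.length).IsCycleOn Set.univ) (D : InterpolationData w) {η : ℝ}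
    (hη : 0 < η) : Nonempty (Execution w D η) := by
  classical
  have hs := D.two_le
  have hpi := Real.pi_pos
  obtain ⟨F, hF, hFv⟩ := D.exists_interpolation
  obtain ⟨a, b, ha, hb, hgen, hord⟩ := D.exists_generic_parametrization hc hF hFv hη
  set Fg : ℝ → ℝ := fun t => F t + (0 + a * Real.cos t + b * Real.sin t) with hFg
  have hN : 1 ≤ s * w.length / 2 := by
    have : 2 * 1 ≤ s * w.length := Nat.mul_le_mul hs D.length_pos
    omega
  have hFgt : IsTrigPoly (s * w.length / 2) (fun t => (Fg t : ℂ)) := by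
    refine (hF.add ((((IsTrigPoly.cos.mono hN).const_mul (a : ℂ))).add
      ((IsTrigPoly.sin.mono hN).const_mul (b : ℂ)))).congr fun t => ?_
    simp only [hFg]
    push_cast
    ring
  have hper : Function.Periodic Fg (2 * Real.pi) := fun t => by exact_mod_cast hFgt.periodic t
  have h0 : ¬ IsCrossingTime s Fg 0 := by
    rw [← D.nodeAt_zero]
    exact (hord 0 (Nat.zero_le _)).not_meet
  obtain ⟨x, hx0, hxη, hxc, hxpi⟩ := exists_shift hs hFgt hgen h0 hη
  set Ft : ℝ → ℝ := fun t => Fg (t + x / s) with hFt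
  have hstrand : ∀ (j : Fin s) t, strand Ft j t = strand Fg j (t + x) := by
    intro j t
    simp only [strand, hFt]
    congr 1
    ring
  have hcross : ∀ t, IsCrossingTime s Ft t ↔ IsCrossingTime s Fg (t + x) := by
    intro t
    simp only [IsCrossingTime, hstrand]
  have hFtt : IsTrigPoly (s * w.length / 2) (fun t => (Ft t : ℂ)) := hFgt.comp_add _
  have hgen' : IsGeneric s Ft := by
    have h := GenericFamily.comp_add (X := strand Fg) hgen x
    have hfun : (fun (i : Fin s) t => strand Fg i (t + x)) = strand Ft := by
      funext i t
      exact (hstrand i t).symm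
    rw [hfun] at h
    exact h
  have hXd : ∀ i : Fin s, Differentiable ℝ (strand Ft i) := fun i =>
    (contDiff_strand (contDiff_of_isTrigPoly hFtt) i).differentiable (by norm_num)
  set C := (finite_meet hs hFtt hgen').toFinset
  set time : Fin C.card → ℝ := fun k => C.orderEmbOfFin rfl k with htime
  have hmono : StrictMono time := (C.orderEmbOfFin rfl).strictMono
  have hrange : Set.range time = {t ∈ Set.Icc 0 (2 * Real.pi) | IsCrossingTime s Ft t} := by
    rw [htime]
    exact (Finset.range_orderEmbOfFin C rfl).trans (Set.Finite.coe_toFinset _)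
  have htimemem : ∀ k, time k ∈ Set.Icc 0 (2 * Real.pi) ∧ IsCrossingTime s Ft (time k) := by
    intro k
    have : time k ∈ Set.range time := Set.mem_range_self k
    rw [hrange] at this
    exact this
  have hlet : ∀ t, ∃ l : Fin (s - 1), Meet (s := s) (strand Ft) t → IsLetterAt (strand Ft) l t := by
    intro t
    by_cases h : Meet (s := s) (strand Ft) t
    · obtain ⟨l, hl⟩ := exists_isLetterAt h
      exact ⟨l, fun _ => hl⟩
    · exact ⟨⟨0, by omega⟩, fun h' => absurd h' h⟩
  choose lt hlt using hlet
  have hpq : ∀ k, IsLetterAt (strand Ft) (lt (time k)) (time k) := fun k =>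
    hlt _ (htimemem k).2
  choose p q hne heq hcard using hpq
  have hval := fun k => exists_hasCriticalSign (fun i => (hXd i).continuous) hgen' (hne k) (heq k)
  choose v hv0 hvs using hval
  have hpos : ∀ k, 0 < time k := by
    intro k
    refine (htimemem k).1.1.lt_of_ne fun h => ?_
    have h1 := (htimemem k).2
    rw [← h, hcross, zero_add] at h1
    exact hxc x ⟨hx0.le, le_rfl⟩ h1
  have hcos : ∀ k, Real.cos (time k / 2) ≠ 0 := by
    intro k h
    have h1 := (htimemem k).1.2
    have h2 := hpos k
    have h3 : time k / 2 = Real.pi / 2 := by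
      apply Real.injOn_cos ⟨by linarith, by linarith⟩ ⟨by linarith, by linarith⟩
      rw [h, Real.cos_pi_div_two]
    have h4 : time k = Real.pi := by linarith
    have h5 := (htimemem k).2
    rw [h4, hcross] at h5
    exact hxpi h5
  -- The data y is v cos(t_k/2), so that the interpolated quotient is exactly v.
  have hyv : ∀ k, v k * Real.cos (time k / 2) / Real.cos (time k / 2) = v k := fun k =>
    mul_div_cancel_right₀ _ (hcos k)
  -- The shift moves the heights of the word to t_k - x. The windows [0, 2π] and (-x, 2π - x)
  -- contain the same crossings, as none lies in [0, x] before the shift.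
  have hTmem : ∀ t, t ∈ List.ofFn time ↔
      (D.nodeAt 0 - x < t ∧ t < D.nodeAt w.length - x) ∧ Meet (s := s) (strand Ft) t := by
    intro t
    have h1 : t ∈ List.ofFn time ↔ t ∈ Set.Icc 0 (2 * Real.pi) ∧ IsCrossingTime s Ft t := by
      rw [List.mem_ofFn]
      exact Set.ext_iff.1 hrange t
    rw [h1, D.nodeAt_zero, D.nodeAt_last]
    constructor
    · rintro ⟨⟨h2, h3⟩, h4⟩
      refine ⟨⟨by linarith, ?_⟩, h4⟩
      by_contra! h5
      rw [hcross, ← sub_add_cancel (t + x) (2 * Real.pi)] at h4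
      exact hxc _ ⟨by linarith, by linarith⟩ (h4.sub_two_pi hper)
    · rintro ⟨⟨h2, h3⟩, h4⟩
      refine ⟨⟨?_, by linarith⟩, h4⟩
      by_contra! h5
      exact hxc (t + x) ⟨by linarith, by linarith⟩ ((hcross t).1 h4)
  obtain ⟨V, hV1, hV2⟩ := exists_signed_word hXd hgen' lt hlt w (fun k => D.nodeAt k - x)
    (fun k hk => by
      have := D.nodeAt_lt hk
      linarith)
    (BraidWord.startPerm hc D.base) (fun k hk i j hij => by
      rw [hstrand, hstrand, sub_add_cancel]
      exact hord k hk i j hij) w.length le_rfl (List.ofFn time)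
    (List.pairwise_ofFn.2 fun i j hij => hmono hij) hTmem
  rw [List.take_length] at hV2
  have hVlen : V.length = C.card := by
    have := congrArg List.length hV1
    simpa using this
  set sgn : Fin C.card → ℤˣ := fun k => (V[(k : ℕ)]'(by omega)).2 with hsgn
  have hVeq : (List.ofFn fun k => (lt (time k), sgn k)) = V := by
    refine List.ext_getElem (by simp [hVlen]) fun n h1 h2 => ?_
    have h3 : (V.map Prod.fst)[n]'(by simpa using h2) =
        ((List.ofFn time).map lt)[n]'(by simpa using h1) := by
      simp only [hV1]
    simp only [List.getElem_map, List.getElem_ofFn] at h3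
    rw [List.getElem_ofFn]
    exact Prod.ext h3.symm rfl
  obtain ⟨At, hAt, hAtv, hAte⟩ := exists_trig_interpolation_arg time v
    (fun k => ((sgn k : ℤ) : ℝ)) hv0 (fun k l hkl => by
      refine ⟨hmono.injective.ne hkl, ?_⟩
      have h1 := hpos k
      have h2 := hpos l
      have h3 := (htimemem k).1.2
      have h4 := (htimemem l).1.2
      rw [abs_lt]
      constructor <;> linarith)
  exact ⟨{
    F := F
    F_trig := hF
    F_interpolates := hFv
    Fgen := Fg
    Fgen_eq := ⟨0, a, b, by simpa using hη, ha, hb, fun t => rfl⟩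
    Fgen_generic := hgen
    Fgen_order := fun k i j hij => by
      rw [← D.nodeAt_val]
      exact hord k (Nat.lt_succ_iff.1 k.2) i j hij
    shift := x
    shift_small := by rwa [abs_of_pos hx0]
    shift_no_crossing := fun t ht => hxc t (by rwa [Set.uIcc_of_le hx0.le] at ht)
    Ft := Ft
    Ft_eq := fun t => rfl
    Ft_pi := fun h => hxpi ((hcross _).1 h)
    crossings := C.card
    time := time
    time_strictMono := hmono
    range_time := hrange
    fst := p
    snd := q
    fst_ne_snd := hne
    fst_eq_snd := heq
    letter := fun k => lt (time k)
    letter_eq := hcard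
    sign := sgn
    sign_isotopic := by rw [hVeq, hV2]
    y := fun k => v k * Real.cos (time k / 2)
    y_sign := fun k => by
      rw [hyv]
      exact hvs k
    At := At
    At_trig := hAt
    At_value := fun k => by
      rw [hyv]
      exact hAtv k
    At_arg := hAte }⟩

theorem corollary1 {s : ℕ} (w : BraidWord s) (hw : IsNontrivialKnot w.closure)
    (D : InterpolationData w) (η : ℝ) (hη : 0 < η) :
    Nonempty (Execution w D η) ∧
    ∀ R : Execution w D η, ∃ (k m : ℕ) (f : MvPolynomial (Fin 3) ℂ),
      IsLeast {k' | R.AdmissibleK k'} k ∧ IsLeast {m' | R.AdmissibleM k m'} m ∧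
      R.IsOutput k m f ∧ f.totalDegree ≤ 2 * s * w.length * (s + 1) + 1 :=
  ⟨nonempty_execution (w.isCycleOn_of_isKnot hw.1) D hη, fun R => R.exists_output⟩
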